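/- Let $H$ be a complex Hilbert space with scalar product $(\cdot,\cdot)$ and let $(K,[\cdot,\cdot])$ be a Pontryagin space of some finite negative index $\kappa_K$. For a bounded operator $\Gamma:H\to K$ let $\Gamma^+:K\to H$ be defined by $(h,\Gamma^+k)=[\Gamma h,k]$; $\rho$ denotes the resolvent set. *Terminology.* $N_\kappa(H)$ is the class of functions $Q:D(Q)\to L(H)$ that are meromorphic in $\mathbb C\setminus\mathbb R$, satisfy $Q(\bar z)^*=Q(z)$ for $z \in D(Q)$, and whose kernel $\frac{Q(z)-Q(w)^*}{z-\bar w}$, $z,w\in D(Q)\cap\mathbb C^+$, has $\kappa$ negative squares. A point $\beta\in\mathbb C$ is a generalized pole of $Q$ if it is an eigenvalue of the self-adjoint linear relation $S$ in a minimal representation $$Q(z)=Q(z_0)^*+(z-\bar z_0)\,\Gamma^+\bigl(I+(z-z_0)(S-z)^{-1}\bigr)\Gamma$$ of $Q$ in a Pontryagin space, where $z_0\in\rho(S)\cap D(Q)\cap\mathbb C^+$ and minimality means that the vectors $(I+(z-z_0)(S-z)^{-1})\Gamma h$, $z\in\rho(S)$, $h\in H$, span a dense subspace; $\beta$ is a generalized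 zero of $Q$ if it is a generalized pole of $\hat Q(z):=-Q(z)^{-1}$, whose domain is $\{z\in D(Q): Q(z)\text{ boundedly invertible}\}$. A representation $\Gamma^+(A-z)^{-1}\Gamma$ with a bounded self-adjoint operator $A$ in a Pontryagin space $K$ is minimal if the vectors $(A-z)^{-1}\Gamma h$, $z\in\rho(A)$, $h\in H$, span a dense subspace of $K$. **Theorem.** Let $A$ be a bounded self-adjoint operator in $K$, let $\Gamma_0:H\to K$ be bounded, and let $Q(z)=\Gamma_0^+(A-z)^{-1}\Gamma_0$, $z\in\rho(A)$, belong to $N_\kappa(H)$. Let $\alpha\in\mathbb R$ be a generalized pole of $Q$, and assume that $\Gamma_0^+\Gamma_0=-\lim_{z\to\infty}zQ(z)$ is boundedly invertible. Put $P=\Gamma_0(\Gamma_0^+\Gamma_0)^{-1}\Gamma_0^+$, and let $\tilde A=(I-P)A(I-P)$ and $\tilde\Gamma=(I-P)A\Gamma_0(\Gamma_0^+\Gamma_0)^{-1}$ be regarded as operators in $(I-P)K$ and from $H$ to $(I-P)K$. Then $\hat Q:=-Q^{-1}$ belongs to $N_\kappa(H)$, its domain is contained in $\rho(\tilde A)$,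 and on it $\hat Q=\hat Q_1+\hat Q_2$, where $$\hat Q_1(z)=-(\Gamma_0^+\Gamma_0)^{-1}\Gamma_0^+(A-z)\Gamma_0(\Gamma_0^+\Gamma_0)^{-1},\qquad \hat Q_2(z)=\tilde\Gamma^+(\tilde A-z)^{-1}\tilde\Gamma ,$$ $\hat Q_1\in N_{\hat\kappa_1}(H)$ on $\mathbb C$, $\hat Q_2\in N_{\hat\kappa_2}(H)$ on $\rho(\tilde A)$, and $\hat\kappa_1+\hat\kappa_2=\kappa$. Moreover: (i) $\hat Q_1$ is a polynomial in $z$ of degree at most one and has no generalized pole in $\mathbb C$; it may have a generalized zero at $\alpha$ (for every real $\alpha$ there are $A$ and $\Gamma_0$, with $H=K=\mathbb C$, that satisfy the hypotheses and for which $\hat Q_1$ has a generalized zero at $\alpha$). (ii) $\hat\kappa_1$ is the number of negative eigenvalues, counted with multiplicity, of the self-adjoint operator $(\Gamma_0^+\Gamma_0)^{-1}$ in $H$. (iii) If $Q$ has a generalized zero at $\alpha$, then $\hat Q_2$ has a generalized pole at $\alpha$. (iv) $(I-P)K$ is a Pontryagin space of negative index $\kappa_K-\hat\kappa_1$, and $\tilde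 A$ is self-adjoint in it. If the given representation of $Q$ is minimal, then this index is $\hat\kappa_2$ and $\hat Q_2(z)=\tilde\Gamma^+(\tilde A-z)^{-1}\tilde\Gamma$ is a minimal representation. -/

import Mathlib

open scoped ComplexConjugate InnerProductSpace

universe u v

noncomputable section

section Pontryagin

variable {H : Type u} [NormedAddCommGroup H] [InnerProductSpace ℂ H]
variable {K : Type v} [NormedAddCommGroup K] [NormedSpace ℂ K]

/-- `K` with the indefinite inner product `[x, y] = B y x` (so `B` is conjugate-linear in its first
argument) is a Pontryagin space of index `κ`, and the norm of `K` is one of the equivalent norms of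
its Hilbert space topology: `K` is complete, `B` is Hermitian, and `K` is the direct
`B`-orthogonal sum of a uniformly positive subspace and a `κ`-dimensional negative definite one. -/
structure IsPontryaginSpace (B : K →L⋆[ℂ] K →L[ℂ] ℂ) (κ : ℕ) : Prop where
  complete : CompleteSpace K
  hermitian : ∀ x y : K, conj (B x y) = B y x
  decomposition : ∃ Kp Km : Submodule ℂ K, IsCompl Kp Km ∧
    (∀ x ∈ Kp, ∀ y ∈ Km, B x y = 0) ∧
    (∃ c : ℝ, 0 < c ∧ ∀ x ∈ Kp, c * ‖x‖ ^ 2 ≤ (B x x).re) ∧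
    (∀ x ∈ Km, x ≠ 0 → (B x x).re < 0) ∧
    FiniteDimensional ℂ Km ∧ Module.finrank ℂ Km = κ

/-- The restriction of an indefinite inner product to a subspace. -/
def restrictForm (B : K →L⋆[ℂ] K →L[ℂ] ℂ) (N : Submodule ℂ K) : N →L⋆[ℂ] N →L[ℂ] ℂ :=
  B.bilinearComp N.subtypeL N.subtypeL

/-- A bounded operator that is self-adjoint with respect to the indefinite inner product. -/
def IsFormSelfAdjoint (B : K →L⋆[ℂ] K →L[ℂ] ℂ) (A : K →L[ℂ] K) : Prop :=
  ∀ x y : K, B (A x) y = B x (A y)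

/-- The operator `Γ⁺ : K → H` of a bounded operator `Γ : H → K`, see `inner_gammaPlus`. -/
def gammaPlus [CompleteSpace H] (B : K →L⋆[ℂ] K →L[ℂ] ℂ) (Γ : H →L[ℂ] K) : K →L[ℂ] H :=
  ((InnerProductSpace.toDual ℂ H).symm : (H →L[ℂ] ℂ) →L⋆[ℂ] H).comp
    (((ContinuousLinearMap.compL ℂ H K ℂ).flip Γ).comp B)

theorem inner_gammaPlus [CompleteSpace H] (B : K →L⋆[ℂ] K →L[ℂ] ℂ) (Γ : H →L[ℂ] K) (k : K)
    (h : H) : ⟪gammaPlus B Γ k, h⟫_ℂ = B k (Γ h) := by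
  simp [gammaPlus]

/-- `A` is a self-adjoint linear relation: `A` coincides with its adjoint
`{(x, y) | [y, s] = [x, t] for all (s, t) ∈ A}`. -/
def IsSelfAdjointRelation (B : K →L⋆[ℂ] K →L[ℂ] ℂ) (A : Submodule ℂ (K × K)) : Prop :=
  ∀ p : K × K, p ∈ A ↔ ∀ q ∈ A, B q.1 p.2 = B q.2 p.1

/-- `R` is `(A - z)⁻¹ = {(k, x) | (x, k + z x) ∈ A}`, an everywhere defined bounded operator. -/
def IsRelationResolvent (A : Submodule ℂ (K × K)) (z : ℂ) (R : K →L[ℂ] K) : Prop :=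
  ∀ k x : K, (x, k + z • x) ∈ A ↔ x = R k

/-- The resolvent set `ρ(A)` of a linear relation. -/
def relationResolventSet (A : Submodule ℂ (K × K)) : Set ℂ :=
  {z | ∃ R : K →L[ℂ] K, IsRelationResolvent A z R}

open Classical in
/-- The resolvent `(A - z)⁻¹` of a linear relation, for `z ∈ ρ(A)` (and `0` otherwise). -/
def relationResolvent (A : Submodule ℂ (K × K)) (z : ℂ) : K →L[ℂ] K :=
  if h : ∃ R : K →L[ℂ] K, IsRelationResolvent A z R then h.choose else 0

/-- `α` is an eigenvalue of the linear relation `A`. -/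
def IsRelationEigenvalue (A : Submodule ℂ (K × K)) (α : ℂ) : Prop :=
  ∃ x : K, x ≠ 0 ∧ (x, α • x) ∈ A

end Pontryagin

section Nevanlinna

variable {H : Type u} [NormedAddCommGroup H] [InnerProductSpace ℂ H] [CompleteSpace H]

/-- The Nevanlinna kernel `N_Q(z, w) = (Q(z) - Q(w)*) / (z - w̄)`. -/
def nevanlinnaKernel (Q : ℂ → H →L[ℂ] H) (z w : ℂ) : H →L[ℂ] H :=
  (z - conj w)⁻¹ • (Q z - ContinuousLinearMap.adjoint (Q w))

/-- The Hermitian matrix `(N_Q(zᵢ, zⱼ) hᵢ, hⱼ)` (the scalar product `(f, g)`, linear in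
`f`, is `⟪g, f⟫` here). -/
def nevanlinnaMatrix (Q : ℂ → H →L[ℂ] H) {n : ℕ} (z : Fin n → ℂ) (h : Fin n → H) :
    Matrix (Fin n) (Fin n) ℂ :=
  Matrix.of fun i j => ⟪h j, nevanlinnaKernel Q (z i) (z j) (h i)⟫_ℂ

open Classical in
/-- The number of negative eigenvalues, with multiplicity, of a Hermitian matrix. -/
def negativeEigenvalueCount {n : ℕ} (M : Matrix (Fin n) (Fin n) ℂ) : ℕ :=
  if hM : M.IsHermitian then (Finset.univ.filter fun i => hM.eigenvalues i < 0).card else 0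

theorem nevanlinnaMatrix_isHermitian (Q : ℂ → H →L[ℂ] H) {n : ℕ} (z : Fin n → ℂ)
    (h : Fin n → H) : (nevanlinnaMatrix Q z h).IsHermitian := by
  ext i j
  simp only [Matrix.conjTranspose_apply, nevanlinnaMatrix, nevanlinnaKernel, Matrix.of_apply]
  rw [← starRingEnd_apply, inner_conj_symm]
  simp only [smul_apply, sub_apply, inner_smul_left,
    inner_smul_right, inner_sub_left, inner_sub_right, ContinuousLinearMap.adjoint_inner_left,
    ContinuousLinearMap.adjoint_inner_right, map_inv₀, map_sub, Complex.conj_conj]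
  rw [← neg_sub (z i), inv_neg]
  ring

/-- `Q : D → L(H)` is a generalized Nevanlinna function of index `κ`. (Values of `Q` outside `D`
are irrelevant; the nonreal points outside `D` are isolated.) -/
structure IsGeneralizedNevanlinna (D : Set ℂ) (Q : ℂ → H →L[ℂ] H) (κ : ℕ) : Prop where
  meromorphic : MeromorphicOn Q {z | z.im ≠ 0}
  domain_codiscrete : D ∈ Filter.codiscreteWithin {z : ℂ | z.im ≠ 0}
  analytic : AnalyticOnNhd ℂ Q (D ∩ {z | z.im ≠ 0})
  symmetric : ∀ z ∈ D, conj z ∈ D ∧ ContinuousLinearMap.adjoint (Q (conj z)) = Q z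
  negativeSquares_le : ∀ (n : ℕ) (z : Fin n → ℂ) (h : Fin n → H),
    (∀ i, z i ∈ D ∧ 0 < (z i).im) → negativeEigenvalueCount (nevanlinnaMatrix Q z h) ≤ κ
  negativeSquares_attained : ∃ (n : ℕ) (z : Fin n → ℂ) (h : Fin n → H),
    (∀ i, z i ∈ D ∧ 0 < (z i).im) ∧ negativeEigenvalueCount (nevanlinnaMatrix Q z h) = κ

/-- `Q` is represented on `D` by the self-adjoint relation `A` and the operator `Γ`, with point of
reference `z₀`:
`Q(z) = Q(z₀)* + (z - z̄₀) Γ⁺ (I + (z - z₀)(A - z)⁻¹) Γ`. -/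
structure IsRelationRepresentation {K : Type v} [NormedAddCommGroup K] [NormedSpace ℂ K]
    (D : Set ℂ) (Q : ℂ → H →L[ℂ] H) (B : K →L⋆[ℂ] K →L[ℂ] ℂ) (A : Submodule ℂ (K × K))
    (Γ : H →L[ℂ] K) (z₀ : ℂ) : Prop where
  pontryagin : ∃ κ : ℕ, IsPontryaginSpace B κ
  selfAdjoint : IsSelfAdjointRelation B A
  reference_mem : z₀ ∈ D ∧ z₀ ∈ relationResolventSet A ∧ 0 < z₀.im
  formula : ∀ z ∈ D ∩ relationResolventSet A,
    Q z = ContinuousLinearMap.adjoint (Q z₀) + (z - conj z₀) •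
      (gammaPlus B Γ ∘L (1 + (z - z₀) • relationResolvent A z) ∘L Γ)

/-- Minimality: `K = cls {(I + (z - z₀)(A - z)⁻¹) Γ h : z ∈ ρ(A), h ∈ H}`. -/
def IsMinimalRelation {K : Type v} [NormedAddCommGroup K] [NormedSpace ℂ K]
    (A : Submodule ℂ (K × K)) (Γ : H →L[ℂ] K) (z₀ : ℂ) : Prop :=
  (Submodule.span ℂ {k : K | ∃ z ∈ relationResolventSet A, ∃ h : H,
    k = ((1 : K →L[ℂ] K) + (z - z₀) • relationResolvent A z) (Γ h)}).topologicalClosure = ⊤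

/-- `α` is a generalized pole of `Q : D → L(H)`: it is an eigenvalue of the relation in a minimal
representation of `Q` (which is unique up to isomorphism). -/
def IsGeneralizedPole (D : Set ℂ) (Q : ℂ → H →L[ℂ] H) (α : ℂ) : Prop :=
  ∃ (K : Type v) (_ : NormedAddCommGroup K) (_ : NormedSpace ℂ K)
    (B : K →L⋆[ℂ] K →L[ℂ] ℂ) (A : Submodule ℂ (K × K)) (Γ : H →L[ℂ] K) (z₀ : ℂ),
    IsRelationRepresentation D Q B A Γ z₀ ∧ IsMinimalRelation A Γ z₀ ∧ IsRelationEigenvalue A α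

/-- The domain of the inverse function `-Q(z)⁻¹` of `Q : D → L(H)`. -/
def hatDomain (D : Set ℂ) (Q : ℂ → H →L[ℂ] H) : Set ℂ := {z ∈ D | IsUnit (Q z)}

/-- The inverse function `Q̂(z) = -Q(z)⁻¹`. -/
def hatFun (Q : ℂ → H →L[ℂ] H) : ℂ → H →L[ℂ] H := fun z => -Ring.inverse (Q z)

/-- A generalized zero of `Q` is a generalized pole of `-Q⁻¹`. -/
def IsGeneralizedZero (D : Set ℂ) (Q : ℂ → H →L[ℂ] H) (α : ℂ) : Prop :=
  IsGeneralizedPole.{u, v} (hatDomain D Q) (hatFun Q) α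

end Nevanlinna

section Operators

variable {H : Type u} [NormedAddCommGroup H] [InnerProductSpace ℂ H] [CompleteSpace H]
variable {K : Type v} [NormedAddCommGroup K] [NormedSpace ℂ K]

/-- `z ↦ Γ⁺ (A - z)⁻¹ Γ`, a function on `ρ(A)`, for a bounded operator `A`. -/
def resolventFun (B : K →L⋆[ℂ] K →L[ℂ] ℂ) (A : K →L[ℂ] K) (Γ : H →L[ℂ] K) :
    ℂ → H →L[ℂ] H :=
  fun z => gammaPlus B Γ ∘L Ring.inverse (A - z • (1 : K →L[ℂ] K)) ∘L Γ

/-- Minimality of `z ↦ Γ⁺ (A - z)⁻¹ Γ`: `K = cls {(A - z)⁻¹ Γ h : z ∈ ρ(A), h ∈ H}`. -/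
def IsMinimalOperator (A : K →L[ℂ] K) (Γ : H →L[ℂ] K) : Prop :=
  (Submodule.span ℂ {k : K | ∃ z ∈ resolventSet ℂ A, ∃ h : H,
    k = Ring.inverse (A - z • (1 : K →L[ℂ] K)) (Γ h)}).topologicalClosure = ⊤

/-- `(Γ⁺ Γ)⁻¹`. -/
def gramInverse (B : K →L⋆[ℂ] K →L[ℂ] ℂ) (Γ : H →L[ℂ] K) : H →L[ℂ] H :=
  Ring.inverse (gammaPlus B Γ ∘L Γ)

/-- `P = Γ (Γ⁺ Γ)⁻¹ Γ⁺`. -/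
def gramProjection (B : K →L⋆[ℂ] K →L[ℂ] ℂ) (Γ : H →L[ℂ] K) : K →L[ℂ] K :=
  Γ ∘L gramInverse B Γ ∘L gammaPlus B Γ

/-- The subspace `(I - P) K`. -/
def complementSpace (B : K →L⋆[ℂ] K →L[ℂ] ℂ) (Γ : H →L[ℂ] K) : Submodule ℂ K :=
  LinearMap.range ((1 - gramProjection B Γ : K →L[ℂ] K) : K →ₗ[ℂ] K)

/-- `I - P` as an operator from `K` onto `(I - P) K`. -/
def complementProj (B : K →L⋆[ℂ] K →L[ℂ] ℂ) (Γ : H →L[ℂ] K) :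
    K →L[ℂ] complementSpace B Γ :=
  (1 - gramProjection B Γ : K →L[ℂ] K).codRestrict _ fun x => ⟨x, rfl⟩

/-- `Ã = (I - P) A (I - P)` as an operator in `(I - P) K`. -/
def tildeA (B : K →L⋆[ℂ] K →L[ℂ] ℂ) (A : K →L[ℂ] K) (Γ : H →L[ℂ] K) :
    complementSpace B Γ →L[ℂ] complementSpace B Γ :=
  complementProj B Γ ∘L A ∘L (1 - gramProjection B Γ) ∘L (complementSpace B Γ).subtypeL

/-- `Γ̃ = (I - P) A Γ (Γ⁺ Γ)⁻¹` as an operator from `H` to `(I - P) K`. -/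
def tildeGamma (B : K →L⋆[ℂ] K →L[ℂ] ℂ) (A : K →L[ℂ] K) (Γ : H →L[ℂ] K) :
    H →L[ℂ] complementSpace B Γ :=
  complementProj B Γ ∘L A ∘L Γ ∘L gramInverse B Γ

/-- `Q̂₁(z) = -(Γ⁺ Γ)⁻¹ Γ⁺ (A - z) Γ (Γ⁺ Γ)⁻¹`. -/
def hatFun₁ (B : K →L⋆[ℂ] K →L[ℂ] ℂ) (A : K →L[ℂ] K) (Γ : H →L[ℂ] K) : ℂ → H →L[ℂ] H :=
  fun z => -(gramInverse B Γ ∘L gammaPlus B Γ ∘L (A - z • (1 : K →L[ℂ] K)) ∘L Γ ∘L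
    gramInverse B Γ)

/-- `Q̂₂(z) = Γ̃⁺ (Ã - z)⁻¹ Γ̃`, the adjoint `Γ̃⁺` being taken in `(I - P) K`. -/
def hatFun₂ (B : K →L⋆[ℂ] K →L[ℂ] ℂ) (A : K →L[ℂ] K) (Γ : H →L[ℂ] K) : ℂ → H →L[ℂ] H :=
  resolventFun (restrictForm B (complementSpace B Γ)) (tildeA B A Γ) (tildeGamma B A Γ)

/-- The span of all eigenvectors of `T` with negative eigenvalue; its dimension is the number of
negative eigenvalues, with multiplicity, of a self-adjoint operator `T` in `H`. -/
def negativeEigenspace (T : H →L[ℂ] H) : Submodule ℂ H :=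
  ⨆ μ : {μ : ℝ // μ < 0}, Module.End.eigenspace (T : H →ₗ[ℂ] H) ((μ : ℝ) : ℂ)

end Operators

end

open scoped ComplexConjugate InnerProductSpace
open Filter Topology

noncomputable section

/-! Write `G = Γ⁺Γ` and `R(z) = (A - z)⁻¹`. Since `G` is invertible, `P` is the orthogonal
projection onto `ran Γ`, and `K` is the orthogonal sum of `ran Γ` and `(I - P)K = ker Γ⁺`. In this
decomposition `A - z` is a two-by-two block operator and `Q(z)` is essentially the corner of its
inverse, so `-Q(z)⁻¹` is a Schur complement: `Q̂₁` comes from the corner of `A - z`, `Q̂₂` from the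
complementary block `Ã - z` and the off-diagonal block `Γ̃`. Concretely, the field `γ̂(z) = ΓG⁻¹ -
(Ã - z)⁻¹Γ̃` satisfies `Γ⁺γ̂(z) = I` and `(A - z)γ̂(z) = -Γ(Q̂₁(z) + Q̂₂(z))`
(`sub_apply_hatGamma`); applying `Γ⁺R(z)` gives the inverse. For `z ∈ ρ(A)`, `Q(z)` is invertible
exactly when `z ∈ ρ(Ã)` (`hatDomain_eq`).

Negative squares are counted geometrically. Each Nevanlinna kernel here is a Gram kernel: of `R(z)Γ`
for `Q`, of `γ̂(z)` for `Q̂`, of the constant field `ΓG⁻¹` for `Q̂₁`, of `(Ã - z)⁻¹Γ̃` for `Q̂₂`.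
The number of negative squares is therefore the largest dimension of a negative definite subspace of
the span of the field (`hasNegativeIndex_upperSpan_iff`). This index depends only on the closure of
the span (`HasNegativeIndex.of_closure_eq`), and the closure does not depend on the nodes
(`cyclicSpan_eq`), because off the real axis `R(z)` is a quotient of analytic functions
(`exists_resolvent_denominator`). From `γ̂(z)Q(z) = R(z)Γ` it follows that `Q̂` and `Q` have the
same index. The closed span contains `ran Γ`, the limit of `-zR(z)Γ` at infinity, so up to closure
it splits into `ran Γ` and the span of `(Ã - z)⁻¹Γ̃`; the indices of the orthogonal summands add up
(`index_add_index`).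

The kernel of `Q̂₁` is the constant `G⁻¹`. Hence the `Γ`-field of a minimal representation is
constant, the resolvent vanishes and there is no eigenvector; the index is the number of negative
eigenvalues of `G⁻¹` by its decomposition into positive and negative parts
(`rank_negativeEigenspace`). For generalized zeros, `A` is first compressed to a minimal
representation (`exists_minimal_compression`), which changes neither `Q` nor `Q̂₁`, hence not `Q̂₂`.
Equality of Gram kernels gives an isometry from any minimal representation of `Q̂` that carries its
`Γ`-field to `γ̂` (`IsPontryaginSpace.exists_isometry`). It intertwines `(S - w)⁻¹` with `(Ã -
w)⁻¹(I - P)`, so eigenvectors of `S` go to eigenvectors of `Ã`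
(`exists_eigenvector_of_intertwining`). Finally `I - P` maps `γ̂(z)` to `-(Ã - z)⁻¹Γ̃`, so
minimality passes to `Q̂₂`. -/

theorem InnerProductSpace.Core.exists_eq_inner {V : Type*} [AddCommGroup V] [Module ℂ V]
    [tV : UniformSpace V] [IsUniformAddGroup V] [ContinuousConstSMul ℂ V] [CompleteSpace V]
    (cd : InnerProductSpace.Core ℂ V)
    (h : ContinuousAt (fun v : V ↦ cd.inner v v) 0)
    (h' : Bornology.IsVonNBounded ℂ {v : V | (cd.inner v v).re < 1}) (f : V →L[ℂ] ℂ) :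
    ∃ y, ∀ x, f x = cd.inner y x := by
  let i1 : NormedAddCommGroup V := cd.toNormedAddCommGroupOfTopology h h'
  let i2 : InnerProductSpace ℂ V := InnerProductSpace.ofCoreOfTopology cd h h'
  -- `toDual` needs completeness for the uniformity of the new norm. Both uniformities are
  -- translation-invariant and induce the same topology, hence coincide.
  have huni : tV = i1.toMetricSpace.toUniformSpace := by
    apply IsUniformAddGroup.ext
    · infer_instance
    · infer_instance
    · rfl
  have : @CompleteSpace V i1.toMetricSpace.toUniformSpace := by
    rw [← huni]; infer_instance
  refine ⟨(InnerProductSpace.toDual ℂ V).symm f, fun x => ?_⟩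
  exact (InnerProductSpace.toDual_symm_apply (𝕜 := ℂ) (x := x) (y := f)).symm

/-! ### Hermitian forms and uniformly positive subspaces -/

section Forms

variable {V : Type*} [NormedAddCommGroup V] [NormedSpace ℂ V]

/-- A sesquilinear form is Hermitian. -/
def IsHermitianForm (b : V →L⋆[ℂ] V →L[ℂ] ℂ) : Prop := ∀ x y : V, conj (b x y) = b y x

theorem IsHermitianForm.im_self {b : V →L⋆[ℂ] V →L[ℂ] ℂ} (hb : IsHermitianForm b) (x : V) :
    (b x x).im = 0 := Complex.conj_eq_iff_im.mp (hb x x)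

theorem IsHermitianForm.eq_zero_symm {b : V →L⋆[ℂ] V →L[ℂ] ℂ} (hb : IsHermitianForm b) {x y : V}
    (h : b x y = 0) : b y x = 0 := by
  rw [← hb, h, map_zero]

theorem IsHermitianForm.restrict {b : V →L⋆[ℂ] V →L[ℂ] ℂ} (hb : IsHermitianForm b)
    (M : Submodule ℂ V) : IsHermitianForm (restrictForm b M) := fun x y => hb x y

@[simp]
theorem restrictForm_apply (b : V →L⋆[ℂ] V →L[ℂ] ℂ) (M : Submodule ℂ V) (x y : M) :
    restrictForm b M x y = b x y := rfl

/-- Riesz representation for a uniformly positive form on a complete space. -/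
theorem exists_eq_form_of_pos [CompleteSpace V] {b : V →L⋆[ℂ] V →L[ℂ] ℂ} (hb : IsHermitianForm b)
    {c : ℝ} (hc : 0 < c) (hpos : ∀ x, c * ‖x‖ ^ 2 ≤ (b x x).re) (f : V →L[ℂ] ℂ) :
    ∃ y, b y = f := by
  let cd : InnerProductSpace.Core ℂ V :=
    { inner := fun x y => b x y
      conj_inner_symm := fun x y => hb y x
      re_inner_nonneg := fun x => le_trans (by positivity) (hpos x)
      add_left := fun x y z => by simp
      smul_left := fun x y r => by simp
      definite := fun x hx => by
        have := hpos x
        rw [hx] at this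
        have h1 : ‖x‖ ^ 2 ≤ 0 := by
          by_contra hcon
          push Not at hcon
          have := mul_pos hc hcon
          simp at *
          linarith
        simpa using le_antisymm h1 (by positivity) }
  obtain ⟨y, hy⟩ := InnerProductSpace.Core.exists_eq_inner cd
    (by
      change ContinuousAt (fun v : V ↦ b v v) 0
      fun_prop)
    (by
      rw [NormedSpace.isVonNBounded_iff, isBounded_iff_forall_norm_le]
      refine ⟨√(1 / c), fun x hx => Real.le_sqrt_of_sq_le ?_⟩
      rw [le_div_iff₀ hc, mul_comm]
      exact (hpos x).trans (le_of_lt hx)) f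
  exact ⟨y, ContinuousLinearMap.ext fun x => (hy x).symm⟩

/-- Orthogonal projection onto a complete uniformly positive subspace. -/
theorem exists_sub_orthogonal_of_pos {b : V →L⋆[ℂ] V →L[ℂ] ℂ}
    (hb : IsHermitianForm b) (M : Submodule ℂ V) [CompleteSpace M] {c : ℝ} (hc : 0 < c)
    (hpos : ∀ x ∈ M, c * ‖x‖ ^ 2 ≤ (b x x).re) (x : V) :
    ∃ r ∈ M, ∀ m ∈ M, b (x - r) m = 0 := by
  obtain ⟨r, hr⟩ := exists_eq_form_of_pos (hb.restrict M) hc (fun y => hpos y y.2)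
    ((b x).comp M.subtypeL)
  refine ⟨r, r.2, fun m hm => ?_⟩
  have := DFunLike.congr_fun hr ⟨m, hm⟩
  simp at this
  simp [this]

/-- The form attains a positive minimum on the compact unit sphere of `M`; homogeneity spreads the
bound over `M`. -/
theorem exists_pos_bound_of_finiteDimensional {b : V →L⋆[ℂ] V →L[ℂ] ℂ} (M : Submodule ℂ V)
    [FiniteDimensional ℂ M] (hpos : ∀ x ∈ M, x ≠ 0 → 0 < (b x x).re) :
    ∃ c : ℝ, 0 < c ∧ ∀ x ∈ M, c * ‖x‖ ^ 2 ≤ (b x x).re := by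
  rcases subsingleton_or_nontrivial M with hM | hM
  · refine ⟨1, one_pos, fun x hx => ?_⟩
    have : (⟨x, hx⟩ : M) = 0 := Subsingleton.elim _ _
    have : x = 0 := congrArg Subtype.val this
    simp [this]
  · have : ProperSpace M := FiniteDimensional.proper ℂ M
    have hne : (Metric.sphere (0 : M) 1).Nonempty := by
      have : NormedSpace ℝ M := NormedSpace.restrictScalars ℝ ℂ M
      exact NormedSpace.sphere_nonempty.mpr zero_le_one
    obtain ⟨x₀, hx₀, hmin⟩ := (isCompact_sphere (0 : M) 1).exists_isMinOn hne
      (f := fun x : M => (b x x).re) (by fun_prop)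
    have hx0 : x₀ ≠ 0 := by
      rintro rfl; simp at hx₀
    refine ⟨(b x₀ x₀).re, hpos x₀ x₀.2 (by simpa using hx0), fun x hx => ?_⟩
    rcases eq_or_ne x 0 with rfl | hx'
    · simp
    · have hn : (‖x‖ : ℂ) ≠ 0 := by simpa using hx'
      have hs : ((‖x‖ : ℂ)⁻¹ • (⟨x, hx⟩ : M)) ∈ Metric.sphere (0 : M) 1 := by
        simp [norm_smul, hx']
      have := hmin hs
      simp only [Set.mem_ofPred_eq, Submodule.coe_smul, map_smulₛₗ, smul_apply,
        map_inv₀, Complex.conj_ofReal, smul_eq_mul, RingHom.id_apply] at this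
      rw [← mul_assoc, ← Complex.ofReal_inv, ← Complex.ofReal_mul, Complex.re_ofReal_mul] at this
      have h2 : 0 < ‖x‖ := by simpa using hx'
      have h3 := mul_le_mul_of_nonneg_right this (by positivity : 0 ≤ ‖x‖ ^ 2)
      calc _ ≤ _ := h3
        _ = _ := by field_simp

end Forms

/-- `q` factors through `V ⧸ ker q`, a normed space because the kernel is closed and
finite-dimensional because it embeds in `F`; every linear map on it is continuous. -/
theorem continuous_of_isClosed_ker_of_finiteDimensional {V F : Type*} [NormedAddCommGroup V]
    [NormedSpace ℂ V] [NormedAddCommGroup F] [NormedSpace ℂ F] [FiniteDimensional ℂ F]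
    (q : V →ₗ[ℂ] F) (hq : IsClosed (LinearMap.ker q : Set V)) : Continuous q := by
  have := hq
  have : FiniteDimensional ℂ (V ⧸ LinearMap.ker q) :=
    LinearEquiv.finiteDimensional q.quotKerEquivRange.symm
  have h1 : Continuous ((LinearMap.ker q).liftQ q le_rfl) :=
    LinearMap.continuous_of_finiteDimensional _
  exact h1.comp (LinearMap.ker q).mkQL.continuous

/-! ### Fundamental decompositions of Pontryagin spaces -/

section Pontryagin
variable {V : Type*} [NormedAddCommGroup V] [NormedSpace ℂ V]

theorem IsPontryaginSpace.isHermitianForm {b : V →L⋆[ℂ] V →L[ℂ] ℂ} {n : ℕ}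
    (h : IsPontryaginSpace b n) : IsHermitianForm b := h.hermitian

/-- A fundamental decomposition of a Pontryagin space, in terms of the projection onto the
negative summand. -/
theorem IsPontryaginSpace.exists_projection {b : V →L⋆[ℂ] V →L[ℂ] ℂ} {n : ℕ}
    (h : IsPontryaginSpace b n) : ∃ p : V →L[ℂ] V, (∀ x, p (p x) = p x) ∧
      (∀ x y, b (x - p x) (p y) = 0) ∧ (∃ c : ℝ, 0 < c ∧ ∀ x, p x = 0 → c * ‖x‖ ^ 2 ≤ (b x x).re) ∧
      (∀ x, p x ≠ 0 → (b (p x) (p x)).re < 0) ∧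
      FiniteDimensional ℂ (LinearMap.range (p : V →ₗ[ℂ] V)) ∧
      Module.finrank ℂ (LinearMap.range (p : V →ₗ[ℂ] V)) = n := by
  obtain ⟨Kp, Km, hc, horth, ⟨c, hc0, hpos⟩, hneg, hfin, hrank⟩ := h.decomposition
  have hdef : ∀ y ∈ Km, b y y = 0 → y = 0 := fun y hy h0 => by
    by_contra hne
    have := hneg y hy hne
    simp [h0] at this
  obtain ⟨q, hker, hq⟩ : ∃ q : V →ₗ[ℂ] Km, LinearMap.ker q = Kp ∧ ∀ y : Km, q y = y :=
    ⟨Km.projectionOnto Kp hc.symm, Submodule.ker_projectionOnto hc.symm,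
      fun y => Submodule.projectionOnto_apply_left hc.symm y⟩
  -- The definition does not ask `Kp` to be closed. It is closed because definiteness on `Km` makes
  -- it the whole orthogonal complement of `Km`; this makes the projection continuous.
  have hKp : (Kp : Set V) = ⋂ y ∈ Km, {x | b x y = 0} := by
    ext x
    simp only [SetLike.mem_coe, Set.mem_iInter, Set.mem_ofPred_eq]
    refine ⟨fun hx y hy => horth x hx y hy, fun hx => ?_⟩
    obtain ⟨a, ha, d, hd, rfl⟩ := Submodule.mem_sup.mp
      (hc.sup_eq_top ▸ Submodule.mem_top : x ∈ Kp ⊔ Km)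
    have h0 : b d d = 0 := by simpa [horth a ha d hd] using hx d hd
    simpa [hdef d hd h0] using ha
  have hclosed : IsClosed (LinearMap.ker q : Set V) := by
    rw [hker, hKp]
    exact isClosed_biInter fun y _ => isClosed_eq (by fun_prop) continuous_const
  have hcont : Continuous q := continuous_of_isClosed_ker_of_finiteDimensional q hclosed
  obtain ⟨p, hp⟩ : ∃ p : V →L[ℂ] V, ∀ x, p x = q x := ⟨Km.subtypeL ∘L ⟨q, hcont⟩, fun x => rfl⟩
  have hrange : LinearMap.range (p : V →ₗ[ℂ] V) = Km := by
    ext y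
    rw [LinearMap.mem_range]
    refine ⟨fun ⟨x, hx⟩ => ?_, fun hy => ⟨y, ?_⟩⟩
    · rw [← hx, ContinuousLinearMap.coe_coe, hp]
      exact (q x).2
    · rw [ContinuousLinearMap.coe_coe, hp, hq ⟨y, hy⟩]
  have hmem : ∀ x, x - q x ∈ Kp := fun x => by
    rw [← hker, LinearMap.mem_ker, map_sub, hq, sub_self]
  refine ⟨p, fun x => ?_, fun x y => ?_, ⟨c, hc0, fun x hx => ?_⟩, fun x hx => ?_, ?_, ?_⟩
  · rw [hp, hp, hq]
  · rw [hp, hp]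
    exact horth _ (hmem x) _ (q y).2
  · refine hpos x ?_
    rw [← hker, LinearMap.mem_ker]
    exact Subtype.ext ((hp x).symm.trans hx)
  · rw [hp] at hx ⊢
    exact hneg _ (q x).2 hx
  · rw [hrange]; exact hfin
  · rw [hrange]; exact hrank

/-- The Hilbert space form of a fundamental decomposition: `b (J x) y` is uniformly positive. -/
theorem IsPontryaginSpace.exists_symmetry {b : V →L⋆[ℂ] V →L[ℂ] ℂ} {n : ℕ}
    (h : IsPontryaginSpace b n) : ∃ p : V →L[ℂ] V, (∀ x, p (p x) = p x) ∧
      (∀ x y, b (p x) y = b x (p y)) ∧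
      FiniteDimensional ℂ (LinearMap.range (p : V →ₗ[ℂ] V)) ∧
      Module.finrank ℂ (LinearMap.range (p : V →ₗ[ℂ] V)) = n ∧
      (∃ c : ℝ, 0 < c ∧ ∀ x, p x = 0 → c * ‖x‖ ^ 2 ≤ (b x x).re) ∧
      IsHermitianForm (b.comp (1 - (2 : ℂ) • p)) ∧
      ∃ c : ℝ, 0 < c ∧ ∀ x, c * ‖x‖ ^ 2 ≤ (b.comp (1 - (2 : ℂ) • p) x x).re := by
  obtain ⟨p, hp, horth, ⟨c, hc, hpos⟩, hneg, hfin, hrank⟩ := h.exists_projection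
  have hsymm : ∀ x y, b (p x) y = b x (p y) := fun x y => by
    have h1 := horth x y
    have h2 := h.isHermitianForm.eq_zero_symm (horth y x)
    simp only [map_sub, sub_apply, sub_eq_zero] at h1 h2
    rw [h1, h2]
  obtain ⟨d, hd, hdneg⟩ := exists_pos_bound_of_finiteDimensional (b := -b)
    (LinearMap.range (p : V →ₗ[ℂ] V)) (by
      rintro _ ⟨x, rfl⟩ hx
      simpa using hneg x hx)
  -- The half in the constant pays for `‖x‖² ≤ 2 (‖x - p x‖² + ‖p x‖²)`.
  refine ⟨p, hp, hsymm, hfin, hrank, ⟨c, hc, hpos⟩, fun x y => ?_, min c d / 2, by positivity,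
    fun x => ?_⟩
  · simp [h.hermitian, hsymm, Complex.conj_ofNat]
  · have h1 := hpos (x - p x) (by simp [hp])
    have h2 := hdneg (p x) ⟨x, rfl⟩
    have h3 : ‖x‖ ≤ ‖x - p x‖ + ‖p x‖ := by simpa using norm_add_le (x - p x) (p x)
    have h4 : ‖x‖ ^ 2 ≤ 2 * (‖x - p x‖ ^ 2 + ‖p x‖ ^ 2) := by
      nlinarith [norm_nonneg x, sq_nonneg (‖x - p x‖ - ‖p x‖)]
    have h5 : b (p x) (p x) = b x (p x) := by rw [hsymm, hp]
    have h6 : (b.comp (1 - (2 : ℂ) • p) x x).re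
        = (b (x - p x) (x - p x)).re + ((-b) (p x) (p x)).re := by
      simp [hsymm, hp]
      ring
    rw [h6]
    have := min_le_left c d
    have := min_le_right c d
    have h7 : 0 < min c d := lt_min hc hd
    nlinarith [sq_nonneg ‖x - p x‖, sq_nonneg ‖p x‖]

/-- Riesz representation in a Pontryagin space. -/
theorem IsPontryaginSpace.exists_eq {b : V →L⋆[ℂ] V →L[ℂ] ℂ} {n : ℕ}
    (h : IsPontryaginSpace b n) (f : V →L[ℂ] ℂ) : ∃ y, b y = f := by
  have := h.complete
  obtain ⟨p, -, -, -, -, -, hherm, c, hc, hpos⟩ := h.exists_symmetry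
  obtain ⟨y, hy⟩ := exists_eq_form_of_pos hherm hc hpos f
  exact ⟨_, hy⟩

/-- Quantitative nondegeneracy: testing `b x` on `(1 - 2p) x` recovers the uniformly positive form.
The added `1` in the constant only keeps it positive. -/
theorem IsPontryaginSpace.exists_norm_le {b : V →L⋆[ℂ] V →L[ℂ] ℂ} {n : ℕ}
    (h : IsPontryaginSpace b n) : ∃ C : ℝ, 0 < C ∧ ∀ x, ‖x‖ ≤ C * ‖b x‖ := by
  obtain ⟨p, -, hsymm, -, -, -, hherm, c, hc, hpos⟩ := h.exists_symmetry
  refine ⟨c⁻¹ * (‖(1 - (2 : ℂ) • p)‖ + 1), by positivity, fun x => ?_⟩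
  rcases eq_or_ne x 0 with rfl | hx
  · simp
  have hx' : 0 < ‖x‖ := by simpa using hx
  have h1 : b.comp (1 - (2 : ℂ) • p) x x = b x ((1 - (2 : ℂ) • p) x) := by
    simp [hsymm, Complex.conj_ofNat]
  have h2 : c * ‖x‖ ^ 2 ≤ ‖b x‖ * (‖(1 - (2 : ℂ) • p)‖ * ‖x‖) := by
    refine (hpos x).trans ((Complex.re_le_norm _).trans ?_)
    rw [h1]
    exact ((b x).le_opNorm _).trans (by gcongr; exact ContinuousLinearMap.le_opNorm _ _)
  have h3 : c * ‖x‖ ≤ ‖b x‖ * ‖(1 - (2 : ℂ) • p)‖ := by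
    refine le_of_mul_le_mul_right ?_ hx'
    nlinarith
  rw [inv_mul_eq_div, div_mul_eq_mul_div, le_div_iff₀ hc]
  nlinarith [norm_nonneg (b x)]

theorem IsPontryaginSpace.eq_zero {b : V →L⋆[ℂ] V →L[ℂ] ℂ} {n : ℕ}
    (h : IsPontryaginSpace b n) {x : V} (hx : ∀ y, b x y = 0) : x = 0 := by
  obtain ⟨C, -, hC⟩ := h.exists_norm_le
  have : b x = 0 := ContinuousLinearMap.ext hx
  simpa [this] using hC x

theorem IsPontryaginSpace.eq_zero_of_dense {b : V →L⋆[ℂ] V →L[ℂ] ℂ} {n : ℕ}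
    (h : IsPontryaginSpace b n) {s : Set V} (hs : (Submodule.span ℂ s).topologicalClosure = ⊤)
    {x : V} (hx : ∀ y ∈ s, b x y = 0) : x = 0 := by
  refine h.eq_zero fun y => ?_
  have hle : Submodule.span ℂ s ≤ LinearMap.ker ((b x : V →L[ℂ] ℂ) : V →ₗ[ℂ] ℂ) :=
    Submodule.span_le.mpr fun y hy => hx y hy
  have := Submodule.topologicalClosure_minimal _ hle (b x).isClosed_ker
  rw [hs] at this
  exact this (Submodule.mem_top (x := y))

end Pontryagin

/-! ### The negative index of a subspace -/

section NegativeIndex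

variable {V : Type*} [NormedAddCommGroup V] [NormedSpace ℂ V]

/-- The form `b` is negative definite on all nontrivial combinations of the family `w`. -/
def IsNegativeFamily (b : V →L⋆[ℂ] V →L[ℂ] ℂ) {n : ℕ} (w : Fin n → V) : Prop :=
  ∀ c : Fin n → ℂ, c ≠ 0 → (b (∑ i, c i • w i) (∑ i, c i • w i)).re < 0

/-- The largest dimension of a negative definite subspace of `L` is `n`. -/
structure HasNegativeIndex (b : V →L⋆[ℂ] V →L[ℂ] ℂ) (L : Submodule ℂ V) (n : ℕ) : Prop where
  exists_family : ∃ w : Fin n → V, (∀ i, w i ∈ L) ∧ IsNegativeFamily b w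
  le : ∀ (k : ℕ) (w : Fin k → V), (∀ i, w i ∈ L) → IsNegativeFamily b w → k ≤ n

variable {b : V →L⋆[ℂ] V →L[ℂ] ℂ} {L L' : Submodule ℂ V} {m n : ℕ}

theorem HasNegativeIndex.unique (hm : HasNegativeIndex b L m) (hn : HasNegativeIndex b L n) :
    m = n := by
  obtain ⟨w, hw, hw'⟩ := hm.exists_family
  obtain ⟨u, hu, hu'⟩ := hn.exists_family
  exact le_antisymm (hn.le m w hw hw') (hm.le n u hu hu')

theorem exists_hasNegativeIndex_of_le {N : ℕ}
    (h : ∀ (k : ℕ) (w : Fin k → V), (∀ i, w i ∈ L) → IsNegativeFamily b w → k ≤ N) :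
    ∃ n ≤ N, HasNegativeIndex b L n := by
  classical
  let p : ℕ → Prop := fun k => ∃ w : Fin k → V, (∀ i, w i ∈ L) ∧ IsNegativeFamily b w
  have h0 : p 0 := ⟨Fin.elim0, fun i => i.elim0, fun c hc => (hc (Subsingleton.elim _ _)).elim⟩
  refine ⟨Nat.findGreatest p N, Nat.findGreatest_le N,
    ⟨Nat.findGreatest_spec (Nat.zero_le N) h0, fun k w hw hw' => ?_⟩⟩
  exact Nat.le_findGreatest (h k w hw hw') ⟨w, hw, hw'⟩

theorem IsNegativeFamily.cons (hb : IsHermitianForm b) {w : Fin n → V} (hw : IsNegativeFamily b w)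
    {x : V} (hx : ∀ i, b (w i) x = 0) (hneg : (b x x).re < 0) :
    IsNegativeFamily b (Fin.cons x w : Fin (n + 1) → V) := by
  intro c hc
  have h1 : b (∑ i : Fin n, c i.succ • w i) x = 0 := by simp [hx]
  have h2 := hb.eq_zero_symm h1
  rw [Fin.sum_univ_succ]
  simp only [Fin.cons_zero, Fin.cons_succ]
  set s := ∑ i : Fin n, c i.succ • w i with hs
  have h3 : b (c 0 • x + s) (c 0 • x + s) = (Complex.normSq (c 0) : ℂ) * b x x + b s s := by
    simp [h1, h2, Complex.normSq_eq_conj_mul_self, mul_assoc]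
  rw [h3, Complex.add_re, Complex.re_ofReal_mul]
  by_cases h4 : (fun i : Fin n => c i.succ) = 0
  · have h5 : c 0 ≠ 0 := by
      intro h5
      apply hc
      ext i
      refine Fin.cases h5 (fun j => congrFun h4 j) i
    have h6 : s = 0 := by
      rw [hs]
      exact Finset.sum_eq_zero fun i _ => by rw [congrFun h4 i]; simp
    simp only [h6, map_zero, Complex.zero_re, add_zero]
    exact mul_neg_of_pos_of_neg (Complex.normSq_pos.mpr h5) hneg
  · have := hw _ h4
    have h7 := mul_nonpos_of_nonneg_of_nonpos (Complex.normSq_nonneg (c 0)) hneg.le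
    simp only [← hs] at this
    linarith

/-- Maximality: the form is nonnegative on the complement of a maximal negative family. -/
theorem HasNegativeIndex.re_nonneg (hb : IsHermitianForm b) (hL : HasNegativeIndex b L n)
    {w : Fin n → V} (hwL : ∀ i, w i ∈ L) (hw : IsNegativeFamily b w) {x : V} (hx : x ∈ L)
    (hwx : ∀ i, b (w i) x = 0) : 0 ≤ (b x x).re := by
  by_contra hneg
  push Not at hneg
  have := hL.le (n + 1) _ (fun i => Fin.cases hx hwL i) (hw.cons hb hwx hneg)
  omega

/-- With more than `finrank F` vectors, some nontrivial combination is killed by `p`, and there the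
form would be both negative and nonnegative. -/
theorem IsNegativeFamily.le_finrank {F : Type*} [AddCommGroup F] [Module ℂ F]
    [FiniteDimensional ℂ F] {k : ℕ} {w : Fin k → V} (hw : IsNegativeFamily b w)
    (hwL : ∀ i, w i ∈ L) (p : V →ₗ[ℂ] F) (hp : ∀ x ∈ L, p x = 0 → 0 ≤ (b x x).re) :
    k ≤ Module.finrank ℂ F := by
  by_contra hlt
  push Not at hlt
  let φ : (Fin k → ℂ) →ₗ[ℂ] V := Fintype.linearCombination ℂ w
  have hφ : ∀ c, φ c = ∑ i, c i • w i := fun c => Fintype.linearCombination_apply ℂ w c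
  have hker : LinearMap.ker (p ∘ₗ φ) ≠ ⊥ := LinearMap.ker_ne_bot_of_finrank_lt (by simpa using hlt)
  obtain ⟨c, hc, hc0⟩ := (Submodule.ne_bot_iff _).mp hker
  have h1 := hw c hc0
  have h2 := hp (φ c) (by rw [hφ]; exact L.sum_mem fun i _ => L.smul_mem _ (hwL i)) hc
  rw [hφ] at h2
  linarith

/-- The index is attained by a family, and bounded by the rank of a map on whose kernel the form
is nonnegative. -/
theorem hasNegativeIndex_of_family {F : Type*} [AddCommGroup F] [Module ℂ F]
    [FiniteDimensional ℂ F] {w : Fin n → V} (hw : IsNegativeFamily b w)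
    (hwL : ∀ i, w i ∈ L) (p : V →ₗ[ℂ] F) (hp : ∀ x ∈ L, p x = 0 → 0 ≤ (b x x).re)
    (hn : Module.finrank ℂ F ≤ n) : HasNegativeIndex b L n :=
  ⟨⟨w, hwL, hw⟩, fun _ _ hu hu' => (hu'.le_finrank hu p hp).trans hn⟩

/-- The coefficients of a vector with respect to a family. -/
def formCoeff (b : V →L⋆[ℂ] V →L[ℂ] ℂ) {n : ℕ} (w : Fin n → V) : V →ₗ[ℂ] (Fin n → ℂ) :=
  LinearMap.pi fun i => ((b (w i) : V →L[ℂ] ℂ) : V →ₗ[ℂ] ℂ)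

@[simp]
theorem formCoeff_apply (w : Fin n → V) (x : V) (i : Fin n) : formCoeff b w x i = b (w i) x := rfl

/-- Negativity need only be tested on the compact unit sphere of coefficients, so it survives small
perturbations of the family. This is why the negative index does not change under closure. -/
theorem IsNegativeFamily.isOpen {k : ℕ} : IsOpen {w : Fin k → V | IsNegativeFamily b w} := by
  rw [isOpen_iff_mem_nhds]
  intro w hw
  have h1 : ∀ᶠ u in 𝓝 w, ∀ c ∈ Metric.sphere (0 : Fin k → ℂ) 1,
      (b (∑ i, c i • u i) (∑ i, c i • u i)).re < 0 := by
    refine (isCompact_sphere (0 : Fin k → ℂ) 1).eventually_forall_of_forall_eventually ?_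
    intro c hc
    have hc0 : c ≠ 0 := by rintro rfl; simp at hc
    have hcont : Continuous fun z : (Fin k → V) × (Fin k → ℂ) =>
      (b (∑ i, z.2 i • z.1 i) (∑ i, z.2 i • z.1 i)).re := by fun_prop
    exact hcont.continuousAt.eventually_lt continuousAt_const (hw c hc0)
  filter_upwards [h1] with u hu c hc
  have hn : 0 < ‖c‖ := by simpa using hc
  have h2 := hu (((‖c‖ : ℂ)⁻¹) • c) (by simp [norm_smul, hc])
  have h3 : ∑ i, (((‖c‖ : ℂ)⁻¹) • c) i • u i = ((‖c‖ : ℂ)⁻¹) • ∑ i, c i • u i := by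
    simp [Finset.smul_sum, smul_smul]
  rw [h3] at h2
  simp only [map_smulₛₗ, smul_apply, map_inv₀, Complex.conj_ofReal, smul_eq_mul,
    RingHom.id_apply] at h2
  rw [← mul_assoc, ← Complex.ofReal_inv, ← Complex.ofReal_mul, Complex.re_ofReal_mul] at h2
  by_contra hcon
  push Not at hcon
  have := mul_nonneg (by positivity : 0 ≤ ‖c‖⁻¹ * ‖c‖⁻¹) hcon
  linarith

theorem exists_negativeFamily_of_closure {k : ℕ} {w : Fin k → V}
    (hw : IsNegativeFamily b w) (hwL : ∀ i, w i ∈ L.topologicalClosure) :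
    ∃ u : Fin k → V, (∀ i, u i ∈ L) ∧ IsNegativeFamily b u := by
  have h1 : w ∈ closure (Set.univ.pi fun _ : Fin k => (L : Set V)) := by
    rw [closure_pi_set]
    exact fun i _ => hwL i
  obtain ⟨u, hu, hu'⟩ := mem_closure_iff.mp h1 _ IsNegativeFamily.isOpen hw
  exact ⟨u, fun i => hu' i trivial, hu⟩

theorem HasNegativeIndex.of_le_closure (h : HasNegativeIndex b L n) (h1 : L ≤ L')
    (h2 : L' ≤ L.topologicalClosure) : HasNegativeIndex b L' n := by
  obtain ⟨w, hw, hw'⟩ := h.exists_family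
  refine ⟨⟨w, fun i => h1 (hw i), hw'⟩, fun k u hu hu' => ?_⟩
  obtain ⟨u', hu1, hu2⟩ := exists_negativeFamily_of_closure hu' fun i => h2 (hu i)
  exact h.le k u' hu1 hu2

theorem HasNegativeIndex.of_closure_eq (h : HasNegativeIndex b L n)
    (h1 : L.topologicalClosure = L'.topologicalClosure) : HasNegativeIndex b L' n := by
  obtain ⟨w, hw, hw'⟩ := h.exists_family
  constructor
  · exact exists_negativeFamily_of_closure hw' fun i => h1 ▸ L.le_topologicalClosure (hw i)
  · intro k u hu hu'
    obtain ⟨u', hu1, hu2⟩ := exists_negativeFamily_of_closure hu' fun i =>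
      h1 ▸ L'.le_topologicalClosure (hu i)
    exact h.le k u' hu1 hu2

/-- The index of an orthogonal sum. -/
theorem HasNegativeIndex.sup (hb : IsHermitianForm b) (hL : HasNegativeIndex b L m)
    (hL' : HasNegativeIndex b L' n) (horth : ∀ x ∈ L, ∀ y ∈ L', b x y = 0) :
    HasNegativeIndex b (L ⊔ L') (m + n) := by
  obtain ⟨w, hwL, hw⟩ := hL.exists_family
  obtain ⟨u, huL, hu⟩ := hL'.exists_family
  have hadd : ∀ x ∈ L, ∀ y ∈ L', (b (x + y) (x + y)).re = (b x x).re + (b y y).re := by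
    intro x hx y hy
    simp [horth x hx y hy, hb.eq_zero_symm (horth x hx y hy)]
  -- For the upper bound, take the coefficients against both maximal families. By orthogonality
  -- those against `w` see only the `L` component and those against `u` only the `L'` component;
  -- where all vanish, maximality makes both components nonnegative.
  refine hasNegativeIndex_of_family (w := Fin.append w u) (F := (Fin m → ℂ) × (Fin n → ℂ)) ?_ ?_
    ((formCoeff b w).prod (formCoeff b u)) ?_ (by simp)
  · intro c hc
    rw [Fin.sum_univ_add]
    simp only [Fin.append_left, Fin.append_right]
    rw [hadd _ (L.sum_mem fun i _ => L.smul_mem _ (hwL i)) _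
      (L'.sum_mem fun i _ => L'.smul_mem _ (huL i))]
    have key : ∀ {k : ℕ} {v : Fin k → V}, IsNegativeFamily b v → ∀ a : Fin k → ℂ,
        (b (∑ i, a i • v i) (∑ i, a i • v i)).re ≤ 0 := by
      intro k v hv a
      rcases eq_or_ne a 0 with rfl | ha
      · simp
      · exact (hv a ha).le
    by_cases h1 : (fun i => c (Fin.castAdd n i)) = 0
    · have h2 : (fun i => c (Fin.natAdd m i)) ≠ 0 := by
        intro h2
        apply hc
        ext i
        exact Fin.addCases (fun j => congrFun h1 j) (fun j => congrFun h2 j) i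
      have := hu _ h2
      have := key hw fun i => c (Fin.castAdd n i)
      linarith
    · have := hw _ h1
      have := key hu fun i => c (Fin.natAdd m i)
      linarith
  · intro i
    refine Fin.addCases (fun j => ?_) (fun j => ?_) i
    · simpa using Submodule.mem_sup_left (hwL j)
    · simpa using Submodule.mem_sup_right (huL j)
  · intro z hz hpz
    obtain ⟨x, hx, y, hy, rfl⟩ := Submodule.mem_sup.mp hz
    simp only [LinearMap.prod_apply, Function.prod_apply, Prod.mk_eq_zero] at hpz
    have h1 : ∀ i, b (w i) x = 0 := fun i => by
      have := congrFun hpz.1 i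
      simpa [horth _ (hwL i) _ hy] using this
    have h2 : ∀ i, b (u i) y = 0 := fun i => by
      have := congrFun hpz.2 i
      simpa [hb.eq_zero_symm (horth _ hx _ (huL i))] using this
    rw [hadd x hx y hy]
    exact add_nonneg (hL.re_nonneg hb hwL hw hx h1) (hL'.re_nonneg hb huL hu hy h2)

/-- Injectivity of `φ` is not needed: negativity involves only diagonal values of the forms, and
families in the image lift vector by vector. -/
theorem hasNegativeIndex_map_iff {V' : Type*} [NormedAddCommGroup V'] [NormedSpace ℂ V']
    {b' : V' →L⋆[ℂ] V' →L[ℂ] ℂ} (φ : V →ₗ[ℂ] V') (hφ : ∀ x, b' (φ x) (φ x) = b x x) :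
    HasNegativeIndex b' (L.map φ) n ↔ HasNegativeIndex b L n := by
  have key : ∀ {k : ℕ} (w : Fin k → V),
      IsNegativeFamily b' (fun i => φ (w i)) ↔ IsNegativeFamily b w := by
    intro k w
    refine forall₂_congr fun c _ => ?_
    rw [← hφ]
    simp
  have lift : ∀ {k : ℕ} (u : Fin k → V'), (∀ i, u i ∈ L.map φ) →
      ∃ w : Fin k → V, (∀ i, w i ∈ L) ∧ u = fun i => φ (w i) := by
    intro k u hu
    choose w hw hw' using hu
    exact ⟨w, hw, funext fun i => (hw' i).symm⟩
  constructor
  · rintro ⟨⟨u, hu, hu'⟩, hle⟩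
    obtain ⟨w, hw, rfl⟩ := lift u hu
    exact ⟨⟨w, hw, (key w).mp hu'⟩, fun k v hv hv' =>
      hle k _ (fun i => Submodule.mem_map_of_mem (hv i)) ((key v).mpr hv')⟩
  · rintro ⟨⟨w, hw, hw'⟩, hle⟩
    refine ⟨⟨_, fun i => Submodule.mem_map_of_mem (hw i), (key w).mpr hw'⟩, fun k u hu hu' => ?_⟩
    obtain ⟨v, hv, rfl⟩ := lift u hu
    exact hle k v hv ((key v).mp hu')

theorem IsNegativeFamily.linearIndependent {w : Fin n → V} (hw : IsNegativeFamily b w) :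
    LinearIndependent ℂ w := by
  rw [Fintype.linearIndependent_iff]
  intro c hc
  by_contra hne
  have := hw c (fun h => hne fun i => congrFun h i)
  simp [hc] at this

/-- This makes the index intrinsic: a basis of the negative summand is a negative family, and the
form is nonnegative on the kernel of the projection onto that summand. -/
theorem IsPontryaginSpace.hasNegativeIndex (h : IsPontryaginSpace b n) :
    HasNegativeIndex b ⊤ n := by
  obtain ⟨p, hp, horth, ⟨c, hc, hpos⟩, hneg, hfin, hrank⟩ := h.exists_projection
  let e := Module.finBasisOfFinrankEq ℂ (LinearMap.range (p : V →ₗ[ℂ] V)) hrank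
  refine hasNegativeIndex_of_family (w := fun i => (e i : V)) ?_ (fun _ => trivial)
    (p : V →ₗ[ℂ] V).rangeRestrict (fun x _ hx => ?_) hrank.le
  · intro a ha
    have h1 : ∑ i, a i • (e i : V) = ((∑ i, a i • e i : LinearMap.range (p : V →ₗ[ℂ] V)) : V) := by
      simp
    have h2 : (∑ i, a i • e i) ≠ 0 := by
      intro h2
      apply ha
      ext i
      exact Fintype.linearIndependent_iff.mp e.linearIndependent a h2 i
    obtain ⟨y, hy⟩ := (∑ i, a i • e i).2
    rw [h1, ← hy]
    apply hneg
    change (p : V →ₗ[ℂ] V) y ≠ 0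
    rw [hy]
    exact fun h3 => h2 (Subtype.ext h3)
  · have : p x = 0 := congrArg Subtype.val hx
    exact le_trans (by positivity) (hpos x this)

/-- A complete space with a nondegenerate Hermitian form that is uniformly positive on a closed
subspace of finite codimension is a Pontryagin space. -/
theorem exists_isPontryaginSpace [CompleteSpace V] (hb : IsHermitianForm b)
    (hnd : ∀ x, (∀ y, b x y = 0) → x = 0) {F : Type*} [NormedAddCommGroup F] [NormedSpace ℂ F]
    [FiniteDimensional ℂ F] (p : V →L[ℂ] F) {c : ℝ} (hc : 0 < c)
    (hpos : ∀ x, p x = 0 → c * ‖x‖ ^ 2 ≤ (b x x).re) : ∃ n, IsPontryaginSpace b n := by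
  -- The dimension of `F` bounds every negative family. The span of a maximal one serves as negative
  -- summand; on its orthogonal complement `Kp` the form is nonnegative by maximality.
  obtain ⟨n, -, hn⟩ := exists_hasNegativeIndex_of_le (b := b) (L := ⊤)
    fun k w hwL hw => hw.le_finrank hwL (p : V →ₗ[ℂ] F)
      fun x _ hx => le_trans (by positivity) (hpos x hx)
  obtain ⟨w, hwL, hw⟩ := hn.exists_family
  set Kp : Submodule ℂ V := LinearMap.ker (formCoeff b w) with hKpdef
  have hKp : ∀ x, x ∈ Kp ↔ ∀ i, b (w i) x = 0 := fun x => by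
    rw [hKpdef, LinearMap.mem_ker]
    exact funext_iff
  have hnonneg : ∀ x ∈ Kp, 0 ≤ (b x x).re := fun x hx =>
    hn.re_nonneg hb hwL hw trivial ((hKp x).mp hx)
  set Km : Submodule ℂ V := Submodule.span ℂ (Set.range w) with hKmdef
  have hfinKm : FiniteDimensional ℂ Km := FiniteDimensional.span_of_finite ℂ (Set.finite_range w)
  have hrank : Module.finrank ℂ Km = n := by
    rw [hKmdef, finrank_span_eq_card hw.linearIndependent, Fintype.card_fin]
  have hKm : ∀ x ∈ Km, ∃ a : Fin n → ℂ, ∑ i, a i • w i = x := fun x hx =>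
    Submodule.mem_span_range_iff_exists_fun ℂ |>.mp hx
  have hneg : ∀ x ∈ Km, x ≠ 0 → (b x x).re < 0 := by
    intro x hx hx0
    obtain ⟨a, rfl⟩ := hKm x hx
    exact hw a (by rintro rfl; simp at hx0)
  have horth : ∀ x ∈ Kp, ∀ y ∈ Km, b x y = 0 := by
    intro x hx y hy
    obtain ⟨a, rfl⟩ := hKm y hy
    simp [hb.eq_zero_symm ((hKp x).mp hx _)]
  have hdecomp : ∀ x, ∃ y ∈ Km, x - y ∈ Kp := by
    intro x
    -- `φ` is the Gram map of the family. Definiteness makes it injective, hence surjective, which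
    -- yields the component of `x` in `Km`.
    let φ : (Fin n → ℂ) →ₗ[ℂ] (Fin n → ℂ) := formCoeff b w ∘ₗ Fintype.linearCombination ℂ w
    have hφ : ∀ a i, φ a i = b (w i) (∑ j, a j • w j) := fun a i => by
      simp [φ, Fintype.linearCombination_apply]
    have hinj : Function.Injective φ := by
      rw [← LinearMap.ker_eq_bot, LinearMap.ker_eq_bot']
      intro a ha
      by_contra ha0
      have h1 := hw a ha0
      have h2 : b (∑ i, a i • w i) (∑ i, a i • w i) = 0 := by
        refine hb.eq_zero_symm ?_
        conv_lhs => rw [map_sum]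
        refine Finset.sum_eq_zero fun i _ => ?_
        have h3 := congrFun ha i
        rw [hφ, Pi.zero_apply] at h3
        exact hb.eq_zero_symm (by rw [map_smulₛₗ, smul_apply, h3, smul_zero])
      rw [h2] at h1
      exact lt_irrefl _ h1
    obtain ⟨a, ha⟩ := LinearMap.surjective_of_injective hinj (formCoeff b w x)
    refine ⟨∑ j, a j • w j, ?_, ?_⟩
    · exact Km.sum_mem fun i _ => Km.smul_mem _ (Submodule.subset_span ⟨i, rfl⟩)
    · rw [hKp]
      intro i
      have := congrFun ha i
      rw [hφ, formCoeff_apply] at this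
      rw [map_sub, this, sub_self]
  have hcompl : IsCompl Kp Km := by
    refine IsCompl.of_eq ?_ ?_
    · rw [Submodule.eq_bot_iff]
      rintro x ⟨hx, hx'⟩
      by_contra h0
      have := hneg x hx' h0
      simp [horth x hx x hx'] at this
    · rw [eq_top_iff]
      intro x _
      obtain ⟨y, hy, hxy⟩ := hdecomp x
      have := Submodule.add_mem_sup hxy hy
      simpa using this
  -- the form is definite on `Kp`
  have hdef : ∀ x ∈ Kp, b x x = 0 → x = 0 := by
    intro x hx hx0
    apply hnd
    intro z
    obtain ⟨y, hy, hzy⟩ := hdecomp z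
    have h1 : b x (z - y) = 0 := by
      set u := z - y
      by_contra hne
      -- A Cauchy-Schwarz argument for a nonnegative form with `b x x = 0`: evaluate at `t (b x u) x
      -- + t² u` and divide by `t²`. The value `t = -|b x u|² / (b u u + 1)` used below makes the
      -- expression negative unless `b x u = 0`.
      have h2 : ∀ t : ℝ, 0 ≤ (b u u).re * t ^ 2 + 2 * t * Complex.normSq (b x u) := by
        intro t
        have h3 := hnonneg (((t : ℂ) * b x u) • x + (t : ℂ) ^ 2 • u) (Kp.add_mem (Kp.smul_mem _ hx)
          (Kp.smul_mem _ hzy))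
        have h4 : b (((t : ℂ) * b x u) • x + (t : ℂ) ^ 2 • u) (((t : ℂ) * b x u) • x + (t : ℂ) ^ 2 • u)
            = ((t ^ 4 : ℝ) : ℂ) * b u u + ((2 * t ^ 3 * Complex.normSq (b x u) : ℝ) : ℂ) := by
          have h5 : b u x = conj (b x u) := (hb x u).symm
          simp only [map_add, map_smulₛₗ, add_apply, smul_apply, smul_eq_mul, hx0, h5, map_mul,
            Complex.conj_ofReal, map_pow, RingHom.id_apply]
          push_cast
          rw [Complex.normSq_eq_conj_mul_self]
          ring
        rw [h4, Complex.add_re, Complex.re_ofReal_mul, Complex.ofReal_re] at h3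
        rcases eq_or_ne t 0 with rfl | ht
        · simp
        · have h6 : 0 < t ^ 2 := by positivity
          refine nonneg_of_mul_nonneg_right (a := t ^ 2) ?_ h6
          linarith
      have h7 : 0 < Complex.normSq (b x u) := Complex.normSq_pos.mpr hne
      have h8 : 0 ≤ (b u u).re := hnonneg u hzy
      have h9 := h2 (-(Complex.normSq (b x u)) / ((b u u).re + 1))
      have h10 : (b u u).re * (-(Complex.normSq (b x u)) / ((b u u).re + 1)) ^ 2 +
          2 * (-(Complex.normSq (b x u)) / ((b u u).re + 1)) * Complex.normSq (b x u)
          = (Complex.normSq (b x u)) ^ 2 * (-(b u u).re - 2) / ((b u u).re + 1) ^ 2 := by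
        field_simp
        ring
      rw [h10] at h9
      have h11 : (Complex.normSq (b x u)) ^ 2 * (-(b u u).re - 2) / ((b u u).re + 1) ^ 2 < 0 := by
        apply div_neg_of_neg_of_pos
        · apply mul_neg_of_pos_of_neg <;> [positivity; linarith]
        · positivity
      linarith
    rw [map_sub, horth x hx y hy, sub_zero] at h1
    exact h1
  -- uniform positivity on `Kp`
  set N : Submodule ℂ V := Kp ⊓ LinearMap.ker (p : V →ₗ[ℂ] F) with hNdef
  have hKpclosed : IsClosed (Kp : Set V) := by
    have : (Kp : Set V) = ⋂ i, {x | b (w i) x = 0} := by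
      ext x
      simp [hKp]
    rw [this]
    exact isClosed_iInter fun i => isClosed_eq (by fun_prop) continuous_const
  have hNclosed : IsClosed (N : Set V) := hKpclosed.inter p.isClosed_ker
  have : CompleteSpace N := hNclosed.completeSpace_coe
  have hNpos : ∀ x ∈ N, c * ‖x‖ ^ 2 ≤ (b x x).re := fun x hx => hpos x hx.2
  let E : Submodule ℂ V :=
    { carrier := {x | x ∈ Kp ∧ ∀ y ∈ N, b x y = 0}
      add_mem' := fun ⟨h1, h2⟩ ⟨h3, h4⟩ => ⟨Kp.add_mem h1 h3, fun y hy => by simp [h2 y hy, h4 y hy]⟩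
      zero_mem' := ⟨Kp.zero_mem, fun y _ => by simp⟩
      smul_mem' := fun a x ⟨h1, h2⟩ => ⟨Kp.smul_mem a h1, fun y hy => by simp [h2 y hy]⟩ }
  -- `E` is the orthogonal complement of `N` in `Kp`. A vector of `E` killed by `p` lies in `N`, so
  -- it is orthogonal to itself and vanishes by definiteness; thus `p` embeds `E` in `F`.
  have hE : FiniteDimensional ℂ E := by
    refine FiniteDimensional.of_injective ((p : V →ₗ[ℂ] F) ∘ₗ E.subtype) ?_
    rw [← LinearMap.ker_eq_bot, LinearMap.ker_eq_bot']
    intro x hx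
    have h1 : (x : V) ∈ N := ⟨x.2.1, hx⟩
    exact Subtype.ext (hdef x x.2.1 (x.2.2 x h1))
  obtain ⟨d, hd, hdpos⟩ := exists_pos_bound_of_finiteDimensional (b := b) E (fun x hx hx0 => by
    refine lt_of_le_of_ne (hnonneg x hx.1) fun h0 => hx0 (hdef x hx.1 ?_)
    exact Complex.ext h0.symm (hb.im_self x))
  refine ⟨n, inferInstance, hb, Kp, Km, hcompl, horth, ⟨min c d / 2, by positivity, fun x hx => ?_⟩,
    hneg, hfinKm, hrank⟩
  obtain ⟨r, hr, hrx⟩ := exists_sub_orthogonal_of_pos hb N hc hNpos x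
  have hs : x - r ∈ E := ⟨Kp.sub_mem hx hr.1, hrx⟩
  have h1 := hNpos r hr
  have h2 := hdpos _ hs
  have h3 : ‖x‖ ≤ ‖r‖ + ‖x - r‖ := by simpa using norm_add_le r (x - r)
  have h4 : ‖x‖ ^ 2 ≤ 2 * (‖r‖ ^ 2 + ‖x - r‖ ^ 2) := by
    nlinarith [norm_nonneg x, sq_nonneg (‖r‖ - ‖x - r‖)]
  have h5 : (b x x).re = (b r r).re + (b (x - r) (x - r)).re := by
    have h6 : b (r + (x - r)) (r + (x - r)) = b r r + b (x - r) (x - r) := by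
      simp only [map_add, add_apply, hrx r hr, hb.eq_zero_symm (hrx r hr)]
      ring
    rw [← Complex.add_re, ← h6, add_sub_cancel]
  rw [h5]
  have := min_le_left c d
  have := min_le_right c d
  have h7 : 0 < min c d := lt_min hc hd
  nlinarith [sq_nonneg ‖r‖, sq_nonneg ‖x - r‖]

/-- Uniform positivity on the kernel of a finite-rank map passes to any closed subspace, so
nondegeneracy is the only condition left to impose. -/
theorem IsPontryaginSpace.restrict (h : IsPontryaginSpace b n) (M : Submodule ℂ V)
    (hM : IsClosed (M : Set V)) (hnd : ∀ x ∈ M, (∀ y ∈ M, b x y = 0) → x = 0) :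
    ∃ m, IsPontryaginSpace (restrictForm b M) m := by
  have := h.complete
  have : CompleteSpace M := hM.completeSpace_coe
  obtain ⟨p, hp, -, hfin, -, ⟨c, hc, hpos⟩, -⟩ := h.exists_symmetry
  let q : M →L[ℂ] LinearMap.range (p : V →ₗ[ℂ] V) :=
    (p.codRestrict _ fun x => ⟨x, rfl⟩) ∘L M.subtypeL
  refine exists_isPontryaginSpace (h.isHermitianForm.restrict M)
    (fun x hx => Subtype.ext (hnd x x.2 fun y hy => hx ⟨y, hy⟩)) q hc fun x hx => ?_
  exact hpos x (congrArg Subtype.val hx)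

theorem hasNegativeIndex_restrictForm_top (M : Submodule ℂ V) :
    HasNegativeIndex (restrictForm b M) ⊤ n ↔ HasNegativeIndex b M n := by
  rw [← hasNegativeIndex_map_iff (b' := b) (b := restrictForm b M) M.subtype (fun x => rfl),
    Submodule.map_top, Submodule.range_subtype]

theorem IsPontryaginSpace.exists_hasNegativeIndex (h : IsPontryaginSpace b n)
    (L : Submodule ℂ V) : ∃ m, HasNegativeIndex b L m := by
  obtain ⟨m, -, hm⟩ := exists_hasNegativeIndex_of_le (b := b) (L := L)
    fun k w _ hw => h.hasNegativeIndex.le k w (fun _ => trivial) hw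
  exact ⟨m, hm⟩

end NegativeIndex

/-! ### Gram matrices and Sylvester's law -/

section Gram

variable {V : Type*} [NormedAddCommGroup V] [NormedSpace ℂ V] {b : V →L⋆[ℂ] V →L[ℂ] ℂ}

/-- Sylvester's law for a form in diagonal shape. -/
theorem hasNegativeIndex_of_diagonal {n : ℕ} {L : Submodule ℂ V} (ev : Fin n → ℝ)
    (coord : Fin n → V →ₗ[ℂ] ℂ) (u : Fin n → V) (huL : ∀ i, u i ∈ L)
    (hu : ∀ i j, coord i (u j) = if i = j then 1 else 0)
    (hb : ∀ x ∈ L, (b x x).re = ∑ i, ev i * Complex.normSq (coord i x)) :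
    HasNegativeIndex b L (Finset.univ.filter fun i => ev i < 0).card := by
  classical
  set s := Finset.univ.filter fun i => ev i < 0 with hs
  let e : Fin s.card ≃ s := s.equivFin.symm
  have hneg : ∀ a, ev (e a) < 0 := fun a => (Finset.mem_filter.mp (e a).2).2
  refine hasNegativeIndex_of_family (w := fun a => u (e a)) (F := s → ℂ) ?_ (fun a => huL _)
    (LinearMap.pi fun i : s => coord i) ?_ (by simp)
  · intro c hc
    rw [hb _ (L.sum_mem fun a _ => L.smul_mem _ (huL _))]
    have hcoord : ∀ i, coord i (∑ a, c a • u (e a)) = ∑ a, if i = e a then c a else 0 := by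
      intro i
      simp [hu]
    obtain ⟨a₀, ha₀⟩ := Function.ne_iff.mp hc
    have hterm : ∀ i, ev i * Complex.normSq (coord i (∑ a, c a • u (e a))) ≤ 0 := by
      intro i
      by_cases hi : ev i < 0
      · exact mul_nonpos_of_nonpos_of_nonneg hi.le (Complex.normSq_nonneg _)
      · have : coord i (∑ a, c a • u (e a)) = 0 := by
          rw [hcoord]
          refine Finset.sum_eq_zero fun a _ => if_neg ?_
          rintro rfl
          exact hi (hneg a)
        simp [this]
    refine Finset.sum_neg' (fun i _ => hterm i) ⟨e a₀, Finset.mem_univ _, ?_⟩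
    refine mul_neg_of_neg_of_pos (hneg a₀) (Complex.normSq_pos.mpr ?_)
    rw [hcoord, Finset.sum_eq_single a₀]
    · simpa using ha₀
    · intro a _ ha
      exact if_neg fun h => ha (e.injective (Subtype.ext h)).symm
    · simp
  · intro x hx hx0
    rw [hb x hx]
    refine Finset.sum_nonneg fun i _ => ?_
    by_cases hi : ev i < 0
    · have : coord i x = 0 := congrFun hx0 ⟨i, by simp [hs, hi]⟩
      simp [this]
    · exact mul_nonneg (not_lt.mp hi) (Complex.normSq_nonneg _)

theorem gram_isHermitian (hb : IsHermitianForm b) {n : ℕ} (x : Fin n → V) :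
    (Matrix.of fun i j => b (x j) (x i)).IsHermitian := by
  ext i j
  simpa using hb _ _

/-- The number of negative eigenvalues of a Gram matrix is the index of the span. -/
theorem hasNegativeIndex_span_gram (hb : IsHermitianForm b) {n : ℕ} (x : Fin n → V) :
    HasNegativeIndex b (Submodule.span ℂ (Set.range x))
      (negativeEigenvalueCount (Matrix.of fun i j => b (x j) (x i))) := by
  classical
  set M : Matrix (Fin n) (Fin n) ℂ := Matrix.of fun i j => b (x j) (x i) with hMdef
  have hM : M.IsHermitian := gram_isHermitian hb x
  have hcount : negativeEigenvalueCount M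
      = (Finset.univ.filter fun i => hM.eigenvalues i < 0).card := by
    rw [negativeEigenvalueCount, dif_pos hM]
  let φ : EuclideanSpace ℂ (Fin n) →L[ℂ] V :=
    LinearMap.toContinuousLinearMap
      (Fintype.linearCombination ℂ x ∘ₗ (WithLp.linearEquiv 2 ℂ (Fin n → ℂ)).toLinearMap)
  have hφ : ∀ a, φ a = ∑ i, a i • x i := fun a => by
    simp [φ, Fintype.linearCombination_apply]
  have hspan : Submodule.span ℂ (Set.range x) = (⊤ : Submodule ℂ _).map (φ : EuclideanSpace ℂ (Fin n) →ₗ[ℂ] V) := by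
    ext y
    rw [Submodule.mem_span_range_iff_exists_fun]
    simp only [Submodule.mem_map, Submodule.mem_top, true_and, ContinuousLinearMap.coe_coe, hφ]
    exact ⟨fun ⟨c, hc⟩ => ⟨WithLp.toLp 2 c, hc⟩, fun ⟨c, hc⟩ => ⟨c, hc⟩⟩
  let b' : EuclideanSpace ℂ (Fin n) →L⋆[ℂ] EuclideanSpace ℂ (Fin n) →L[ℂ] ℂ := b.bilinearComp φ φ
  rw [hspan, hcount, hasNegativeIndex_map_iff (b := b') (b' := b)
    (φ : EuclideanSpace ℂ (Fin n) →ₗ[ℂ] V) fun x => rfl]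
  let coord : Fin n → EuclideanSpace ℂ (Fin n) →ₗ[ℂ] ℂ := fun j =>
    Fintype.linearCombination ℂ (fun i => hM.eigenvectorBasis j i) ∘ₗ
      (WithLp.linearEquiv 2 ℂ (Fin n → ℂ)).toLinearMap
  have hcoord : ∀ j y, coord j y = ∑ i, y i * hM.eigenvectorBasis j i := fun j y => by
    simp [coord, Fintype.linearCombination_apply]
  -- The matrix has the entry `b (x j) (x i)` at `(i, j)`, so its quadratic form reproduces `b` only
  -- after conjugating the coefficients.
  let cj : EuclideanSpace ℂ (Fin n) → EuclideanSpace ℂ (Fin n) := fun y =>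
    WithLp.toLp 2 fun i => conj (y i : ℂ)
  have hcoord' : ∀ j y, coord j y = ⟪cj y, hM.eigenvectorBasis j⟫_ℂ := fun j y => by
    rw [hcoord, PiLp.inner_apply]
    simp [cj, mul_comm]
  refine hasNegativeIndex_of_diagonal hM.eigenvalues coord (fun j => cj (hM.eigenvectorBasis j))
    (fun _ => trivial) (fun i j => ?_) fun y _ => ?_
  · rw [hcoord']
    have : cj (cj (hM.eigenvectorBasis j)) = hM.eigenvectorBasis j := by
      ext i; simp [cj]
    rw [this, orthonormal_iff_ite.mp hM.eigenvectorBasis.orthonormal]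
    simp [eq_comm]
  · have h1 : b' y y = ⟪cj y, M.toEuclideanLin (cj y)⟫_ℂ := by
      change b (φ y) (φ y) = _
      simp only [hφ, map_sum, map_smulₛₗ, FunLike.coe_sum, Finset.sum_apply, smul_apply,
        PiLp.inner_apply, RingHom.id_apply]
      simp only [Matrix.ofLp_toLpLin, Matrix.toLin'_apply, Matrix.mulVec, dotProduct,
        RCLike.inner_apply, cj, hMdef, Matrix.of_apply, Complex.conj_conj, smul_eq_mul,
        Finset.sum_mul]
      refine Finset.sum_congr rfl fun i _ => ?_
      rw [Finset.mul_sum]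
      exact Finset.sum_congr rfl fun j _ => by ring
    rw [h1, ← hM.eigenvectorBasis.sum_inner_mul_inner, Complex.re_sum]
    refine Finset.sum_congr rfl fun j _ => ?_
    have h2 : ⟪hM.eigenvectorBasis j, M.toEuclideanLin (cj y)⟫_ℂ
        = hM.eigenvalues j * ⟪hM.eigenvectorBasis j, cj y⟫_ℂ := by
      have hsymm := Matrix.isSymmetric_toEuclideanLin_iff.mpr hM
      rw [← hsymm]
      have h3 : M.toEuclideanLin (hM.eigenvectorBasis j)
          = (hM.eigenvalues j : ℂ) • hM.eigenvectorBasis j := by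
        ext i
        have := congrFun (hM.mulVec_eigenvectorBasis j) i
        simpa [Matrix.toLpLin_apply] using this
      rw [h3, inner_smul_left, Complex.conj_ofReal]
    rw [h2, hcoord', ← inner_conj_symm (hM.eigenvectorBasis j) (cj y)]
    generalize ⟪cj y, hM.eigenvectorBasis j⟫_ℂ = a
    rw [mul_left_comm, Complex.re_ofReal_mul, Complex.mul_conj, Complex.ofReal_re]

theorem exists_fin_range_of_mem_span {k : ℕ} {S : Set V} {w : Fin k → V}
    (hw : ∀ i, w i ∈ Submodule.span ℂ S) :
    ∃ (n : ℕ) (x : Fin n → V), (∀ i, x i ∈ S) ∧ ∀ i, w i ∈ Submodule.span ℂ (Set.range x) := by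
  classical
  choose T hTS hT using fun i => Submodule.mem_span_finite_of_mem_span (hw i)
  let U := Finset.univ.biUnion T
  refine ⟨U.card, fun i => (U.equivFin.symm i : V), fun i => ?_, fun i => ?_⟩
  · obtain ⟨j, -, hj⟩ := Finset.mem_biUnion.mp (U.equivFin.symm i).2
    exact hTS j hj
  · refine Submodule.span_mono ?_ (hT i)
    intro y hy
    refine ⟨U.equivFin ⟨y, Finset.mem_biUnion.mpr ⟨i, Finset.mem_univ _, hy⟩⟩, by simp⟩

end Gram

/-! ### Negative squares of a Nevanlinna kernel -/

section Kernel

variable {H : Type*} [NormedAddCommGroup H] [InnerProductSpace ℂ H]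
variable {V : Type*} [NormedAddCommGroup V] [NormedSpace ℂ V] {b : V →L⋆[ℂ] V →L[ℂ] ℂ}

/-- The span of `v z h` for `z ∈ D ∩ ℂ⁺`. -/
def upperSpan (D : Set ℂ) (v : ℂ → H →L[ℂ] V) : Submodule ℂ V :=
  Submodule.span ℂ {y | ∃ z ∈ D, 0 < z.im ∧ ∃ h, y = v z h}

theorem nevanlinnaMatrix_eq_gram [CompleteSpace H] {D : Set ℂ} {Q : ℂ → H →L[ℂ] H} {v : ℂ → H →L[ℂ] V}
    (hv : ∀ z ∈ D, ∀ w ∈ D, 0 < z.im → 0 < w.im → ∀ h g,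
      ⟪g, nevanlinnaKernel Q z w h⟫_ℂ = b (v w g) (v z h)) {n : ℕ} {z : Fin n → ℂ} {h : Fin n → H}
    (hz : ∀ i, z i ∈ D ∧ 0 < (z i).im) :
    nevanlinnaMatrix Q z h = Matrix.of fun i j => b (v (z j) (h j)) (v (z i) (h i)) := by
  ext i j
  exact hv _ (hz i).1 _ (hz j).1 (hz i).2 (hz j).2 _ _

theorem exists_nodes_of_mem_upperSpan {D : Set ℂ} {v : ℂ → H →L[ℂ] V} {k : ℕ} {w : Fin k → V}
    (hw : ∀ i, w i ∈ upperSpan D v) :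
    ∃ (n : ℕ) (z : Fin n → ℂ) (h : Fin n → H), (∀ i, z i ∈ D ∧ 0 < (z i).im) ∧
      ∀ i, w i ∈ Submodule.span ℂ (Set.range fun i => v (z i) (h i)) := by
  obtain ⟨n, x, hx, hwx⟩ := exists_fin_range_of_mem_span hw
  choose z hz hz' h hh using hx
  obtain rfl : x = fun i => v (z i) (h i) := funext hh
  exact ⟨n, z, h, fun i => ⟨hz i, hz' i⟩, hwx⟩

theorem span_le_upperSpan {D : Set ℂ} {v : ℂ → H →L[ℂ] V} {n : ℕ} {z : Fin n → ℂ} {h : Fin n → H}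
    (hz : ∀ i, z i ∈ D ∧ 0 < (z i).im) :
    Submodule.span ℂ (Set.range fun i => v (z i) (h i)) ≤ upperSpan D v := by
  rw [Submodule.span_le]
  rintro _ ⟨i, rfl⟩
  exact Submodule.subset_span ⟨z i, (hz i).1, (hz i).2, h i, rfl⟩

/-- The number of negative squares of the Nevanlinna kernel, read off from a representation of the
kernel as a Gram kernel. -/
theorem hasNegativeIndex_upperSpan_iff [CompleteSpace H] (hb : IsHermitianForm b) {D : Set ℂ} {Q : ℂ → H →L[ℂ] H}
    {v : ℂ → H →L[ℂ] V}
    (hv : ∀ z ∈ D, ∀ w ∈ D, 0 < z.im → 0 < w.im → ∀ h g,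
      ⟪g, nevanlinnaKernel Q z w h⟫_ℂ = b (v w g) (v z h)) {κ : ℕ} :
    HasNegativeIndex b (upperSpan D v) κ ↔
      (∀ (n : ℕ) (z : Fin n → ℂ) (h : Fin n → H), (∀ i, z i ∈ D ∧ 0 < (z i).im) →
        negativeEigenvalueCount (nevanlinnaMatrix Q z h) ≤ κ) ∧
      ∃ (n : ℕ) (z : Fin n → ℂ) (h : Fin n → H), (∀ i, z i ∈ D ∧ 0 < (z i).im) ∧
        negativeEigenvalueCount (nevanlinnaMatrix Q z h) = κ := by
  -- Finitely many nodes give a Gram matrix, whose count is the index of their span. Conversely, a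
  -- finite negative family involves only finitely many nodes, so the whole span contributes nothing
  -- new.
  have key : ∀ {n : ℕ} (z : Fin n → ℂ) (h : Fin n → H), (∀ i, z i ∈ D ∧ 0 < (z i).im) →
      HasNegativeIndex b (Submodule.span ℂ (Set.range fun i => v (z i) (h i)))
        (negativeEigenvalueCount (nevanlinnaMatrix Q z h)) := by
    intro n z h hz
    rw [nevanlinnaMatrix_eq_gram hv hz]
    exact hasNegativeIndex_span_gram hb _
  constructor
  · intro hκ
    have hle : ∀ (n : ℕ) (z : Fin n → ℂ) (h : Fin n → H), (∀ i, z i ∈ D ∧ 0 < (z i).im) →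
        negativeEigenvalueCount (nevanlinnaMatrix Q z h) ≤ κ := by
      intro n z h hz
      obtain ⟨w, hw, hw'⟩ := (key z h hz).exists_family
      exact hκ.le _ w (fun i => span_le_upperSpan hz (hw i)) hw'
    refine ⟨hle, ?_⟩
    obtain ⟨w, hw, hw'⟩ := hκ.exists_family
    obtain ⟨n, z, h, hz, hwz⟩ := exists_nodes_of_mem_upperSpan hw
    exact ⟨n, z, h, hz, le_antisymm (hle n z h hz) ((key z h hz).le _ w hwz hw')⟩
  · rintro ⟨hle, n, z, h, hz, rfl⟩
    obtain ⟨w, hw, hw'⟩ := (key z h hz).exists_family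
    refine ⟨⟨w, fun i => span_le_upperSpan hz (hw i), hw'⟩, fun k u hu hu' => ?_⟩
    obtain ⟨m, z', h', hz', huz⟩ := exists_nodes_of_mem_upperSpan hu
    exact ((key z' h' hz').le _ u huz hu').trans (hle m z' h' hz')

end Kernel

/-! ### Isometries between Pontryagin spaces -/

section Isometry

variable {V W : Type*} [NormedAddCommGroup V] [NormedSpace ℂ V] [NormedAddCommGroup W]
  [NormedSpace ℂ W] {b : V →L⋆[ℂ] V →L[ℂ] ℂ} {b' : W →L⋆[ℂ] W →L[ℂ] ℂ} {m n : ℕ}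

/-- The orthogonal sum of two forms. -/
def prodForm (b : V →L⋆[ℂ] V →L[ℂ] ℂ) (b' : W →L⋆[ℂ] W →L[ℂ] ℂ) :
    (V × W) →L⋆[ℂ] (V × W) →L[ℂ] ℂ :=
  b.bilinearComp (ContinuousLinearMap.fst ℂ V W) (ContinuousLinearMap.fst ℂ V W) +
    b'.bilinearComp (ContinuousLinearMap.snd ℂ V W) (ContinuousLinearMap.snd ℂ V W)

@[simp]
theorem prodForm_apply (x y : V × W) : prodForm b b' x y = b x.1 y.1 + b' x.2 y.2 := rfl

theorem IsPontryaginSpace.prod (h : IsPontryaginSpace b m) (h' : IsPontryaginSpace b' n) :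
    ∃ k, IsPontryaginSpace (prodForm b b') k := by
  have := h.complete
  have := h'.complete
  obtain ⟨p, hp, -, hfin, -, ⟨c, hc, hpos⟩, -⟩ := h.exists_symmetry
  obtain ⟨p', hp', -, hfin', -, ⟨c', hc', hpos'⟩, -⟩ := h'.exists_symmetry
  let q : V →L[ℂ] LinearMap.range (p : V →ₗ[ℂ] V) := p.codRestrict _ fun x => ⟨x, rfl⟩
  let q' : W →L[ℂ] LinearMap.range (p' : W →ₗ[ℂ] W) := p'.codRestrict _ fun x => ⟨x, rfl⟩
  refine exists_isPontryaginSpace (b := prodForm b b') (fun x y => ?_) (fun x hx => ?_)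
    (q.prodMap q') (c := min c c') (lt_min hc hc') fun x hx => ?_
  · simp [h.hermitian, h'.hermitian]
  · refine Prod.ext (h.eq_zero fun y => ?_) (h'.eq_zero fun y => ?_)
    · simpa using hx (y, 0)
    · simpa using hx (0, y)
  · have h1 : p x.1 = 0 := congrArg Subtype.val (Prod.ext_iff.mp hx).1
    have h2 : p' x.2 = 0 := congrArg Subtype.val (Prod.ext_iff.mp hx).2
    have h3 := hpos _ h1
    have h4 := hpos' _ h2
    have h5 : ‖x‖ ^ 2 ≤ ‖x.1‖ ^ 2 + ‖x.2‖ ^ 2 := by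
      rw [Prod.norm_def]
      rcases max_choice ‖x.1‖ ‖x.2‖ with h | h <;> rw [h] <;> nlinarith [sq_nonneg ‖x.1‖, sq_nonneg ‖x.2‖]
    rw [prodForm_apply, Complex.add_re]
    have := min_le_left c c'
    have := min_le_right c c'
    have h7 : 0 < min c c' := lt_min hc hc'
    nlinarith [sq_nonneg ‖x.1‖, sq_nonneg ‖x.2‖]

/-- Two total families with the same Gram kernel in Pontryagin spaces are related by a bounded
isometry. -/
theorem IsPontryaginSpace.exists_isometry (h : IsPontryaginSpace b m)
    (h' : IsPontryaginSpace b' n) {ι : Type*} (x : ι → V) (y : ι → W)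
    (hgram : ∀ i j, b (x i) (x j) = b' (y i) (y j))
    (hx : (Submodule.span ℂ (Set.range x)).topologicalClosure = ⊤)
    (hy : (Submodule.span ℂ (Set.range y)).topologicalClosure = ⊤) :
    ∃ T : V →L[ℂ] W, (∀ i, T (x i) = y i) ∧ Function.Injective T := by
  have := h.complete
  have := h'.complete
  obtain ⟨k, hk⟩ := h.prod h'
  -- `E` is the closed linear relation generated by `x i ↦ y i`. The task is to show that it is the
  -- graph of an injective bounded operator.
  set E : Submodule ℂ (V × W) :=
    (Submodule.span ℂ (Set.range fun i => (x i, y i))).topologicalClosure with hE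
  have hEclosed : IsClosed (E : Set (V × W)) := Submodule.isClosed_topologicalClosure _
  have hmem : ∀ i, (x i, y i) ∈ E := fun i =>
    Submodule.le_topologicalClosure _ (Submodule.subset_span ⟨i, rfl⟩)
  have hcl : ∀ N : Submodule ℂ (V × W), IsClosed (N : Set (V × W)) → (∀ i, (x i, y i) ∈ N) → E ≤ N := by
    intro N hN hi
    refine Submodule.topologicalClosure_minimal _ (Submodule.span_le.mpr ?_) hN
    rintro _ ⟨i, rfl⟩
    exact hi i
  have hiso1 : ∀ i, ∀ e ∈ E, b (x i) e.1 = b' (y i) e.2 := by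
    intro i e he
    have := hcl (LinearMap.ker (((b (x i)).comp (ContinuousLinearMap.fst ℂ V W) -
      (b' (y i)).comp (ContinuousLinearMap.snd ℂ V W) : (V × W) →L[ℂ] ℂ) : (V × W) →ₗ[ℂ] ℂ))
      (ContinuousLinearMap.isClosed_ker _) (fun j => by simp [hgram]) he
    simpa [sub_eq_zero] using this
  have hiso : ∀ e ∈ E, ∀ f ∈ E, b e.1 f.1 = b' e.2 f.2 := by
    intro e he f hf
    have := hcl (LinearMap.ker (((b e.1).comp (ContinuousLinearMap.fst ℂ V W) -
      (b' e.2).comp (ContinuousLinearMap.snd ℂ V W) : (V × W) →L[ℂ] ℂ) : (V × W) →ₗ[ℂ] ℂ))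
      (ContinuousLinearMap.isClosed_ker _) (fun j => by
        have h1 := hiso1 j e he
        have h2 : b e.1 (x j) = b' e.2 (y j) := by
          rw [← h.hermitian, h1, h'.hermitian]
        simp [h2]) hf
    simpa [sub_eq_zero] using this
  have hzero1 : ∀ v : V, (∀ i, b v (x i) = 0) → v = 0 := fun v hv =>
    h.eq_zero_of_dense hx (by rintro _ ⟨i, rfl⟩; exact hv i)
  have hzero2 : ∀ v : W, (∀ i, b' v (y i) = 0) → v = 0 := fun v hv =>
    h'.eq_zero_of_dense hy (by rintro _ ⟨i, rfl⟩; exact hv i)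
  have hnd : ∀ e ∈ E, (∀ f ∈ E, b e.1 f.1 = 0) → e = 0 := by
    intro e he hef
    refine Prod.ext (hzero1 _ fun i => hef _ (hmem i)) (hzero2 _ fun i => ?_)
    rw [← hiso e he _ (hmem i)]
    exact hef _ (hmem i)
  -- On `E` the product form is twice the form of the first components, hence nondegenerate, and `E`
  -- is itself a Pontryagin space.
  obtain ⟨l, hl⟩ := hk.restrict E hEclosed fun e he hef => hnd e he fun f hf => by
    have h1 := hef f hf
    rw [prodForm_apply, ← hiso e he f hf, ← two_mul] at h1
    simpa using h1
  obtain ⟨C, hC, hbound⟩ := hl.exists_norm_le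
  have : CompleteSpace E := hEclosed.completeSpace_coe
  let π : E →L[ℂ] V := (ContinuousLinearMap.fst ℂ V W).comp E.subtypeL
  -- For the same reason the functional of `e` is controlled by its first component. So the first
  -- projection is bounded below on `E`; its range is closed and dense, hence everything.
  have hπ : ∀ e : E, ‖e‖ ≤ C * (2 * ‖b‖) * ‖π e‖ := by
    intro e
    rw [mul_assoc]
    refine (hbound e).trans (mul_le_mul_of_nonneg_left ?_ hC.le)
    refine ContinuousLinearMap.opNorm_le_bound _ (by positivity) fun f => ?_
    have h1 : restrictForm (prodForm b b') E e f = 2 * b (π e) (π f) := by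
      rw [restrictForm_apply, prodForm_apply, ← hiso e e.2 f f.2, ← two_mul]
      rfl
    have h2 : ‖π f‖ ≤ ‖f‖ := norm_fst_le (f : V × W)
    calc ‖restrictForm (prodForm b b') E e f‖ = 2 * ‖b (π e) (π f)‖ := by rw [h1]; simp
      _ ≤ 2 * (‖b‖ * ‖π e‖ * ‖π f‖) := by gcongr; exact b.le_opNorm₂ _ _
      _ ≤ 2 * (‖b‖ * ‖π e‖ * ‖f‖) := by gcongr
      _ = _ := by ring
  have hanti : AntilipschitzWith (Real.toNNReal (C * (2 * ‖b‖))) π := by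
    refine AddMonoidHomClass.antilipschitz_of_bound π fun e => ?_
    rw [Real.coe_toNNReal _ (by positivity)]
    exact hπ e
  have hrange : LinearMap.range (π : E →ₗ[ℂ] V) = ⊤ := by
    have h1 : IsClosed (LinearMap.range (π : E →ₗ[ℂ] V) : Set V) :=
      hanti.isClosed_range π.uniformContinuous
    rw [eq_top_iff, ← hx]
    refine Submodule.topologicalClosure_minimal _ (Submodule.span_le.mpr ?_) h1
    rintro _ ⟨i, rfl⟩
    exact ⟨⟨_, hmem i⟩, rfl⟩
  let e : E ≃L[ℂ] V := ContinuousLinearEquiv.ofBijective π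
    (LinearMap.ker_eq_bot.mpr hanti.injective) hrange
  refine ⟨((ContinuousLinearMap.snd ℂ V W).comp E.subtypeL).comp (e.symm : V →L[ℂ] E), fun i => ?_,
    ?_⟩
  · have h1 : e.symm (x i) = ⟨(x i, y i), hmem i⟩ := by
      rw [ContinuousLinearEquiv.symm_apply_eq]
      rfl
    simp [h1]
  · rw [injective_iff_map_eq_zero]
    intro v hv
    have h1 : (e.symm v : V × W).2 = 0 := hv
    have h2 : (e.symm v : V × W) = 0 := hnd _ (e.symm v).2 fun f hf => by
      rw [hiso _ (e.symm v).2 f hf, h1]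
      simp
    have h3 : e.symm v = 0 := Subtype.ext h2
    simpa using h3

end Isometry

/-! ### Resolvents of bounded operators -/

section Resolvent

variable {E : Type*} [NormedAddCommGroup E] [NormedSpace ℂ E] {A : E →L[ℂ] E} {z w : ℂ}

/-- The resolvent `(A - z)⁻¹`. -/
def res (A : E →L[ℂ] E) (z : ℂ) : E →L[ℂ] E := Ring.inverse (A - z • (1 : E →L[ℂ] E))

theorem mem_resolventSet_iff_isUnit : z ∈ resolventSet ℂ A ↔ IsUnit (A - z • (1 : E →L[ℂ] E)) := by
  rw [spectrum.mem_resolventSet_iff, Algebra.algebraMap_eq_smul_one, ← IsUnit.neg_iff, neg_sub]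

theorem res_eq_neg_resolvent : res A z = -resolvent A z := by
  rw [res, resolvent, Algebra.algebraMap_eq_smul_one, ← neg_sub (z • (1 : E →L[ℂ] E)) A]
  by_cases h : IsUnit (z • (1 : E →L[ℂ] E) - A)
  · obtain ⟨u, hu⟩ := h
    rw [← hu, ← Units.val_neg, Ring.inverse_unit, Ring.inverse_unit]
    simp
  · rw [Ring.inverse_non_unit _ h, Ring.inverse_non_unit _ (by rwa [IsUnit.neg_iff]), neg_zero]

theorem sub_mul_res (hz : z ∈ resolventSet ℂ A) : (A - z • (1 : E →L[ℂ] E)) * res A z = 1 :=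
  Ring.mul_inverse_cancel _ (mem_resolventSet_iff_isUnit.mp hz)

theorem res_mul_sub (hz : z ∈ resolventSet ℂ A) : res A z * (A - z • (1 : E →L[ℂ] E)) = 1 :=
  Ring.inverse_mul_cancel _ (mem_resolventSet_iff_isUnit.mp hz)

theorem apply_res (hz : z ∈ resolventSet ℂ A) (x : E) : A (res A z x) = x + z • res A z x := by
  have := DFunLike.congr_fun (sub_mul_res hz) x
  simpa [sub_eq_iff_eq_add] using this

theorem res_apply_sub (hz : z ∈ resolventSet ℂ A) (x : E) : res A z (A x - z • x) = x := by
  simpa using DFunLike.congr_fun (res_mul_sub hz) x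

theorem eq_res_of_apply (hz : z ∈ resolventSet ℂ A) {x y : E} (h : A x - z • x = y) :
    x = res A z y := by
  rw [← h, res_apply_sub hz]

theorem res_sub_res (hz : z ∈ resolventSet ℂ A) (hw : w ∈ resolventSet ℂ A) (x : E) :
    res A z x - res A w x = (z - w) • res A w (res A z x) := by
  have h1 : res A z x - res A w x = res A w (A (res A z x - res A w x) - w • (res A z x - res A w x)) :=
    (res_apply_sub hw _).symm
  rw [h1, ← map_smul]
  congr 1
  rw [map_sub, apply_res hz, apply_res hw]
  module

theorem res_comm (hz : z ∈ resolventSet ℂ A) (hw : w ∈ resolventSet ℂ A) (x : E) :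
    res A w (res A z x) = res A z (res A w x) := by
  refine (eq_res_of_apply hz ?_)
  have h1 : A (res A w (res A z x)) - z • res A w (res A z x)
      = res A z x + (w - z) • res A w (res A z x) := by
    rw [apply_res hw]; module
  rw [h1, ← neg_sub z w, neg_smul, ← res_sub_res hz hw]
  abel

theorem analyticAt_res [CompleteSpace E] (hz : z ∈ resolventSet ℂ A) : AnalyticAt ℂ (res A) z := by
  obtain ⟨u, hu⟩ := mem_resolventSet_iff_isUnit.mp hz
  have h1 : AnalyticAt ℂ Ring.inverse (A - z • (1 : E →L[ℂ] E)) := hu ▸ analyticAt_inverse u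
  have h2 : AnalyticAt ℂ (fun z : ℂ => A - z • (1 : E →L[ℂ] E)) z := by fun_prop
  exact AnalyticAt.comp (f := fun z : ℂ => A - z • (1 : E →L[ℂ] E)) h1 h2

theorem continuousAt_res [CompleteSpace E] (hz : z ∈ resolventSet ℂ A) : ContinuousAt (res A) z :=
  (analyticAt_res hz).continuousAt

theorem resolventSet_mem_nhds [CompleteSpace E] (hz : z ∈ resolventSet ℂ A) :
    resolventSet ℂ A ∈ 𝓝 z := (spectrum.isOpen_resolventSet A).mem_nhds hz

theorem eventually_mem_resolventSet [CompleteSpace E] (A : E →L[ℂ] E) :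
    ∀ᶠ z in Bornology.cobounded ℂ, z ∈ resolventSet ℂ A :=
  (spectrum.eventually_isUnit_resolvent A).mono fun _ h => spectrum.isUnit_resolvent.mpr h

theorem tendsto_res_cobounded [CompleteSpace E] (A : E →L[ℂ] E) :
    Tendsto (res A) (Bornology.cobounded ℂ) (𝓝 0) := by
  have := (spectrum.resolvent_tendsto_cobounded A (𝕜 := ℂ)).neg
  simpa [funext fun z => res_eq_neg_resolvent (A := A) (z := z)] using this

theorem mem_resolventSet_of_bijective [CompleteSpace E]
    (h : Function.Bijective fun x => A x - z • x) : z ∈ resolventSet ℂ A := by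
  rw [mem_resolventSet_iff_isUnit, ContinuousLinearMap.isUnit_iff_bijective]
  exact h

end Resolvent

/-! ### Self-adjoint operators with respect to a form -/

section SelfAdjoint

variable {K : Type*} [NormedAddCommGroup K] [NormedSpace ℂ K] {B : K →L⋆[ℂ] K →L[ℂ] ℂ} {n : ℕ}
  {A : K →L[ℂ] K} {z w : ℂ}

/-- The Hilbert space argument: `Im B x ((A - w) x) = -Im w · B x x` bounds `A - w` below, so the
range of `A - z` is closed. A vector orthogonal to it is annihilated by `A - z̄`, to which the lower
bound applies as well. -/
theorem mem_resolventSet_of_pos [CompleteSpace K] (hB : IsHermitianForm B) {c : ℝ} (hc : 0 < c)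
    (hpos : ∀ x, c * ‖x‖ ^ 2 ≤ (B x x).re) (hA : IsFormSelfAdjoint B A) (hz : z.im ≠ 0) :
    z ∈ resolventSet ℂ A := by
  have hbelow : ∀ {w : ℂ}, w.im ≠ 0 → ∀ x, |w.im| * c * ‖x‖ ≤ ‖B‖ * ‖A x - w • x‖ := by
    intro w hw x
    rcases eq_or_ne x 0 with rfl | hx
    · simp
    have hx' : 0 < ‖x‖ := by simpa using hx
    have h1 : (B x (A x)).im = 0 := by
      rw [← Complex.conj_eq_iff_im, hB, hA]
    have h2 : (B x (A x - w • x)).im = -(w.im * (B x x).re) := by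
      simp [h1, hB.im_self]
    have h3 : |w.im| * (c * ‖x‖ ^ 2) ≤ ‖B‖ * ‖x‖ * ‖A x - w • x‖ := by
      calc |w.im| * (c * ‖x‖ ^ 2) ≤ |w.im| * (B x x).re := by gcongr; exact hpos x
        _ = |(B x (A x - w • x)).im| := by
          rw [h2, abs_neg, abs_mul, abs_of_nonneg (le_trans (by positivity) (hpos x))]
        _ ≤ ‖B x (A x - w • x)‖ := Complex.abs_im_le_norm _
        _ ≤ _ := B.le_opNorm₂ _ _
    refine le_of_mul_le_mul_right ?_ hx'
    nlinarith
  have hinj : ∀ {w : ℂ}, w.im ≠ 0 → ∀ x, A x - w • x = 0 → x = 0 := by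
    intro w hw x hx
    have h1 := hbelow hw x
    rw [hx, norm_zero, mul_zero] at h1
    have h2 : 0 < |w.im| * c := mul_pos (abs_pos.mpr hw) hc
    have h3 : ‖x‖ ≤ 0 := by
      by_contra hcon
      push Not at hcon
      nlinarith [mul_pos h2 hcon]
    simpa using h3
  set T : K →L[ℂ] K := A - z • (1 : K →L[ℂ] K) with hT
  have hTx : ∀ x, T x = A x - z • x := fun x => by simp [hT]
  have hd : 0 < |z.im| * c := mul_pos (abs_pos.mpr hz) hc
  have hanti : AntilipschitzWith (Real.toNNReal ((|z.im| * c)⁻¹ * ‖B‖)) T := by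
    refine AddMonoidHomClass.antilipschitz_of_bound T fun x => ?_
    rw [Real.coe_toNNReal _ (by positivity), hTx, mul_assoc, inv_mul_eq_div, le_div_iff₀ hd, mul_comm]
    exact hbelow hz x
  have hclosed : IsClosed (LinearMap.range (T : K →ₗ[ℂ] K) : Set K) :=
    hanti.isClosed_range T.uniformContinuous
  have : CompleteSpace (LinearMap.range (T : K →ₗ[ℂ] K)) := hclosed.completeSpace_coe
  refine mem_resolventSet_of_bijective ⟨fun x y hxy => hanti.injective ?_, fun x => ?_⟩
  · simpa [hTx] using hxy
  · obtain ⟨_, ⟨y, rfl⟩, hr⟩ := exists_sub_orthogonal_of_pos hB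
      (LinearMap.range (T : K →ₗ[ℂ] K)) hc (fun x _ => hpos x) x
    refine ⟨y, ?_⟩
    set u := x - (T : K →ₗ[ℂ] K) y with hu
    have h1 : A u - conj z • u = 0 := by
      have h2 : ∀ v, B (A u - conj z • u) v = 0 := by
        intro v
        have := hr _ ⟨v, rfl⟩
        change B u (T v) = 0 at this
        rw [hTx] at this
        simpa [hA u v] using this
      have h3 := hpos (A u - conj z • u)
      rw [h2] at h3
      have h4 : ‖A u - conj z • u‖ ^ 2 ≤ 0 := by
        by_contra hcon
        push Not at hcon
        have := mul_pos hc hcon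
        simp only [Complex.zero_re] at h3
        linarith
      simpa using le_antisymm h4 (by positivity)
    have h5 : u = 0 := hinj (w := conj z) (by simpa using hz) u h1
    rw [hu, sub_eq_zero, ContinuousLinearMap.coe_coe, hTx] at h5
    exact h5.symm

/-- `A - z̄` is the adjoint of `A - z`: surjectivity of the latter gives injectivity, and Riesz
representation of `v ↦ B k (res A z v)` solves `(A - z̄) x = k`. -/
theorem conj_mem_resolventSet (h : IsPontryaginSpace B n) (hA : IsFormSelfAdjoint B A)
    (hz : z ∈ resolventSet ℂ A) : conj z ∈ resolventSet ℂ A := by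
  have := h.complete
  have hsub : ∀ x y, B (A x - conj z • x) y = B x (A y - z • y) := fun x y => by
    simp [hA x y]
  refine mem_resolventSet_of_bijective ⟨fun x y hxy => ?_, fun k => ?_⟩
  · rw [← sub_eq_zero]
    refine h.eq_zero fun v => ?_
    have h1 : A (x - y) - conj z • (x - y) = 0 := by
      simp only [map_sub, smul_sub]
      rw [sub_sub_sub_comm, sub_eq_zero]
      exact hxy
    have h2 := hsub (x - y) (res A z v)
    rw [h1, apply_res hz] at h2
    simpa using h2.symm
  · obtain ⟨x, hx⟩ := h.exists_eq ((B k).comp (res A z))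
    refine ⟨x, ?_⟩
    simp only
    rw [← sub_eq_zero]
    refine h.eq_zero fun v => ?_
    rw [map_sub, sub_apply, hsub, hx, ContinuousLinearMap.comp_apply, res_apply_sub hz, sub_self]

theorem form_res (h : IsPontryaginSpace B n) (hA : IsFormSelfAdjoint B A)
    (hz : z ∈ resolventSet ℂ A) (x y : K) : B (res A z x) y = B x (res A (conj z) y) := by
  have hz' := conj_mem_resolventSet h hA hz
  have h1 := hA (res A z x) (res A (conj z) y)
  rw [apply_res hz, apply_res hz'] at h1
  simpa using h1.symm

end SelfAdjoint

/-! ### An analytic denominator for the resolvent off the real axis -/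

section Denominator

theorem exists_eq_comp_of_finiteDimensional_range {K : Type*} [NormedAddCommGroup K]
    [NormedSpace ℂ K] (f : K →L[ℂ] K) [FiniteDimensional ℂ (LinearMap.range (f : K →ₗ[ℂ] K))] :
    ∃ (n : ℕ) (U : (Fin n → ℂ) →L[ℂ] K) (V : K →L[ℂ] (Fin n → ℂ)), f = U ∘L V := by
  let e := (Module.finBasis ℂ (LinearMap.range (f : K →ₗ[ℂ] K))).equivFun.toContinuousLinearEquiv
  let g : K →L[ℂ] LinearMap.range (f : K →ₗ[ℂ] K) := f.codRestrict _ fun x => ⟨x, rfl⟩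
  refine ⟨Module.finrank ℂ (LinearMap.range (f : K →ₗ[ℂ] K)),
    (LinearMap.range (f : K →ₗ[ℂ] K)).subtypeL ∘L (e.symm : _ →L[ℂ] _), (e : _ →L[ℂ] _) ∘L g, ?_⟩
  ext x
  change f x = ((e.symm (e (g x)) : LinearMap.range (f : K →ₗ[ℂ] K)) : K)
  rw [e.symm_apply_apply]
  rfl

theorem analyticAt_det {n : ℕ} {M : ℂ → Matrix (Fin n) (Fin n) ℂ} {z : ℂ}
    (hM : ∀ i j, AnalyticAt ℂ (fun z => M z i j) z) : AnalyticAt ℂ (fun z => (M z).det) z := by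
  simp only [Matrix.det_apply']
  refine Finset.analyticAt_fun_sum _ fun σ _ => ?_
  exact analyticAt_const.mul (Finset.analyticAt_fun_prod _ fun i _ => hM _ _)

/-- The classical adjoint of an analytic family of operators on a finite-dimensional space. -/
theorem exists_analytic_adjugate {n : ℕ} (m : ℂ → (Fin n → ℂ) →L[ℂ] (Fin n → ℂ)) :
    ∃ (d : ℂ → ℂ) (a : ℂ → (Fin n → ℂ) →L[ℂ] (Fin n → ℂ)), ∀ z,
      m z * a z = d z • 1 ∧ a z * m z = d z • 1 ∧ (d z ≠ 0 ↔ Function.Injective (m z)) ∧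
      (AnalyticAt ℂ m z → AnalyticAt ℂ d z ∧ AnalyticAt ℂ a z) := by
  let M : ℂ → Matrix (Fin n) (Fin n) ℂ := fun z =>
    LinearMap.toMatrix' (m z : (Fin n → ℂ) →ₗ[ℂ] (Fin n → ℂ))
  have hM : ∀ z, Matrix.toLin' (M z) = (m z : (Fin n → ℂ) →ₗ[ℂ] (Fin n → ℂ)) := fun z =>
    Matrix.toLin'_toMatrix' _
  let φ : Matrix (Fin n) (Fin n) ℂ →ₗ[ℂ] (Fin n → ℂ) →L[ℂ] (Fin n → ℂ) :=
    (LinearMap.toContinuousLinearMap : _ ≃ₗ[ℂ] _).toLinearMap ∘ₗ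
      (Matrix.toLin' : Matrix (Fin n) (Fin n) ℂ ≃ₗ[ℂ] _).toLinearMap
  have hφ : ∀ N x, φ N x = N.mulVec x := fun N x => by simp [φ]
  have hm : ∀ z x, m z x = (M z).mulVec x := fun z x => by
    rw [← Matrix.toLin'_apply, hM]; rfl
  refine ⟨fun z => (M z).det, fun z => φ (M z).adjugate, fun z => ⟨?_, ?_, ?_, fun hz => ?_⟩⟩
  · ext1 x
    simp [hφ, hm, Matrix.mulVec_mulVec, Matrix.mul_adjugate, Matrix.smul_mulVec]
  · ext1 x
    simp [hφ, hm, Matrix.mulVec_mulVec, Matrix.adjugate_mul, Matrix.smul_mulVec]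
  · rw [← isUnit_iff_ne_zero, ← Matrix.isUnit_iff_isUnit_det, ← Matrix.mulVec_injective_iff_isUnit]
    simp only [Function.Injective, hm]
  · have hentry : ∀ i j, AnalyticAt ℂ (fun z => M z i j) z := by
      intro i j
      have h1 : (fun z => M z i j) = fun z =>
          (ContinuousLinearMap.proj (R := ℂ) (φ := fun _ : Fin n => ℂ) i) (m z (Pi.single j 1)) := by
        ext z
        simp [M, LinearMap.toMatrix'_apply]
      rw [h1]
      have h2 : AnalyticAt ℂ (fun z => m z (Pi.single j 1)) z := by
        exact ((ContinuousLinearMap.apply ℂ (Fin n → ℂ) (Pi.single j (1 : ℂ))).analyticAt _).comp hz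
      exact (ContinuousLinearMap.analyticAt _ _).comp h2
    refine ⟨analyticAt_det hentry, ?_⟩
    have hadj : ∀ i j, AnalyticAt ℂ (fun z => (M z).adjugate i j) z := by
      intro i j
      simp only [Matrix.adjugate_apply]
      refine analyticAt_det fun k l => ?_
      simp only [Matrix.updateRow_apply]
      split_ifs
      · exact analyticAt_const
      · exact hentry k l
    have hsum : (fun z => φ (M z).adjugate)
        = fun z => ∑ i, ∑ j, (M z).adjugate i j • φ (Matrix.single i j 1) := by
      ext1 z
      conv_lhs => rw [Matrix.matrix_eq_sum_single (M z).adjugate]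
      simp only [map_sum]
      refine Finset.sum_congr rfl fun i _ => Finset.sum_congr rfl fun j _ => ?_
      rw [← map_smul, Matrix.smul_single, smul_eq_mul, mul_one]
    rw [hsum]
    exact Finset.analyticAt_fun_sum _ fun i _ => Finset.analyticAt_fun_sum _ fun j _ =>
      (hadj i j).smul analyticAt_const

variable {K : Type*} [NormedAddCommGroup K] [NormedSpace ℂ K] {B : K →L⋆[ℂ] K →L[ℂ] ℂ} {n : ℕ}
  {A : K →L[ℂ] K} {z w : ℂ}

/-- The resolvent of a self-adjoint operator in a Pontryagin space is, off the real axis, a quotient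
of analytic functions. -/
theorem exists_resolvent_denominator (h : IsPontryaginSpace B n) (hA : IsFormSelfAdjoint B A) :
    ∃ (d : ℂ → ℂ) (F : ℂ → K →L[ℂ] K), ∀ z : ℂ, z.im ≠ 0 →
      AnalyticAt ℂ d z ∧ AnalyticAt ℂ F z ∧ (d z ≠ 0 ↔ z ∈ resolventSet ℂ A) ∧
      (z ∈ resolventSet ℂ A → F z = d z • res A z) := by
  have := h.complete
  obtain ⟨p, hp, hsymm, hfin, -, -, hherm, c, hc, hpos⟩ := h.exists_symmetry
  -- The compression of `A` to the positive summand is self-adjoint for the Hilbert space form, so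
  -- all nonreal points lie in its resolvent set, and it differs from `A` by a finite-rank operator.
  set T : K →L[ℂ] K := (1 - p) * A * (1 - p) with hTdef
  have hTx : ∀ x, T x = A (x - p x) - p (A (x - p x)) := fun x => by simp [hTdef]
  have hT : IsFormSelfAdjoint (B.comp (1 - (2 : ℂ) • p)) T := by
    intro x y
    simp [hTx, hp, hsymm, hA _ _]
    ring
  have hmem : ∀ z : ℂ, z.im ≠ 0 → z ∈ resolventSet ℂ T := fun z hz =>
    mem_resolventSet_of_pos hherm hc hpos hT hz
  have hrange : FiniteDimensional ℂ (LinearMap.range ((A - T : K →L[ℂ] K) : K →ₗ[ℂ] K)) := by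
    have hle : LinearMap.range ((A - T : K →L[ℂ] K) : K →ₗ[ℂ] K) ≤
        LinearMap.range (p : K →ₗ[ℂ] K) ⊔
          (LinearMap.range (p : K →ₗ[ℂ] K)).map (A : K →ₗ[ℂ] K) := by
      rintro _ ⟨x, rfl⟩
      have h1 : ((A - T : K →L[ℂ] K) : K →ₗ[ℂ] K) x = p (A (x - p x)) + A (p x) := by
        simp [hTx]
        abel
      rw [h1]
      exact Submodule.add_mem_sup ⟨_, rfl⟩ ⟨p x, ⟨x, rfl⟩, rfl⟩
    exact Submodule.finiteDimensional_of_le hle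
  obtain ⟨k, U, V, hUV⟩ := exists_eq_comp_of_finiteDimensional_range (A - T)
  have hAx : ∀ x, A x = T x + U (V x) := fun x => by
    have := DFunLike.congr_fun hUV x
    simp only [sub_apply, ContinuousLinearMap.comp_apply] at this
    rw [← this]; abel
  -- With `A = T + UV`, invertibility of `A - z` reduces to that of the finite matrix `1 + V (T -
  -- z)⁻¹ U`. Its determinant is the denominator `d`, and `F` is the Woodbury formula multiplied by
  -- `d`, with the adjugate in place of the inverse.
  let m : ℂ → (Fin k → ℂ) →L[ℂ] (Fin k → ℂ) := fun z => 1 + V ∘L (res T z ∘L U)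
  have hmx : ∀ z x, m z x = x + V (res T z (U x)) := fun z x => rfl
  obtain ⟨d, a, hda⟩ := exists_analytic_adjugate m
  let F : ℂ → K →L[ℂ] K := fun z =>
    d z • res T z - res T z ∘L (U ∘L (a z ∘L (V ∘L res T z)))
  have hFx : ∀ z x, F z x = d z • res T z x - res T z (U (a z (V (res T z x)))) := fun z x => rfl
  have hAF : ∀ z : ℂ, z.im ≠ 0 → ∀ x, A (F z x) - z • F z x = d z • x := by
    intro z hz x
    have h1 : a z (V (res T z x)) + V (res T z (U (a z (V (res T z x))))) = d z • V (res T z x) := by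
      rw [← hmx]
      exact DFunLike.congr_fun (hda z).1 (V (res T z x))
    have h2 : U (a z (V (res T z x))) + U (V (res T z (U (a z (V (res T z x))))))
        = d z • U (V (res T z x)) := by
      rw [← map_add, h1, map_smul]
    rw [hAx, hFx]
    simp only [map_sub, map_smul, apply_res (hmem z hz), smul_add, smul_sub]
    rw [← h2]
    simp only [smul_comm z (d z)]
    abel
  have hFA : ∀ z : ℂ, z.im ≠ 0 → ∀ x, F z (A x - z • x) = d z • x := by
    intro z hz x
    have h0 : res T z (A x - z • x) = x + res T z (U (V x)) := by
      rw [hAx, add_sub_right_comm, map_add, res_apply_sub (hmem z hz)]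
    have h1 : a z (V x + V (res T z (U (V x)))) = d z • V x := by
      rw [← hmx]
      exact DFunLike.congr_fun (hda z).2.1 (V x)
    rw [hFx, h0, map_add, h1]
    simp
  refine ⟨d, F, fun z hz => ?_⟩
  have hres : AnalyticAt ℂ (res T) z := analyticAt_res (hmem z hz)
  have hm : AnalyticAt ℂ m z := by
    refine analyticAt_const.add ?_
    exact (((ContinuousLinearMap.compL ℂ (Fin k → ℂ) K (Fin k → ℂ) V).comp
      ((ContinuousLinearMap.compL ℂ (Fin k → ℂ) K K).flip U)).analyticAt _).comp hres
  obtain ⟨hd, ha⟩ := (hda z).2.2.2 hm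
  refine ⟨hd, ?_, ⟨fun h0 => ?_, fun hzA => ?_⟩, fun hzA => ?_⟩
  · refine (hd.smul hres).sub ?_
    have h1 : AnalyticAt ℂ (fun z => V ∘L res T z) z :=
      ((ContinuousLinearMap.compL ℂ K K (Fin k → ℂ) V).analyticAt _).comp hres
    have h2 : AnalyticAt ℂ (fun z => a z ∘L (V ∘L res T z)) z :=
      ((ContinuousLinearMap.compL ℂ K (Fin k → ℂ) (Fin k → ℂ)).analyticAt_bilinear _).comp
        (ha.prod h1)
    have h3 : AnalyticAt ℂ (fun z => U ∘L (a z ∘L (V ∘L res T z))) z :=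
      ((ContinuousLinearMap.compL ℂ K (Fin k → ℂ) K U).analyticAt _).comp h2
    exact ((ContinuousLinearMap.compL ℂ K K K).analyticAt_bilinear _).comp (hres.prod h3)
  · refine mem_resolventSet_of_bijective ⟨fun x y hxy => ?_, fun x => ⟨(d z)⁻¹ • F z x, ?_⟩⟩
    · have h1 := hFA z hz x
      have h2 := hFA z hz y
      simp only at hxy
      rw [hxy, h2] at h1
      exact (smul_right_injective K h0 h1).symm
    · simp only [map_smul]
      rw [smul_comm z, ← smul_sub, hAF z hz, smul_smul, inv_mul_cancel₀ h0, one_smul]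
  -- A kernel vector `x` of `m z` yields the solution `y = (T - z)⁻¹ U x` of `A y = z y`, which
  -- vanishes for `z ∈ ρ(A)`; then `x = -V y = 0`.
  · rw [(hda z).2.2.1, injective_iff_map_eq_zero]
    intro x hx
    rw [hmx] at hx
    set y := res T z (U x) with hy
    have h1 : A y - z • y = 0 := by
      rw [hAx, hy, apply_res (hmem z hz), ← hy]
      have : U x + U (V y) = 0 := by rw [← map_add, hx, map_zero]
      rw [← this]; abel
    have h2 : y = 0 := by rw [eq_res_of_apply hzA h1, map_zero]
    rw [h2, map_zero, add_zero] at hx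
    exact hx
  · ext1 x
    rw [smul_apply, ← map_smul]
    exact eq_res_of_apply hzA (hAF z hz x)

end Denominator

/-! ### Half-planes and rays to infinity -/

section HalfPlane

theorem isPreconnected_halfPlane (z : ℂ) : IsPreconnected {w : ℂ | 0 < w.im * z.im} := by
  have h : Convex ℝ {w : ℂ | 0 < w.im * z.im} := by
    intro w hw w' hw' a b ha hb hab
    simp only [Set.mem_ofPred_eq, Complex.add_im, Complex.smul_im, smul_eq_mul] at *
    rcases eq_or_lt_of_le ha with rfl | ha
    · simp only [zero_add] at hab
      simpa [hab] using hw'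
    · have := mul_pos ha hw
      have := mul_nonneg hb hw'.le
      nlinarith
  exact h.isPreconnected

theorem self_mem_halfPlane {z : ℂ} (hz : z.im ≠ 0) : z ∈ {w : ℂ | 0 < w.im * z.im} :=
  mul_self_pos.mpr hz

theorem tendsto_smul_cobounded {z : ℂ} (hz : z.im ≠ 0) :
    Tendsto (fun t : ℝ => (t : ℂ) * z) atTop (Bornology.cobounded ℂ) := by
  rw [← tendsto_norm_atTop_iff_cobounded]
  have hz' : 0 < ‖z‖ := norm_pos_iff.mpr (by rintro rfl; simp at hz)
  simp only [norm_mul, Complex.norm_real, Real.norm_eq_abs]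
  exact tendsto_abs_atTop_atTop.atTop_mul_const hz'

theorem eventually_im_ne_zero {z : ℂ} (hz : z.im ≠ 0) : ∀ᶠ w in 𝓝 z, w.im ≠ 0 :=
  Complex.continuous_im.continuousAt.eventually_ne hz

theorem frequently_im_pos_of_real {z : ℂ} (hz : z.im = 0) : ∃ᶠ w in 𝓝[≠] z, 0 < w.im := by
  rw [frequently_iff]
  intro U hU
  obtain ⟨ε, hε, hU⟩ := Metric.mem_nhdsWithin_iff.mp hU
  have h1 : (z + ((ε / 2 : ℝ) : ℂ) * Complex.I).im = ε / 2 := by simp [hz]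
  refine ⟨z + ((ε / 2 : ℝ) : ℂ) * Complex.I, hU ⟨?_, ?_⟩, ?_⟩
  · rw [Metric.mem_ball, dist_eq_norm, add_sub_cancel_left, norm_mul, Complex.norm_I, mul_one,
      Complex.norm_real, Real.norm_eq_abs, abs_of_pos (half_pos hε)]
    exact half_lt_self hε
  · intro h
    have h2 := congrArg Complex.im (Set.mem_singleton_iff.mp h)
    rw [h1, hz] at h2
    linarith
  · rw [h1]; exact half_pos hε

end HalfPlane

/-! ### Cyclic subspaces and independence of the nodes -/

section Cyclic

variable {H : Type*} [NormedAddCommGroup H] [InnerProductSpace ℂ H]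
variable {K : Type*} [NormedAddCommGroup K] [NormedSpace ℂ K] {B : K →L⋆[ℂ] K →L[ℂ] ℂ} {n : ℕ}
  {A : K →L[ℂ] K} {Γ : H →L[ℂ] K} {z w : ℂ}

/-- If zeros of the denominator accumulated at `z`, it would vanish on the half-plane of `z`. But
large points of that half-plane belong to the resolvent set of the bounded operator `A`. -/
theorem eventually_mem_resolventSet_nhdsNE (h : IsPontryaginSpace B n)
    (hA : IsFormSelfAdjoint B A) (hz : z.im ≠ 0) : ∀ᶠ w in 𝓝[≠] z, w ∈ resolventSet ℂ A := by
  have := h.complete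
  obtain ⟨d, F, hdF⟩ := exists_resolvent_denominator h hA
  have hne : ∀ w ∈ {w : ℂ | 0 < w.im * z.im}, w.im ≠ 0 := by
    rintro w hw h0
    simp [h0] at hw
  by_contra hcon
  have hfreq : ∃ᶠ w in 𝓝[≠] z, d w = 0 := by
    have h1 : ∀ᶠ w in 𝓝[≠] z, w.im ≠ 0 := (eventually_im_ne_zero hz).filter_mono nhdsWithin_le_nhds
    refine ((not_eventually.mp hcon).and_eventually h1).mono fun w hw => ?_
    by_contra h2
    exact hw.1 ((hdF w hw.2).2.2.1.mp h2)
  have hzero := AnalyticOnNhd.eqOn_zero_of_preconnected_of_frequently_eq_zero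
    (fun w hw => (hdF w (hne w hw)).1) (isPreconnected_halfPlane z) (self_mem_halfPlane hz) hfreq
  have hlarge := (tendsto_smul_cobounded hz).eventually (eventually_mem_resolventSet A)
  obtain ⟨t, ht, ht0⟩ := (hlarge.and (eventually_gt_atTop 0)).exists
  have hmem : (t : ℂ) * z ∈ {w : ℂ | 0 < w.im * z.im} := by
    simp only [Set.mem_ofPred_eq, Complex.im_ofReal_mul, mul_assoc]
    exact mul_pos ht0 (mul_self_pos.mpr hz)
  exact (hdF _ (hne _ hmem)).2.2.1.mpr ht (hzero hmem)

theorem resolventSet_mem_codiscreteWithin (h : IsPontryaginSpace B n)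
    (hA : IsFormSelfAdjoint B A) :
    resolventSet ℂ A ∈ Filter.codiscreteWithin {z : ℂ | z.im ≠ 0} := by
  rw [mem_codiscreteWithin_iff_forall_mem_nhdsNE]
  intro z hz
  filter_upwards [eventually_mem_resolventSet_nhdsNE h hA hz] with w hw using Or.inl hw

theorem meromorphicAt_res (h : IsPontryaginSpace B n) (hA : IsFormSelfAdjoint B A)
    (hz : z.im ≠ 0) : MeromorphicAt (res A) z := by
  obtain ⟨d, F, hdF⟩ := exists_resolvent_denominator h hA
  have h1 : MeromorphicAt (fun w => (d w)⁻¹ • F w) z :=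
    (hdF z hz).1.meromorphicAt.inv.smul (hdF z hz).2.1.meromorphicAt
  refine h1.congr ?_
  filter_upwards [eventually_mem_resolventSet_nhdsNE h hA hz,
    (eventually_im_ne_zero hz).filter_mono nhdsWithin_le_nhds] with w hw hw'
  rw [(hdF w hw').2.2.2 hw, smul_smul, inv_mul_cancel₀ ((hdF w hw').2.2.1.mpr hw), one_smul]

/-- The identity theorem for `F(w) x` modulo `N`, the numerator `F` being analytic on the whole
half-plane. Closedness of `N` makes the quotient a normed space. -/
theorem res_mem_of_frequently (h : IsPontryaginSpace B n) (hA : IsFormSelfAdjoint B A)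
    {N : Submodule ℂ K} (hN : IsClosed (N : Set K)) (hz : z.im ≠ 0) {x : K}
    (hfreq : ∃ᶠ w in 𝓝[≠] z, w ∈ resolventSet ℂ A ∧ res A w x ∈ N)
    (hw : w ∈ resolventSet ℂ A) (hwz : 0 < w.im * z.im) : res A w x ∈ N := by
  have := hN
  obtain ⟨d, F, hdF⟩ := exists_resolvent_denominator h hA
  have hne : ∀ w ∈ {w : ℂ | 0 < w.im * z.im}, w.im ≠ 0 := by
    rintro w hw h0
    simp [h0] at hw
  have hanal : AnalyticOnNhd ℂ (fun w => N.mkQL (F w x)) {w : ℂ | 0 < w.im * z.im} := by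
    intro w hw
    have h1 : AnalyticAt ℂ (fun w => F w x) w :=
      ((ContinuousLinearMap.apply ℂ K x).analyticAt _).comp (hdF w (hne w hw)).2.1
    exact (N.mkQL.analyticAt _).comp h1
  have hzero := hanal.eqOn_zero_of_preconnected_of_frequently_eq_zero (isPreconnected_halfPlane z)
    (self_mem_halfPlane hz) (by
      have h1 : ∀ᶠ w in 𝓝[≠] z, w.im ≠ 0 :=
        (eventually_im_ne_zero hz).filter_mono nhdsWithin_le_nhds
      refine (hfreq.and_eventually h1).mono fun w hw => ?_
      rw [(hdF w hw.2).2.2.2 hw.1.1]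
      refine (Submodule.Quotient.mk_eq_zero N).mpr ?_
      exact N.smul_mem _ hw.1.2)
  have h2 : F w x ∈ N := (Submodule.Quotient.mk_eq_zero N).mp (hzero hwz)
  have hd := (hdF w (hne w hwz)).2.2.1.mpr hw
  rw [(hdF w (hne w hwz)).2.2.2 hw, smul_apply] at h2
  exact (N.smul_mem_iff hd).mp h2

/-- Along a ray to infinity, `-w (A - w)⁻¹ x` tends to `x`. -/
theorem mem_of_res_mem [CompleteSpace K] {N : Submodule ℂ K} (hN : IsClosed (N : Set K))
    (hz : z.im ≠ 0) {x : K}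
    (hx : ∀ w ∈ resolventSet ℂ A, 0 < w.im * z.im → res A w x ∈ N) : x ∈ N := by
  have h1 := tendsto_smul_cobounded hz
  have h2 : Tendsto (fun t : ℝ => x - A (res A ((t : ℂ) * z) x)) atTop (𝓝 (x - A ((0 : K →L[ℂ] K) x))) :=
    tendsto_const_nhds.sub ((A.continuous.tendsto _).comp
      (((ContinuousLinearMap.apply ℂ K x).continuous.tendsto _).comp
        ((tendsto_res_cobounded A).comp h1)))
  simp only [zero_apply, map_zero, sub_zero] at h2
  refine hN.mem_of_tendsto h2 ?_
  filter_upwards [h1.eventually (eventually_mem_resolventSet A), eventually_gt_atTop 0] with t ht ht0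
  have h3 : x - A (res A ((t : ℂ) * z) x) = -(((t : ℂ) * z) • res A ((t : ℂ) * z) x) := by
    rw [apply_res ht]; abel
  rw [h3]
  refine N.neg_mem (N.smul_mem _ (hx _ ht ?_))
  rw [Complex.im_ofReal_mul, mul_assoc]
  exact mul_pos ht0 (mul_self_pos.mpr hz)

/-- A closed invariant subspace is invariant under the resolvent near infinity. -/
theorem eventually_res_mem_of_invariant [CompleteSpace K] {N : Submodule ℂ K}
    (hN : IsClosed (N : Set K)) (hinv : ∀ x ∈ N, A x ∈ N) {x : K} (hx : x ∈ N) :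
    ∀ᶠ w in Bornology.cobounded ℂ, res A w x ∈ N := by
  have : CompleteSpace N := hN.completeSpace_coe
  let A' : N →L[ℂ] N := (A ∘L N.subtypeL).codRestrict N fun y => hinv y y.2
  filter_upwards [eventually_mem_resolventSet A', eventually_mem_resolventSet A] with w hw' hw
  have h1 := apply_res hw' ⟨x, hx⟩
  have h2 : A (res A' w ⟨x, hx⟩ : N) - w • ((res A' w ⟨x, hx⟩ : N) : K) = x := by
    have := congrArg Subtype.val h1
    change A (res A' w ⟨x, hx⟩ : N) = x + w • ((res A' w ⟨x, hx⟩ : N) : K) at this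
    rw [this, add_sub_cancel_right]
  rw [← eq_res_of_apply hw h2]
  exact (res A' w ⟨x, hx⟩ : N).2

/-- The closed span of `(A - z)⁻¹ Γ h` for `z ∈ D`. -/
def cyclicSpan (A : K →L[ℂ] K) (Γ : H →L[ℂ] K) (D : Set ℂ) : Submodule ℂ K :=
  (Submodule.span ℂ {k : K | ∃ z ∈ D, ∃ h : H, k = res A z (Γ h)}).topologicalClosure

theorem isClosed_cyclicSpan (D : Set ℂ) : IsClosed (cyclicSpan A Γ D : Set K) :=
  Submodule.isClosed_topologicalClosure _

theorem res_mem_cyclicSpan_of_mem {D : Set ℂ} (hz : z ∈ D) (x : H) :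
    res A z (Γ x) ∈ cyclicSpan A Γ D :=
  Submodule.le_topologicalClosure _ (Submodule.subset_span ⟨z, hz, x, rfl⟩)

theorem cyclicSpan_le {D : Set ℂ} {N : Submodule ℂ K} (hN : IsClosed (N : Set K))
    (h : ∀ z ∈ D, ∀ x, res A z (Γ x) ∈ N) : cyclicSpan A Γ D ≤ N := by
  refine Submodule.topologicalClosure_minimal _ (Submodule.span_le.mpr ?_) hN
  rintro _ ⟨z, hz, x, rfl⟩
  exact h z hz x

theorem isMinimalOperator_iff_cyclicSpan :
    IsMinimalOperator A Γ ↔ cyclicSpan A Γ (resolventSet ℂ A) = ⊤ := Iff.rfl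

theorem upperSpan_closure_eq_cyclicSpan (D : Set ℂ) :
    (upperSpan D fun z => res A z ∘L Γ).topologicalClosure
      = cyclicSpan A Γ (D ∩ {z | 0 < z.im}) := by
  rw [upperSpan, cyclicSpan]
  congr 3
  ext y
  constructor
  · rintro ⟨z, hz, hz', x, rfl⟩
    exact ⟨z, ⟨hz, hz'⟩, x, rfl⟩
  · rintro ⟨z, ⟨hz, hz'⟩, x, rfl⟩
    exact ⟨z, hz, hz', x, rfl⟩

variable {D : Set ℂ}

/-- The identity theorem fills the half-plane of `z`; the limit at infinity then gives `Γ x`, and `A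
(A - w)⁻¹ = I + w (A - w)⁻¹` gives invariance. An invariant closed subspace is preserved by the
resolvent near infinity, which reaches the other half-plane, where the identity theorem applies
again. Real points of the resolvent set follow by continuity. -/
theorem cyclicSpan_aux (h : IsPontryaginSpace B n) (hA : IsFormSelfAdjoint B A)
    (hD : D ⊆ resolventSet ℂ A) (hz : z.im ≠ 0) (hfreq : ∃ᶠ w in 𝓝[≠] z, w ∈ D) :
    (∀ x, Γ x ∈ cyclicSpan A Γ D) ∧ (∀ x ∈ cyclicSpan A Γ D, A x ∈ cyclicSpan A Γ D) ∧
      ∀ w ∈ resolventSet ℂ A, ∀ x, res A w (Γ x) ∈ cyclicSpan A Γ D := by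
  have := h.complete
  have hN := isClosed_cyclicSpan (A := A) (Γ := Γ) D
  have hside : ∀ w ∈ resolventSet ℂ A, 0 < w.im * z.im → ∀ x,
      res A w (Γ x) ∈ cyclicSpan A Γ D := fun w hw hwz x =>
    res_mem_of_frequently h hA hN hz
      (hfreq.mono fun v hv => ⟨hD hv, res_mem_cyclicSpan_of_mem hv x⟩) hw hwz
  have hΓ : ∀ x, Γ x ∈ cyclicSpan A Γ D := fun x =>
    mem_of_res_mem hN hz fun w hw hwz => hside w hw hwz x
  have hinv : ∀ x ∈ cyclicSpan A Γ D, A x ∈ cyclicSpan A Γ D := by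
    have hle : cyclicSpan A Γ D ≤ (cyclicSpan A Γ D).comap (A : K →ₗ[ℂ] K) := by
      refine cyclicSpan_le (hN.preimage A.continuous) fun w hw x => ?_
      change A (res A w (Γ x)) ∈ cyclicSpan A Γ D
      rw [apply_res (hD hw)]
      exact Submodule.add_mem _ (hΓ x) (Submodule.smul_mem _ _ (res_mem_cyclicSpan_of_mem hw x))
    exact hle
  have hother : ∀ w ∈ resolventSet ℂ A, 0 < w.im * (conj z).im → ∀ x,
      res A w (Γ x) ∈ cyclicSpan A Γ D := by
    intro w hw hwz x
    have hz' : (conj z).im ≠ 0 := by simpa using hz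
    have hlarge := eventually_res_mem_of_invariant hN hinv (hΓ x)
    have hev : ∀ᶠ v in Bornology.cobounded ℂ, v ∈ resolventSet ℂ A ∧
        res A v (Γ x) ∈ cyclicSpan A Γ D := (eventually_mem_resolventSet A).and hlarge
    obtain ⟨r, -, hr⟩ := (Filter.HasBasis.cobounded_of_norm atTop_basis_Ioi (E := ℂ)).eventually_iff.mp hev
    obtain ⟨t, ht⟩ := (((tendsto_smul_cobounded hz').eventually
      (show ∀ᶠ v in Bornology.cobounded ℂ, r < ‖v‖ from
        (tendsto_norm_cobounded_atTop).eventually (eventually_gt_atTop r))).and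
        (eventually_gt_atTop 0)).exists
    have him : ((t : ℂ) * conj z).im ≠ 0 := by
      rw [Complex.im_ofReal_mul]
      exact mul_ne_zero ht.2.ne' hz'
    refine res_mem_of_frequently h hA hN him ?_ hw ?_
    · refine Eventually.frequently ?_
      have h1 : ∀ᶠ v in 𝓝 ((t : ℂ) * conj z), r < ‖v‖ :=
        continuous_norm.continuousAt.eventually_const_lt ht.1
      exact (h1.filter_mono nhdsWithin_le_nhds).mono fun v hv => hr hv
    · rw [Complex.im_ofReal_mul, mul_left_comm]
      exact mul_pos ht.2 hwz
  have hnonreal : ∀ w ∈ resolventSet ℂ A, w.im ≠ 0 → ∀ x, res A w (Γ x) ∈ cyclicSpan A Γ D := by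
    intro w hw hw0 x
    rcases lt_or_gt_of_ne (mul_ne_zero hw0 hz) with h1 | h1
    · refine hother w hw ?_ x
      rw [Complex.conj_im, mul_neg]
      linarith
    · exact hside w hw h1 x
  refine ⟨hΓ, hinv, fun w hw x => ?_⟩
  by_cases hw0 : w.im = 0
  · have h1 : Tendsto (fun v => res A v (Γ x)) (𝓝 w) (𝓝 (res A w (Γ x))) :=
      ((ContinuousLinearMap.apply ℂ K (Γ x)).continuous.tendsto _).comp (continuousAt_res hw)
    refine hN.mem_of_frequently_of_tendsto (b := 𝓝[≠] w) ?_ (h1.mono_left nhdsWithin_le_nhds)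
    have h2 : ∀ᶠ v in 𝓝[≠] w, v ∈ resolventSet ℂ A := nhdsWithin_le_nhds (resolventSet_mem_nhds hw)
    exact ((frequently_im_pos_of_real hw0).and_eventually h2).mono fun v hv =>
      hnonreal v hv.2 hv.1.ne' x
  · exact hnonreal w hw hw0 x

/-- The cyclic subspace does not depend on the set of nodes. -/
theorem cyclicSpan_eq (h : IsPontryaginSpace B n) (hA : IsFormSelfAdjoint B A)
    (hD : D ⊆ resolventSet ℂ A) (hz : z.im ≠ 0) (hfreq : ∃ᶠ w in 𝓝[≠] z, w ∈ D) :
    cyclicSpan A Γ D = cyclicSpan A Γ (resolventSet ℂ A) :=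
  le_antisymm (cyclicSpan_le (isClosed_cyclicSpan _) fun _ hw x =>
      res_mem_cyclicSpan_of_mem (hD hw) x)
    (cyclicSpan_le (isClosed_cyclicSpan _) (cyclicSpan_aux h hA hD hz hfreq).2.2)

end Cyclic

/-! ### The functions `Γ⁺ (A - z)⁻¹ Γ` -/

section Nevanlinna

variable {H : Type*} [NormedAddCommGroup H] [InnerProductSpace ℂ H] [CompleteSpace H]
variable {K : Type*} [NormedAddCommGroup K] [NormedSpace ℂ K] {B : K →L⋆[ℂ] K →L[ℂ] ℂ} {n : ℕ}
  {A : K →L[ℂ] K} {Γ : H →L[ℂ] K} {z w : ℂ}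

theorem resolventFun_apply (z : ℂ) (x : H) :
    resolventFun B A Γ z x = gammaPlus B Γ (res A z (Γ x)) := rfl

theorem inner_resolventFun (z : ℂ) (x y : H) :
    ⟪resolventFun B A Γ z x, y⟫_ℂ = B (res A z (Γ x)) (Γ y) := by
  rw [resolventFun_apply, inner_gammaPlus]

theorem inner_resolventFun_right (hB : IsHermitianForm B) (z : ℂ) (x y : H) :
    ⟪x, resolventFun B A Γ z y⟫_ℂ = B (Γ x) (res A z (Γ y)) := by
  rw [← inner_conj_symm, inner_resolventFun, hB]

/-- The adjoint of `(A - w)⁻¹` is `(A - w̄)⁻¹`, and the resolvent identity at `z` and `w̄` cancels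
the denominator of the kernel. -/
theorem inner_nevanlinnaKernel_resolventFun (h : IsPontryaginSpace B n)
    (hA : IsFormSelfAdjoint B A) (hz : z ∈ resolventSet ℂ A) (hw : w ∈ resolventSet ℂ A)
    (hzw : z - conj w ≠ 0) (x y : H) :
    ⟪y, nevanlinnaKernel (resolventFun B A Γ) z w x⟫_ℂ = B (res A w (Γ y)) (res A z (Γ x)) := by
  have hw' := conj_mem_resolventSet h hA hw
  rw [nevanlinnaKernel, smul_apply, inner_smul_right, sub_apply, inner_sub_right,
    ContinuousLinearMap.adjoint_inner_right, inner_resolventFun_right h.isHermitianForm,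
    inner_resolventFun, form_res h hA hw, form_res h hA hw, ← map_sub, res_sub_res hz hw', map_smul,
    smul_eq_mul, inv_mul_cancel_left₀ hzw]

theorem sub_conj_ne_zero (hz : 0 < z.im) (hw : 0 < w.im) : z - conj w ≠ 0 := by
  intro h
  have := congrArg Complex.im h
  simp at this
  linarith

theorem adjoint_resolventFun (h : IsPontryaginSpace B n) (hA : IsFormSelfAdjoint B A)
    (hz : z ∈ resolventSet ℂ A) :
    ContinuousLinearMap.adjoint (resolventFun B A Γ (conj z)) = resolventFun B A Γ z := by
  ext1 x
  refine ext_inner_right ℂ fun y => ?_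
  rw [ContinuousLinearMap.adjoint_inner_left, inner_resolventFun,
    inner_resolventFun_right h.isHermitianForm, form_res h hA hz]

theorem resolventFun_eq_comp : resolventFun B A Γ = fun z =>
    ((ContinuousLinearMap.compL ℂ H K H (gammaPlus B Γ)).comp
      ((ContinuousLinearMap.compL ℂ H K K).flip Γ)) (res A z) := rfl

theorem analyticAt_resolventFun [CompleteSpace K] (hz : z ∈ resolventSet ℂ A) :
    AnalyticAt ℂ (resolventFun B A Γ) z := by
  rw [resolventFun_eq_comp]
  exact (ContinuousLinearMap.analyticAt _ _).comp (analyticAt_res hz)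

theorem MeromorphicAt.clm_comp {E F : Type*} [NormedAddCommGroup E] [NormedSpace ℂ E]
    [NormedAddCommGroup F] [NormedSpace ℂ F] {f : ℂ → E} (hf : MeromorphicAt f z) (L : E →L[ℂ] F) :
    MeromorphicAt (fun z => L (f z)) z := by
  obtain ⟨k, hk⟩ := hf
  refine ⟨k, ?_⟩
  have h1 := (L.analyticAt _).comp hk
  refine h1.congr (Eventually.of_forall fun w => ?_)
  simp

theorem meromorphicAt_resolventFun (h : IsPontryaginSpace B n) (hA : IsFormSelfAdjoint B A)
    (hz : z.im ≠ 0) : MeromorphicAt (resolventFun B A Γ) z := by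
  rw [resolventFun_eq_comp]
  exact (meromorphicAt_res h hA hz).clm_comp _

/-- The index of a function `Γ⁺ (A - z)⁻¹ Γ` is the index of the span of the vectors
`(A - z)⁻¹ Γ h`. -/
theorem isGeneralizedNevanlinna_resolventFun (h : IsPontryaginSpace B n)
    (hA : IsFormSelfAdjoint B A) {κ : ℕ}
    (hκ : HasNegativeIndex B (upperSpan (resolventSet ℂ A) fun z => res A z ∘L Γ) κ) :
    IsGeneralizedNevanlinna (resolventSet ℂ A) (resolventFun B A Γ) κ := by
  have := h.complete
  have hiff := (hasNegativeIndex_upperSpan_iff h.isHermitianForm (Q := resolventFun B A Γ)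
    (v := fun z => res A z ∘L Γ) (κ := κ) (D := resolventSet ℂ A) fun _ hz _ hw hz' hw' x y =>
      inner_nevanlinnaKernel_resolventFun h hA hz hw (sub_conj_ne_zero hz' hw') x y).mp hκ
  exact ⟨fun z hz => meromorphicAt_resolventFun h hA hz, resolventSet_mem_codiscreteWithin h hA,
    fun z hz => analyticAt_resolventFun hz.1,
    fun z hz => ⟨conj_mem_resolventSet h hA hz, adjoint_resolventFun h hA hz⟩, hiff.1, hiff.2⟩

theorem IsGeneralizedNevanlinna.hasNegativeIndex (h : IsPontryaginSpace B n)
    (hA : IsFormSelfAdjoint B A) {κ : ℕ}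
    (hQ : IsGeneralizedNevanlinna (resolventSet ℂ A) (resolventFun B A Γ) κ) :
    HasNegativeIndex B (upperSpan (resolventSet ℂ A) fun z => res A z ∘L Γ) κ :=
  (hasNegativeIndex_upperSpan_iff h.isHermitianForm (Q := resolventFun B A Γ)
    (v := fun z => res A z ∘L Γ) (κ := κ) (D := resolventSet ℂ A) fun _ hz _ hw hz' hw' x y =>
      inner_nevanlinnaKernel_resolventFun h hA hz hw (sub_conj_ne_zero hz' hw') x y).mpr
    ⟨hQ.negativeSquares_le, hQ.negativeSquares_attained⟩

end Nevanlinna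

/-! ### The block decomposition and the inverse function -/

section Block

variable {H : Type*} [NormedAddCommGroup H] [InnerProductSpace ℂ H] [CompleteSpace H]
variable {K : Type*} [NormedAddCommGroup K] [NormedSpace ℂ K] {B : K →L⋆[ℂ] K →L[ℂ] ℂ} {n : ℕ}
  {A : K →L[ℂ] K} {Γ : H →L[ℂ] K} {z w : ℂ}

theorem gammaPlus_gramInverse (hG : IsUnit (gammaPlus B Γ ∘L Γ)) (x : H) :
    gammaPlus B Γ (Γ (gramInverse B Γ x)) = x :=
  DFunLike.congr_fun (Ring.mul_inverse_cancel _ hG) x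

theorem gramInverse_gammaPlus (hG : IsUnit (gammaPlus B Γ ∘L Γ)) (x : H) :
    gramInverse B Γ (gammaPlus B Γ (Γ x)) = x :=
  DFunLike.congr_fun (Ring.inverse_mul_cancel _ hG) x

theorem gramProjection_apply (k : K) :
    gramProjection B Γ k = Γ (gramInverse B Γ (gammaPlus B Γ k)) := rfl

theorem gammaPlus_gramProjection (hG : IsUnit (gammaPlus B Γ ∘L Γ)) (k : K) :
    gammaPlus B Γ (gramProjection B Γ k) = gammaPlus B Γ k := by
  rw [gramProjection_apply, gammaPlus_gramInverse hG]

/-- Identifying `(I - P)K` with `ker Γ⁺` shows at once that it is closed and that it is the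
orthogonal complement of `ran Γ`. -/
theorem mem_complementSpace (hG : IsUnit (gammaPlus B Γ ∘L Γ)) {k : K} :
    k ∈ complementSpace B Γ ↔ gammaPlus B Γ k = 0 := by
  constructor
  · rintro ⟨x, rfl⟩
    simp [gammaPlus_gramProjection hG]
  · intro hk
    exact ⟨k, by simp [gramProjection_apply, hk]⟩

theorem isClosed_complementSpace (hG : IsUnit (gammaPlus B Γ ∘L Γ)) :
    IsClosed (complementSpace B Γ : Set K) := by
  have : (complementSpace B Γ : Set K) = {k | gammaPlus B Γ k = 0} := by
    ext k
    exact mem_complementSpace hG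
  rw [this]
  exact isClosed_eq (gammaPlus B Γ).continuous continuous_const

theorem gammaPlus_coe (hG : IsUnit (gammaPlus B Γ ∘L Γ)) (y : complementSpace B Γ) :
    gammaPlus B Γ (y : K) = 0 := (mem_complementSpace hG).mp y.2

theorem coe_complementProj (k : K) :
    (complementProj B Γ k : K) = k - Γ (gramInverse B Γ (gammaPlus B Γ k)) := rfl

theorem complementProj_gamma (hG : IsUnit (gammaPlus B Γ ∘L Γ)) (x : H) :
    complementProj B Γ (Γ x) = 0 :=
  Subtype.ext (by rw [coe_complementProj, gramInverse_gammaPlus hG, sub_self]; rfl)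

theorem complementProj_coe (hG : IsUnit (gammaPlus B Γ ∘L Γ)) (y : complementSpace B Γ) :
    complementProj B Γ (y : K) = y :=
  Subtype.ext (by rw [coe_complementProj, gammaPlus_coe hG]; simp)

theorem form_coe_gamma (hG : IsUnit (gammaPlus B Γ ∘L Γ)) (y : complementSpace B Γ) (x : H) :
    B y (Γ x) = 0 := by
  rw [← inner_gammaPlus, gammaPlus_coe hG, inner_zero_left]

theorem form_gamma_coe (hB : IsHermitianForm B) (hG : IsUnit (gammaPlus B Γ ∘L Γ))
    (y : complementSpace B Γ) (x : H) : B (Γ x) y = 0 :=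
  hB.eq_zero_symm (form_coe_gamma hG y x)

theorem tildeA_apply (hG : IsUnit (gammaPlus B Γ ∘L Γ)) (y : complementSpace B Γ) :
    tildeA B A Γ y = complementProj B Γ (A y) := by
  simp [tildeA, gramProjection_apply, gammaPlus_coe hG]

theorem coe_tildeA (hG : IsUnit (gammaPlus B Γ ∘L Γ)) (y : complementSpace B Γ) :
    (tildeA B A Γ y : K) = A y - Γ (gramInverse B Γ (gammaPlus B Γ (A y))) := by
  rw [tildeA_apply hG, coe_complementProj]

theorem tildeGamma_apply (x : H) :
    tildeGamma B A Γ x = complementProj B Γ (A (Γ (gramInverse B Γ x))) := rfl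

theorem form_gramInverse (hG : IsUnit (gammaPlus B Γ ∘L Γ)) (x y : H) :
    B (Γ (gramInverse B Γ x)) (Γ (gramInverse B Γ y)) = ⟪x, gramInverse B Γ y⟫_ℂ := by
  rw [← inner_gammaPlus, gammaPlus_gramInverse hG]

theorem inner_gramInverse (hB : IsHermitianForm B) (hG : IsUnit (gammaPlus B Γ ∘L Γ)) (x y : H) :
    ⟪gramInverse B Γ x, y⟫_ℂ = ⟪x, gramInverse B Γ y⟫_ℂ := by
  rw [← inner_conj_symm, ← form_gramInverse hG, hB, form_gramInverse hG]

/-- A vector of `(I - P)K` orthogonal to `(I - P)K` is also orthogonal to `ran Γ`, hence to all of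
`K`. -/
theorem exists_isPontryaginSpace_complementSpace (h : IsPontryaginSpace B n)
    (hG : IsUnit (gammaPlus B Γ ∘L Γ)) :
    ∃ m, IsPontryaginSpace (restrictForm B (complementSpace B Γ)) m := by
  refine h.restrict _ (isClosed_complementSpace hG) fun x hx hx0 => h.eq_zero fun k => ?_
  have h1 : k = (complementProj B Γ k : K) + Γ (gramInverse B Γ (gammaPlus B Γ k)) := by
    rw [coe_complementProj, sub_add_cancel]
  rw [h1, map_add, hx0 _ (complementProj B Γ k).2, form_coe_gamma hG ⟨x, hx⟩, add_zero]

theorem isFormSelfAdjoint_tildeA (hB : IsHermitianForm B) (hA : IsFormSelfAdjoint B A)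
    (hG : IsUnit (gammaPlus B Γ ∘L Γ)) :
    IsFormSelfAdjoint (restrictForm B (complementSpace B Γ)) (tildeA B A Γ) := by
  intro x y
  rw [restrictForm_apply, restrictForm_apply, coe_tildeA hG, coe_tildeA hG, map_sub, map_sub,
    sub_apply, form_gamma_coe hB hG, form_coe_gamma hG, hA]

theorem gammaPlus_tildeGamma (hB : IsHermitianForm B) (hA : IsFormSelfAdjoint B A)
    (hG : IsUnit (gammaPlus B Γ ∘L Γ)) (y : complementSpace B Γ) :
    gammaPlus (restrictForm B (complementSpace B Γ)) (tildeGamma B A Γ) y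
      = gramInverse B Γ (gammaPlus B Γ (A y)) := by
  refine ext_inner_right ℂ fun x => ?_
  rw [inner_gammaPlus, restrictForm_apply, tildeGamma_apply, coe_complementProj, map_sub,
    form_coe_gamma hG, sub_zero, inner_gramInverse hB hG, inner_gammaPlus, hA]

theorem hatFun₁_apply (hG : IsUnit (gammaPlus B Γ ∘L Γ)) (z : ℂ) (x : H) :
    hatFun₁ B A Γ z x = z • gramInverse B Γ x
      - gramInverse B Γ (gammaPlus B Γ (A (Γ (gramInverse B Γ x)))) := by
  simp [hatFun₁, gammaPlus_gramInverse hG]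

theorem hatFun₂_apply (hB : IsHermitianForm B) (hA : IsFormSelfAdjoint B A)
    (hG : IsUnit (gammaPlus B Γ ∘L Γ)) (z : ℂ) (x : H) :
    hatFun₂ B A Γ z x = gramInverse B Γ (gammaPlus B Γ
      (A (res (tildeA B A Γ) z (tildeGamma B A Γ x) : complementSpace B Γ))) := by
  rw [hatFun₂, resolventFun_apply, gammaPlus_tildeGamma hB hA hG]

/-- The defect field `Γ (Γ⁺ Γ)⁻¹ - (Ã - z)⁻¹ Γ̃` of the inverse function. -/
def hatGamma (B : K →L⋆[ℂ] K →L[ℂ] ℂ) (A : K →L[ℂ] K) (Γ : H →L[ℂ] K) (z : ℂ) : H →L[ℂ] K :=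
  Γ ∘L gramInverse B Γ -
    (complementSpace B Γ).subtypeL ∘L res (tildeA B A Γ) z ∘L tildeGamma B A Γ

theorem hatGamma_apply (z : ℂ) (x : H) :
    hatGamma B A Γ z x = Γ (gramInverse B Γ x) -
      (res (tildeA B A Γ) z (tildeGamma B A Γ x) : complementSpace B Γ) := rfl

theorem gammaPlus_hatGamma (hG : IsUnit (gammaPlus B Γ ∘L Γ)) (z : ℂ) (x : H) :
    gammaPlus B Γ (hatGamma B A Γ z x) = x := by
  rw [hatGamma_apply, map_sub, gammaPlus_gramInverse hG, gammaPlus_coe hG, sub_zero]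

theorem complementProj_hatGamma (hG : IsUnit (gammaPlus B Γ ∘L Γ)) (z : ℂ) (x : H) :
    complementProj B Γ (hatGamma B A Γ z x) = -res (tildeA B A Γ) z (tildeGamma B A Γ x) := by
  rw [hatGamma_apply, map_sub, complementProj_gamma hG, complementProj_coe hG, zero_sub]

/-- The Schur complement computation. The vector `y = (Ã - z)⁻¹ Γ̃ x` is chosen so that the
component of the left side in `(I - P)K` cancels; what remains lies in `ran Γ`. -/
theorem sub_apply_hatGamma (hB : IsHermitianForm B) (hA : IsFormSelfAdjoint B A)
    (hG : IsUnit (gammaPlus B Γ ∘L Γ)) (hz : z ∈ resolventSet ℂ (tildeA B A Γ)) (x : H) :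
    A (hatGamma B A Γ z x) - z • hatGamma B A Γ z x
      = -Γ (hatFun₁ B A Γ z x + hatFun₂ B A Γ z x) := by
  set y := res (tildeA B A Γ) z (tildeGamma B A Γ x) with hy
  have h1 : (tildeA B A Γ y : K) = tildeGamma B A Γ x + z • (y : K) := by
    rw [hy, apply_res hz]; rfl
  rw [coe_tildeA hG, tildeGamma_apply, coe_complementProj] at h1
  have h2 : A y = A (Γ (gramInverse B Γ x)) -
      Γ (gramInverse B Γ (gammaPlus B Γ (A (Γ (gramInverse B Γ x))))) + z • (y : K)
        + Γ (gramInverse B Γ (gammaPlus B Γ (A y))) := by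
    rw [← h1]; abel
  rw [hatFun₁_apply hG, hatFun₂_apply hB hA hG, hatGamma_apply, ← hy]
  simp only [map_sub, map_add, map_smul, smul_sub]
  nth_rw 1 [h2]
  abel

theorem hatGamma_eq (hB : IsHermitianForm B) (hA : IsFormSelfAdjoint B A)
    (hG : IsUnit (gammaPlus B Γ ∘L Γ)) (hz : z ∈ resolventSet ℂ A)
    (hz' : z ∈ resolventSet ℂ (tildeA B A Γ)) (x : H) :
    hatGamma B A Γ z x = -res A z (Γ (hatFun₁ B A Γ z x + hatFun₂ B A Γ z x)) := by
  rw [← map_neg]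
  exact eq_res_of_apply hz (sub_apply_hatGamma hB hA hG hz' x)

theorem resolventFun_hat (hB : IsHermitianForm B) (hA : IsFormSelfAdjoint B A)
    (hG : IsUnit (gammaPlus B Γ ∘L Γ)) (hz : z ∈ resolventSet ℂ A)
    (hz' : z ∈ resolventSet ℂ (tildeA B A Γ)) (x : H) :
    resolventFun B A Γ z (hatFun₁ B A Γ z x + hatFun₂ B A Γ z x) = -x := by
  have h1 := gammaPlus_hatGamma (A := A) hG z x
  rw [hatGamma_eq hB hA hG hz hz', map_neg] at h1
  rw [resolventFun_apply, ← neg_eq_iff_eq_neg]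
  exact h1

/-- If `(Ã - z) u = 0`, then `(A - z) u ∈ ran Γ`, so `u = (A - z)⁻¹ Γ a` with `Q(z) a = Γ⁺ u = 0`;
conversely, a kernel vector of `Q(z)` gives one of `Ã - z`. Thus the two injectivity statements
correspond, and surjectivity is obtained by explicit solutions. -/
theorem hatDomain_eq (h : IsPontryaginSpace B n) (hA : IsFormSelfAdjoint B A)
    (hG : IsUnit (gammaPlus B Γ ∘L Γ)) :
    hatDomain (resolventSet ℂ A) (resolventFun B A Γ)
      = resolventSet ℂ A ∩ resolventSet ℂ (tildeA B A Γ) := by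
  have hB := h.isHermitianForm
  have := h.complete
  have : CompleteSpace (complementSpace B Γ) := (isClosed_complementSpace hG).completeSpace_coe
  have htilde : ∀ (z : ℂ) (y : complementSpace B Γ),
      tildeA B A Γ y - z • y = complementProj B Γ (A y - z • (y : K)) := fun z y => by
    rw [tildeA_apply hG, map_sub, map_smul, complementProj_coe hG]
  have hproj : ∀ k, complementProj B Γ k = 0 → k = Γ (gramInverse B Γ (gammaPlus B Γ k)) := by
    intro k hk
    have := congrArg Subtype.val hk
    rw [coe_complementProj] at this
    exact sub_eq_zero.mp this
  ext z
  constructor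
  · rintro ⟨hz, hQ⟩
    refine ⟨hz, ?_⟩
    have hQbij := ContinuousLinearMap.isUnit_iff_bijective.mp hQ
    refine mem_resolventSet_of_bijective ⟨fun x y hxy => ?_, fun k => ?_⟩
    · rw [← sub_eq_zero]
      set u := x - y with hu
      have h1 : complementProj B Γ (A u - z • (u : K)) = 0 := by
        rw [← htilde, hu, map_sub, smul_sub, sub_sub_sub_comm, sub_eq_zero]
        exact hxy
      have h2 := eq_res_of_apply hz (hproj _ h1)
      have h3 := gammaPlus_coe hG u
      rw [h2, ← resolventFun_apply, map_eq_zero_iff _ hQbij.1] at h3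
      rw [h3, map_zero, map_zero] at h2
      exact Subtype.ext h2
    -- Subtracting `Γ a` from `k` is invisible to `I - P`; `a` is chosen so that the solution falls
    -- into `ker Γ⁺`.
    · obtain ⟨a, ha⟩ := hQbij.2 (gammaPlus B Γ (res A z k))
      have h1 : gammaPlus B Γ (res A z (k - Γ a)) = 0 := by
        rw [map_sub, map_sub, ← resolventFun_apply, ha, sub_self]
      refine ⟨⟨res A z (k - Γ a), (mem_complementSpace hG).mpr h1⟩, ?_⟩
      simp only
      rw [htilde]
      simp only [apply_res hz, add_sub_cancel_right]
      rw [map_sub, complementProj_gamma hG, complementProj_coe hG, sub_zero]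
  · rintro ⟨hz, hz'⟩
    refine ⟨hz, ContinuousLinearMap.isUnit_iff_bijective.mpr ⟨?_, fun x => ?_⟩⟩
    · rw [injective_iff_map_eq_zero]
      intro x hx
      rw [resolventFun_apply] at hx
      have h1 : tildeA B A Γ ⟨_, (mem_complementSpace hG).mpr hx⟩ -
          z • (⟨_, (mem_complementSpace hG).mpr hx⟩ : complementSpace B Γ) = 0 := by
        rw [htilde]
        simp only [apply_res hz, add_sub_cancel_right]
        exact complementProj_gamma hG x
      have h2 := eq_res_of_apply hz' h1
      rw [map_zero] at h2
      have h3 : res A z (Γ x) = 0 := congrArg Subtype.val h2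
      have h4 := apply_res hz (Γ x)
      rw [h3, map_zero, smul_zero, add_zero] at h4
      rw [← gramInverse_gammaPlus hG x, ← h4, map_zero, map_zero]
    · refine ⟨-(hatFun₁ B A Γ z x + hatFun₂ B A Γ z x), ?_⟩
      rw [map_neg, resolventFun_hat hB hA hG hz hz', neg_neg]

theorem hatFun_eq (h : IsPontryaginSpace B n) (hA : IsFormSelfAdjoint B A)
    (hG : IsUnit (gammaPlus B Γ ∘L Γ))
    (hz : z ∈ hatDomain (resolventSet ℂ A) (resolventFun B A Γ)) :
    hatFun (resolventFun B A Γ) z = hatFun₁ B A Γ z + hatFun₂ B A Γ z := by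
  have hz' := (hatDomain_eq h hA hG) ▸ hz
  have h1 : resolventFun B A Γ z * (hatFun₁ B A Γ z + hatFun₂ B A Γ z) = -1 := by
    ext1 x
    exact resolventFun_hat h.isHermitianForm hA hG hz'.1 hz'.2 x
  rw [hatFun, neg_eq_iff_eq_neg, ← mul_one (Ring.inverse _),
    Ring.inverse_mul_eq_iff_eq_mul _ _ _ hz.2, mul_neg, h1, neg_neg]

/-- As `Q(z)` is bijective on this domain, the defect field and `(A - z)⁻¹ Γ` have equal ranges at
each node. -/
theorem hatGamma_resolventFun (h : IsPontryaginSpace B n) (hA : IsFormSelfAdjoint B A)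
    (hG : IsUnit (gammaPlus B Γ ∘L Γ))
    (hz : z ∈ hatDomain (resolventSet ℂ A) (resolventFun B A Γ)) (x : H) :
    hatGamma B A Γ z (resolventFun B A Γ z x) = res A z (Γ x) := by
  have hz' := (hatDomain_eq h hA hG) ▸ hz
  have h1 : hatFun (resolventFun B A Γ) z (resolventFun B A Γ z x) = -x := by
    change -(Ring.inverse (resolventFun B A Γ z) * resolventFun B A Γ z) x = -x
    rw [Ring.inverse_mul_cancel _ hz.2]
    rfl
  rw [hatFun_eq h hA hG hz] at h1
  rw [hatGamma_eq h.isHermitianForm hA hG hz'.1 hz'.2]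
  rw [add_apply] at h1
  rw [h1, map_neg, map_neg, neg_neg]

/-- The Nevanlinna kernel of `-Q⁻¹` is the Gram kernel of the defect field. -/
theorem form_hatGamma (hB : IsHermitianForm B) (hG : IsUnit (gammaPlus B Γ ∘L Γ)) (x y : H) :
    B (hatGamma B A Γ w y) (hatGamma B A Γ z x) = ⟪y, gramInverse B Γ x⟫_ℂ +
      restrictForm B (complementSpace B Γ) (res (tildeA B A Γ) w (tildeGamma B A Γ y))
        (res (tildeA B A Γ) z (tildeGamma B A Γ x)) := by
  rw [hatGamma_apply, hatGamma_apply, restrictForm_apply, ← form_gramInverse hG]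
  simp only [map_sub, sub_apply, form_coe_gamma hG, form_gamma_coe hB hG]
  ring

/-- The constant term is symmetric and cancels; only the leading coefficient survives, so the kernel
is independent of the nodes. -/
theorem inner_nevanlinnaKernel_hatFun₁ (hB : IsHermitianForm B) (hA : IsFormSelfAdjoint B A)
    (hG : IsUnit (gammaPlus B Γ ∘L Γ)) (hzw : z - conj w ≠ 0) (x y : H) :
    ⟪y, nevanlinnaKernel (hatFun₁ B A Γ) z w x⟫_ℂ = ⟪y, gramInverse B Γ x⟫_ℂ := by
  have h1 : ⟪y, hatFun₁ B A Γ z x⟫_ℂ = z * ⟪y, gramInverse B Γ x⟫_ℂ -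
      B (Γ (gramInverse B Γ y)) (A (Γ (gramInverse B Γ x))) := by
    rw [hatFun₁_apply hG, inner_sub_right, inner_smul_right, ← inner_gramInverse hB hG y
      (gammaPlus B Γ _), ← inner_conj_symm _ (gammaPlus B Γ _), inner_gammaPlus, hB]
  have h2 : ⟪hatFun₁ B A Γ w y, x⟫_ℂ = conj w * ⟪y, gramInverse B Γ x⟫_ℂ -
      B (Γ (gramInverse B Γ y)) (A (Γ (gramInverse B Γ x))) := by
    rw [hatFun₁_apply hG, inner_sub_left, inner_smul_left, inner_gramInverse hB hG,
      inner_gramInverse hB hG, inner_gammaPlus, hA]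
  rw [nevanlinnaKernel, smul_apply, inner_smul_right, sub_apply, inner_sub_right,
    ContinuousLinearMap.adjoint_inner_right, h1, h2, sub_sub_sub_cancel_right, ← sub_mul,
    inv_mul_cancel_left₀ hzw]

theorem nevanlinnaKernel_congr {Q Q' : ℂ → H →L[ℂ] H} (hz : Q z = Q' z) (hw : Q w = Q' w) :
    nevanlinnaKernel Q z w = nevanlinnaKernel Q' z w := by
  rw [nevanlinnaKernel, nevanlinnaKernel, hz, hw]

theorem nevanlinnaKernel_add (Q Q' : ℂ → H →L[ℂ] H) :
    nevanlinnaKernel (fun z => Q z + Q' z) z w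
      = nevanlinnaKernel Q z w + nevanlinnaKernel Q' z w := by
  rw [nevanlinnaKernel, nevanlinnaKernel, nevanlinnaKernel, ← smul_add, map_add, add_sub_add_comm]

theorem inner_nevanlinnaKernel_hatFun (h : IsPontryaginSpace B n) (hA : IsFormSelfAdjoint B A)
    (hG : IsUnit (gammaPlus B Γ ∘L Γ))
    (hz : z ∈ hatDomain (resolventSet ℂ A) (resolventFun B A Γ))
    (hw : w ∈ hatDomain (resolventSet ℂ A) (resolventFun B A Γ)) (hzw : z - conj w ≠ 0) (x y : H) :
    ⟪y, nevanlinnaKernel (hatFun (resolventFun B A Γ)) z w x⟫_ℂ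
      = B (hatGamma B A Γ w y) (hatGamma B A Γ z x) := by
  have hz' := (hatDomain_eq h hA hG) ▸ hz
  have hw' := (hatDomain_eq h hA hG) ▸ hw
  have hB := h.isHermitianForm
  obtain ⟨m, hm⟩ := exists_isPontryaginSpace_complementSpace h hG
  rw [nevanlinnaKernel_congr (Q' := fun z => hatFun₁ B A Γ z + hatFun₂ B A Γ z)
    (hatFun_eq h hA hG hz) (hatFun_eq h hA hG hw), nevanlinnaKernel_add, add_apply, inner_add_right,
    inner_nevanlinnaKernel_hatFun₁ hB hA hG hzw, form_hatGamma hB hG]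
  congr 1
  exact inner_nevanlinnaKernel_resolventFun hm (isFormSelfAdjoint_tildeA hB hA hG) hz'.2 hw'.2 hzw
    x y

end Block

/-! ### Negative eigenvalues of a self-adjoint operator -/

section Spectral

variable {H : Type*} [NormedAddCommGroup H] [InnerProductSpace ℂ H] [CompleteSpace H]

/-- The form `⟪x, T y⟫`. -/
def operatorForm (T : H →L[ℂ] H) : H →L⋆[ℂ] H →L[ℂ] ℂ := (innerSL ℂ).bilinearComp (1 : H →L[ℂ] H) T

theorem operatorForm_apply (T : H →L[ℂ] H) (x y : H) : operatorForm T x y = ⟪x, T y⟫_ℂ := rfl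

/-- With `S` the positive square root of `N`, the form is `‖S x‖²`. -/
theorem apply_eq_zero_of_inner_eq_zero {N : H →L[ℂ] H} (hN : 0 ≤ N) {x : H}
    (hx : (⟪x, N x⟫_ℂ).re = 0) : N x = 0 := by
  obtain ⟨S, hS, rfl⟩ : ∃ S : H →L[ℂ] H, IsSelfAdjoint S ∧ S * S = N :=
    ⟨CFC.sqrt N, (CFC.sqrt_nonneg N).isSelfAdjoint, CFC.sqrt_mul_sqrt_self N hN⟩
  have h1 : ⟪x, (S * S) x⟫_ℂ = ⟪S x, S x⟫_ℂ := by
    rw [mul_apply_eq_comp, ← ContinuousLinearMap.adjoint_inner_left, hS.adjoint_eq]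
  rw [h1, inner_self_eq_norm_sq_to_K] at hx
  have h2 : S x = 0 := by
    have : ‖S x‖ ^ 2 = 0 := by exact_mod_cast hx
    simpa using this
  rw [mul_apply_eq_comp, h2, map_zero]

/-- A self-adjoint operator whose form has negative index `k` has exactly `k` negative eigenvalues,
counted with multiplicity. -/
theorem rank_negativeEigenspace {T : H →L[ℂ] H} (hT : IsSelfAdjoint T) {k : ℕ}
    (hk : HasNegativeIndex (operatorForm T) ⊤ k) :
    Module.rank ℂ (negativeEigenspace T) = k := by
  -- Positive and negative parts, `T = P - N` with `PN = NP = 0`. The form is negative definite on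
  -- `ran N` and nonnegative on `ker N`, so `ran N` has dimension exactly `k`; it remains to
  -- identify it with the span of the negative eigenvectors.
  obtain ⟨P, N, hP, hN, hTPN, hPN, hNP⟩ : ∃ P N : H →L[ℂ] H, 0 ≤ P ∧ 0 ≤ N ∧ T = P - N ∧
      P * N = 0 ∧ N * P = 0 :=
    ⟨T⁺, T⁻, CFC.posPart_nonneg T, CFC.negPart_nonneg T, (CFC.posPart_sub_negPart T hT).symm,
      CFC.posPart_mul_negPart T, CFC.negPart_mul_posPart T⟩
  have hPpos : ∀ x, 0 ≤ (⟪x, P x⟫_ℂ).re := fun x =>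
    ((ContinuousLinearMap.nonneg_iff_isPositive P).mp hP).re_inner_nonneg_right x
  have hNpos : ∀ x, 0 ≤ (⟪x, N x⟫_ℂ).re := fun x =>
    ((ContinuousLinearMap.nonneg_iff_isPositive N).mp hN).re_inner_nonneg_right x
  have hPNx : ∀ x, P (N x) = 0 := fun x => DFunLike.congr_fun hPN x
  have hNPx : ∀ x, N (P x) = 0 := fun x => DFunLike.congr_fun hNP x
  have hTx : ∀ x, T x = P x - N x := fun x => by rw [hTPN]; rfl
  have hNsymm : ∀ x y, ⟪N x, y⟫_ℂ = ⟪x, N y⟫_ℂ := fun x y => by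
    rw [← ContinuousLinearMap.adjoint_inner_left, hN.isSelfAdjoint.adjoint_eq]
  have hTsymm : ∀ x y, ⟪T x, y⟫_ℂ = ⟪x, T y⟫_ℂ := fun x y => by
    rw [← ContinuousLinearMap.adjoint_inner_left, hT.adjoint_eq]
  set R : Submodule ℂ H := LinearMap.range (N : H →ₗ[ℂ] H) with hR
  have hneg : ∀ x ∈ R, x ≠ 0 → (⟪x, T x⟫_ℂ).re < 0 := by
    rintro _ ⟨y, rfl⟩ hy
    rw [ContinuousLinearMap.coe_coe] at hy ⊢
    rw [hTx, hPNx, zero_sub, inner_neg_right, Complex.neg_re, neg_lt_zero]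
    refine lt_of_le_of_ne (hNpos _) fun h0 => hy ?_
    have h1 := apply_eq_zero_of_inner_eq_zero hN h0.symm
    have h2 : ⟪N y, N y⟫_ℂ = 0 := by rw [hNsymm, h1, inner_zero_right]
    exact inner_self_eq_zero.mp h2
  have hle : Module.rank ℂ R ≤ k := by
    refine rank_le fun s hs => ?_
    let e := s.equivFin.symm
    refine hk.le s.card (fun i => ((e i : R) : H)) (fun _ => trivial) fun c hc => ?_
    have h1 : ∑ i, c i • ((e i : R) : H) = ((∑ i, c i • (e i : R) : R) : H) := by simp
    rw [h1, operatorForm_apply]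
    refine hneg _ (Submodule.coe_mem _) fun h0 => hc ?_
    have h2 : LinearIndependent ℂ fun i => (e i : R) := hs.comp e e.injective
    exact funext (Fintype.linearIndependent_iff.mp h2 c (Subtype.ext h0))
  have hfin : FiniteDimensional ℂ R := by
    rw [FiniteDimensional, ← Module.rank_lt_aleph0_iff]
    exact hle.trans_lt Cardinal.natCast_lt_aleph0
  have hge : k ≤ Module.finrank ℂ R := by
    obtain ⟨w, hw, hw'⟩ := hk.exists_family
    refine hw'.le_finrank hw (N : H →ₗ[ℂ] H).rangeRestrict fun x _ hx => ?_
    have h1 : N x = 0 := congrArg Subtype.val hx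
    rw [operatorForm_apply, hTx, h1, sub_zero]
    exact hPpos x
  have hrank : Module.rank ℂ R = k := by
    refine le_antisymm hle ?_
    rw [← Module.finrank_eq_rank]
    exact_mod_cast hge
  suffices h : negativeEigenspace T = R by rw [h, hrank]
  refine le_antisymm (iSup_le fun μ x hx => ?_) ?_
  · rw [Module.End.mem_eigenspace_iff, ContinuousLinearMap.coe_coe] at hx
    -- Otherwise `P x` would be an eigenvector of `T` for `μ < 0`, while `T` acts on it as the
    -- nonnegative operator `P`.
    have h1 : P x = 0 := by
      by_contra hne
      have h2 : T (P x) = ((μ : ℝ) : ℂ) • P x := by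
        rw [← map_smul, ← hx, hTx, hTx, map_sub, hPNx, hNPx]
      have h3 := hPpos (P x)
      have h4 : T (P x) = P (P x) := by rw [hTx, hNPx, sub_zero]
      rw [← h4, h2, inner_smul_right, Complex.re_ofReal_mul, inner_self_eq_norm_sq_to_K] at h3
      have h5 : (0 : ℝ) < ‖P x‖ ^ 2 := by positivity
      have h6 : (((‖P x‖ : ℂ)) ^ 2).re = ‖P x‖ ^ 2 := by norm_cast
      have h7 : (μ : ℝ) * ‖P x‖ ^ 2 < 0 := mul_neg_of_neg_of_pos μ.2 h5
      erw [h6] at h3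
      linarith
    have hμ : ((μ : ℝ) : ℂ) ≠ 0 := by exact_mod_cast μ.2.ne
    refine ⟨-((μ : ℝ) : ℂ)⁻¹ • x, ?_⟩
    rw [hTx, h1, zero_sub] at hx
    rw [ContinuousLinearMap.coe_coe, map_smul, neg_smul, ← smul_neg, hx, smul_smul,
      inv_mul_cancel₀ hμ, one_smul]
  -- Conversely, `T` restricts to a symmetric operator on the finite-dimensional space `ran N`,
  -- which is spanned by eigenvectors; negativity of the form there forces their eigenvalues to be
  -- negative.
  · have hinv : ∀ x ∈ R, (T : H →ₗ[ℂ] H) x ∈ R := by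
      rintro _ ⟨y, rfl⟩
      rw [ContinuousLinearMap.coe_coe, ContinuousLinearMap.coe_coe, hTx, hPNx, zero_sub]
      exact R.neg_mem ⟨_, rfl⟩
    let TR : R →ₗ[ℂ] R := (T : H →ₗ[ℂ] H).restrict hinv
    have hsymm : TR.IsSymmetric := fun x y => hTsymm x y
    have htop : (⨆ μ, Module.End.eigenspace TR μ) = ⊤ :=
      Submodule.orthogonal_eq_bot_iff.mp hsymm.orthogonalComplement_iSup_eigenspaces_eq_bot
    have hmap : R = (⨆ μ, Module.End.eigenspace TR μ).map R.subtype := by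
      rw [htop, Submodule.map_top, Submodule.range_subtype]
    rw [hmap, Submodule.map_iSup]
    refine iSup_le fun μ => ?_
    rintro _ ⟨x, hx, rfl⟩
    rcases eq_or_ne x 0 with rfl | hx0
    · simp
    have h1 : T (x : H) = μ • (x : H) :=
      congrArg Subtype.val (Module.End.mem_eigenspace_iff.mp hx)
    have h2 := hneg x x.2 (by simpa using hx0)
    have h3 : 0 < ‖(x : H)‖ ^ 2 := by
      have : 0 < ‖(x : H)‖ := by simpa using hx0
      positivity
    have h4 : ⟪(x : H), T x⟫_ℂ = ((‖(x : H)‖ ^ 2 : ℝ) : ℂ) * μ := by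
      rw [h1, inner_smul_right, inner_self_eq_norm_sq_to_K, mul_comm]
      norm_cast
    have h5 : conj μ = μ := by
      have h6 : conj ⟪(x : H), T x⟫_ℂ = ⟪(x : H), T x⟫_ℂ := by
        rw [inner_conj_symm, hTsymm]
      rw [h4, map_mul, Complex.conj_ofReal] at h6
      exact mul_left_cancel₀ (by exact_mod_cast h3.ne') h6
    have h7 : μ.re < 0 := by
      rw [h4, Complex.re_ofReal_mul] at h2
      by_contra hcon
      push Not at hcon
      exact absurd h2 (not_lt.mpr (mul_nonneg h3.le hcon))
    refine Submodule.mem_iSup_of_mem (⟨μ.re, h7⟩ : {μ : ℝ // μ < 0}) ?_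
    rw [Module.End.mem_eigenspace_iff, Complex.conj_eq_iff_re.mp h5]
    exact h1

end Spectral

/-! ### Indices and minimality for the summands of the inverse function -/

section Inverse

variable {H : Type*} [NormedAddCommGroup H] [InnerProductSpace ℂ H] [CompleteSpace H]
variable {K : Type*} [NormedAddCommGroup K] [NormedSpace ℂ K] {B : K →L⋆[ℂ] K →L[ℂ] ℂ} {n : ℕ}
  {A : K →L[ℂ] K} {Γ : H →L[ℂ] K} {z w : ℂ} {κ κ₁ κ₂ : ℕ}

theorem hatFun₁_eq (hG : IsUnit (gammaPlus B Γ ∘L Γ)) (z : ℂ) :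
    hatFun₁ B A Γ z = hatFun₁ B A Γ 0 + z • gramInverse B Γ := by
  ext1 x
  rw [add_apply, hatFun₁_apply hG, hatFun₁_apply hG, smul_apply]
  module

theorem analyticAt_hatFun₁ (hG : IsUnit (gammaPlus B Γ ∘L Γ)) :
    AnalyticAt ℂ (hatFun₁ B A Γ) z := by
  rw [funext (hatFun₁_eq hG)]
  fun_prop

theorem adjoint_hatFun₁ (hB : IsHermitianForm B) (hA : IsFormSelfAdjoint B A)
    (hG : IsUnit (gammaPlus B Γ ∘L Γ)) :
    ContinuousLinearMap.adjoint (hatFun₁ B A Γ (conj z)) = hatFun₁ B A Γ z := by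
  ext1 x
  refine ext_inner_right ℂ fun y => ?_
  rw [ContinuousLinearMap.adjoint_inner_left, hatFun₁_apply hG, hatFun₁_apply hG, inner_sub_right,
    inner_sub_left, inner_smul_left, inner_smul_right, inner_gramInverse hB hG,
    inner_gramInverse hB hG, inner_gammaPlus, ← inner_gramInverse hB hG _ (gammaPlus B Γ _),
    ← inner_conj_symm _ (gammaPlus B Γ _), inner_gammaPlus, hB, hA]

theorem upperSpan_univ_gram (hG : IsUnit (gammaPlus B Γ ∘L Γ)) :
    upperSpan Set.univ (fun _ => Γ ∘L gramInverse B Γ) = LinearMap.range (Γ : H →ₗ[ℂ] K) := by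
  refine le_antisymm (Submodule.span_le.mpr ?_) ?_
  · rintro _ ⟨z, -, -, x, rfl⟩
    exact ⟨_, rfl⟩
  · rintro _ ⟨x, rfl⟩
    refine Submodule.subset_span ⟨Complex.I, trivial, by simp, gammaPlus B Γ (Γ x), ?_⟩
    rw [ContinuousLinearMap.comp_apply, gramInverse_gammaPlus hG, ContinuousLinearMap.coe_coe]

theorem isGeneralizedNevanlinna_hatFun₁ (hB : IsHermitianForm B) (hA : IsFormSelfAdjoint B A)
    (hG : IsUnit (gammaPlus B Γ ∘L Γ))
    (hκ : HasNegativeIndex B (LinearMap.range (Γ : H →ₗ[ℂ] K)) κ₁) :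
    IsGeneralizedNevanlinna Set.univ (hatFun₁ B A Γ) κ₁ := by
  rw [← upperSpan_univ_gram hG] at hκ
  have hiff := (hasNegativeIndex_upperSpan_iff hB (Q := hatFun₁ B A Γ)
    (v := fun _ => Γ ∘L gramInverse B Γ) (κ := κ₁) (D := Set.univ) fun _ _ _ _ hz' hw' x y => by
      rw [inner_nevanlinnaKernel_hatFun₁ hB hA hG (sub_conj_ne_zero hz' hw')]
      exact (form_gramInverse hG y x).symm).mp hκ
  exact ⟨fun z _ => (analyticAt_hatFun₁ hG).meromorphicAt, Filter.univ_mem,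
    fun z _ => analyticAt_hatFun₁ hG, fun z _ => ⟨trivial, adjoint_hatFun₁ hB hA hG⟩, hiff.1, hiff.2⟩

/-- `Γ (Γ⁺Γ)⁻¹` maps `H` onto `ran Γ` and carries the form of `(Γ⁺Γ)⁻¹` to `B`, so the two negative
indices agree. -/
theorem rank_negativeEigenspace_gramInverse (hB : IsHermitianForm B)
    (hG : IsUnit (gammaPlus B Γ ∘L Γ))
    (hκ : HasNegativeIndex B (LinearMap.range (Γ : H →ₗ[ℂ] K)) κ₁) :
    Module.rank ℂ (negativeEigenspace (gramInverse B Γ)) = κ₁ := by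
  have hT : IsSelfAdjoint (gramInverse B Γ) := by
    rw [ContinuousLinearMap.isSelfAdjoint_iff_isSymmetric]
    exact fun x y => inner_gramInverse hB hG x y
  refine rank_negativeEigenspace hT ?_
  rw [← hasNegativeIndex_map_iff (b := operatorForm (gramInverse B Γ)) (b' := B)
    ((Γ ∘L gramInverse B Γ : H →L[ℂ] K) : H →ₗ[ℂ] K) fun x => form_gramInverse hG x x]
  convert hκ using 1
  ext y
  constructor
  · rintro ⟨x, -, rfl⟩
    exact ⟨_, rfl⟩
  · rintro ⟨x, rfl⟩
    exact ⟨gammaPlus B Γ (Γ x), trivial, by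
      rw [ContinuousLinearMap.coe_coe, ContinuousLinearMap.comp_apply, gramInverse_gammaPlus hG,
        ContinuousLinearMap.coe_coe]⟩

theorem eventually_mem_hatDomain (h : IsPontryaginSpace B n) (hA : IsFormSelfAdjoint B A)
    (hG : IsUnit (gammaPlus B Γ ∘L Γ)) (hz : z.im ≠ 0) :
    ∀ᶠ w in 𝓝[≠] z, w ∈ hatDomain (resolventSet ℂ A) (resolventFun B A Γ) := by
  obtain ⟨m, hm⟩ := exists_isPontryaginSpace_complementSpace h hG
  rw [hatDomain_eq h hA hG]
  exact (eventually_mem_resolventSet_nhdsNE h hA hz).and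
    (eventually_mem_resolventSet_nhdsNE hm (isFormSelfAdjoint_tildeA h.isHermitianForm hA hG) hz)

theorem frequently_mem_hatDomain (h : IsPontryaginSpace B n) (hA : IsFormSelfAdjoint B A)
    (hG : IsUnit (gammaPlus B Γ ∘L Γ)) :
    ∃ᶠ w in 𝓝[≠] Complex.I,
      w ∈ hatDomain (resolventSet ℂ A) (resolventFun B A Γ) ∩ {z | 0 < z.im} := by
  have h1 : ∀ᶠ w : ℂ in 𝓝[≠] Complex.I, 0 < w.im :=
    nhdsWithin_le_nhds (Complex.continuous_im.continuousAt.eventually_const_lt (by simp))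
  exact ((eventually_mem_hatDomain h hA hG (by simp)).and h1).frequently

theorem isGeneralizedNevanlinna_hatFun (h : IsPontryaginSpace B n) (hA : IsFormSelfAdjoint B A)
    (hG : IsUnit (gammaPlus B Γ ∘L Γ))
    (hκ : HasNegativeIndex B (upperSpan (hatDomain (resolventSet ℂ A) (resolventFun B A Γ))
      (hatGamma B A Γ)) κ) :
    IsGeneralizedNevanlinna (hatDomain (resolventSet ℂ A) (resolventFun B A Γ))
      (hatFun (resolventFun B A Γ)) κ := by
  have hB := h.isHermitianForm
  have := h.complete
  have : CompleteSpace (complementSpace B Γ) := (isClosed_complementSpace hG).completeSpace_coe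
  obtain ⟨m, hm⟩ := exists_isPontryaginSpace_complementSpace h hG
  have hA' := isFormSelfAdjoint_tildeA hB hA hG
  have hiff := (hasNegativeIndex_upperSpan_iff hB fun _ hz _ hw hz' hw' x y =>
      inner_nevanlinnaKernel_hatFun h hA hG hz hw (sub_conj_ne_zero hz' hw') x y).mp hκ
  refine ⟨fun z hz => ?_, ?_, fun z hz => ?_, fun z hz => ?_, hiff.1, hiff.2⟩
  · have h1 : MeromorphicAt (fun z => hatFun₁ B A Γ z + hatFun₂ B A Γ z) z :=
      (analyticAt_hatFun₁ hG).meromorphicAt.add (meromorphicAt_resolventFun hm hA' hz)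
    refine h1.congr ?_
    filter_upwards [eventually_mem_hatDomain h hA hG hz] with w hw
    exact (hatFun_eq h hA hG hw).symm
  · rw [mem_codiscreteWithin_iff_forall_mem_nhdsNE]
    intro z hz
    filter_upwards [eventually_mem_hatDomain h hA hG hz] with w hw using Or.inl hw
  · have hz' := (hatDomain_eq h hA hG) ▸ hz.1
    have h1 : AnalyticAt ℂ (fun z => hatFun₁ B A Γ z + hatFun₂ B A Γ z) z :=
      (analyticAt_hatFun₁ hG).add (analyticAt_resolventFun hz'.2)
    refine h1.congr ?_
    have h2 : ∀ᶠ w in 𝓝 z, w ∈ hatDomain (resolventSet ℂ A) (resolventFun B A Γ) := by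
      rw [hatDomain_eq h hA hG]
      exact Filter.inter_mem (resolventSet_mem_nhds hz'.1) (resolventSet_mem_nhds hz'.2)
    filter_upwards [h2] with w hw
    exact (hatFun_eq h hA hG hw).symm
  · have hz' := (hatDomain_eq h hA hG) ▸ hz
    have hc : conj z ∈ hatDomain (resolventSet ℂ A) (resolventFun B A Γ) := by
      rw [hatDomain_eq h hA hG]
      exact ⟨conj_mem_resolventSet h hA hz'.1, conj_mem_resolventSet hm hA' hz'.2⟩
    refine ⟨hc, ?_⟩
    rw [hatFun_eq h hA hG hc, hatFun_eq h hA hG hz, map_add, adjoint_hatFun₁ hB hA hG]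
    congr 1
    exact adjoint_resolventFun hm hA' hz'.2

/-- The vectors `(A - z)⁻¹ Γ h` and the defect vectors of the inverse function span the same
subspace. -/
theorem upperSpan_hatGamma (h : IsPontryaginSpace B n) (hA : IsFormSelfAdjoint B A)
    (hG : IsUnit (gammaPlus B Γ ∘L Γ)) :
    upperSpan (hatDomain (resolventSet ℂ A) (resolventFun B A Γ)) (hatGamma B A Γ) =
      upperSpan (hatDomain (resolventSet ℂ A) (resolventFun B A Γ)) fun z => res A z ∘L Γ := by
  rw [upperSpan, upperSpan]
  congr 1
  ext y
  constructor
  · rintro ⟨z, hz, hz', x, rfl⟩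
    obtain ⟨a, rfl⟩ := (ContinuousLinearMap.isUnit_iff_bijective.mp hz.2).2 x
    exact ⟨z, hz, hz', a, hatGamma_resolventFun h hA hG hz a⟩
  · rintro ⟨z, hz, hz', x, rfl⟩
    exact ⟨z, hz, hz', _, (hatGamma_resolventFun h hA hG hz x).symm⟩

/-- The inverse function has a smaller domain than `ρ(A)`, but the lost nodes do not shrink the
closed span. Hence the inverse function inherits the index of `Q`. -/
theorem closure_upperSpan_hatGamma (h : IsPontryaginSpace B n) (hA : IsFormSelfAdjoint B A)
    (hG : IsUnit (gammaPlus B Γ ∘L Γ)) :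
    (upperSpan (hatDomain (resolventSet ℂ A) (resolventFun B A Γ))
      (hatGamma B A Γ)).topologicalClosure = cyclicSpan A Γ (resolventSet ℂ A) := by
  rw [upperSpan_hatGamma h hA hG, upperSpan_closure_eq_cyclicSpan]
  exact cyclicSpan_eq h hA (fun z hz => hz.1.1) (by simp) (frequently_mem_hatDomain h hA hG)

theorem closure_upperSpan_res (h : IsPontryaginSpace B n) (hA : IsFormSelfAdjoint B A) :
    (upperSpan (resolventSet ℂ A) fun z => res A z ∘L Γ).topologicalClosure
      = cyclicSpan A Γ (resolventSet ℂ A) := by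
  rw [upperSpan_closure_eq_cyclicSpan]
  refine cyclicSpan_eq h hA (fun z hz => hz.1) (z := Complex.I) (by simp) ?_
  have h1 : ∀ᶠ w : ℂ in 𝓝[≠] Complex.I, 0 < w.im :=
    nhdsWithin_le_nhds (Complex.continuous_im.continuousAt.eventually_const_lt (by simp))
  exact ((eventually_mem_resolventSet_nhdsNE h hA (by simp)).and h1).frequently

theorem hasNegativeIndex_hatGamma (h : IsPontryaginSpace B n) (hA : IsFormSelfAdjoint B A)
    (hG : IsUnit (gammaPlus B Γ ∘L Γ))
    (hκ : HasNegativeIndex B (upperSpan (resolventSet ℂ A) fun z => res A z ∘L Γ) κ) :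
    HasNegativeIndex B (upperSpan (hatDomain (resolventSet ℂ A) (resolventFun B A Γ))
      (hatGamma B A Γ)) κ :=
  hκ.of_closure_eq ((closure_upperSpan_res h hA).trans (closure_upperSpan_hatGamma h hA hG).symm)

theorem orthogonal_range_complementSpace (hB : IsHermitianForm B)
    (hG : IsUnit (gammaPlus B Γ ∘L Γ)) {x y : K} (hx : x ∈ LinearMap.range (Γ : H →ₗ[ℂ] K))
    (hy : y ∈ complementSpace B Γ) : B x y = 0 := by
  obtain ⟨a, rfl⟩ := hx
  exact form_gamma_coe hB hG ⟨y, hy⟩ a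

theorem index_complementSpace (h : IsPontryaginSpace B n) (hG : IsUnit (gammaPlus B Γ ∘L Γ))
    (hκ : HasNegativeIndex B (LinearMap.range (Γ : H →ₗ[ℂ] K)) κ₁) {m : ℕ}
    (hm : IsPontryaginSpace (restrictForm B (complementSpace B Γ)) m) : κ₁ + m = n := by
  have h1 := hκ.sup h.isHermitianForm ((hasNegativeIndex_restrictForm_top _).mp hm.hasNegativeIndex)
    fun x hx y hy => orthogonal_range_complementSpace h.isHermitianForm hG hx hy
  refine h1.unique ?_
  convert h.hasNegativeIndex
  rw [eq_top_iff]
  intro k _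
  have h2 : k = Γ (gramInverse B Γ (gammaPlus B Γ k)) + (complementProj B Γ k : K) := by
    rw [coe_complementProj, add_sub_cancel]
  rw [h2]
  exact Submodule.add_mem_sup ⟨_, rfl⟩ (Submodule.coe_mem _)

theorem cyclicSpan_tilde_eq (h : IsPontryaginSpace B n) (hA : IsFormSelfAdjoint B A)
    (hG : IsUnit (gammaPlus B Γ ∘L Γ)) :
    cyclicSpan (tildeA B A Γ) (tildeGamma B A Γ)
        (hatDomain (resolventSet ℂ A) (resolventFun B A Γ) ∩ {z | 0 < z.im})
      = cyclicSpan (tildeA B A Γ) (tildeGamma B A Γ) (resolventSet ℂ (tildeA B A Γ)) := by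
  obtain ⟨m, hm⟩ := exists_isPontryaginSpace_complementSpace h hG
  refine cyclicSpan_eq hm (isFormSelfAdjoint_tildeA h.isHermitianForm hA hG) (fun z hz => ?_)
    (by simp) (frequently_mem_hatDomain h hA hG)
  have := hz.1
  rw [hatDomain_eq h hA hG] at this
  exact this.2

/-- The orthogonal sum of `ran Γ` and the span of the vectors `(Ã - z)⁻¹ Γ̃ x` lies between the span
of the defect vectors and its closure, so it has index `κ`. -/
theorem index_add_index (h : IsPontryaginSpace B n) (hA : IsFormSelfAdjoint B A)
    (hG : IsUnit (gammaPlus B Γ ∘L Γ))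
    (hκ : HasNegativeIndex B (upperSpan (resolventSet ℂ A) fun z => res A z ∘L Γ) κ)
    (hκ₁ : HasNegativeIndex B (LinearMap.range (Γ : H →ₗ[ℂ] K)) κ₁)
    (hκ₂ : HasNegativeIndex (restrictForm B (complementSpace B Γ))
      (upperSpan (resolventSet ℂ (tildeA B A Γ))
        fun z => res (tildeA B A Γ) z ∘L tildeGamma B A Γ) κ₂) :
    κ₁ + κ₂ = κ := by
  have hB := h.isHermitianForm
  obtain ⟨m, hm⟩ := exists_isPontryaginSpace_complementSpace h hG
  have hA' := isFormSelfAdjoint_tildeA hB hA hG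
  set D := hatDomain (resolventSet ℂ A) (resolventFun B A Γ) with hD
  set N := upperSpan D fun z => res (tildeA B A Γ) z ∘L tildeGamma B A Γ with hN
  have h1 : HasNegativeIndex B (N.map (complementSpace B Γ).subtype) κ₂ := by
    rw [hasNegativeIndex_map_iff (b := restrictForm B (complementSpace B Γ))
      (complementSpace B Γ).subtype fun x => rfl]
    refine hκ₂.of_closure_eq ?_
    rw [closure_upperSpan_res hm hA', hN, upperSpan_closure_eq_cyclicSpan, hD,
      cyclicSpan_tilde_eq h hA hG]
  have h2 := hκ₁.sup hB h1 fun x hx y hy => by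
    obtain ⟨y, -, rfl⟩ := hy
    exact orthogonal_range_complementSpace hB hG hx y.2
  refine h2.unique ((hasNegativeIndex_hatGamma h hA hG hκ).of_le_closure ?_ ?_)
  · refine Submodule.span_le.mpr ?_
    rintro _ ⟨z, hz, hz', x, rfl⟩
    rw [hatGamma_apply, sub_eq_add_neg]
    exact Submodule.add_mem_sup ⟨_, rfl⟩ (Submodule.neg_mem _
      ⟨_, Submodule.subset_span ⟨z, hz, hz', x, rfl⟩, rfl⟩)
  -- Once `ran Γ` is in the closure, subtracting a defect vector from `Γ (Γ⁺Γ)⁻¹ x` isolates `(Ã -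
  -- z)⁻¹ Γ̃ x`.
  · have hΓ : LinearMap.range (Γ : H →ₗ[ℂ] K) ≤ (upperSpan D (hatGamma B A Γ)).topologicalClosure := by
      rw [closure_upperSpan_hatGamma h hA hG]
      rintro _ ⟨x, rfl⟩
      exact (cyclicSpan_aux h hA subset_rfl (z := Complex.I) (by simp)
        (eventually_mem_resolventSet_nhdsNE h hA (by simp)).frequently).1 x
    refine sup_le hΓ ?_
    rw [Submodule.map_le_iff_le_comap]
    refine Submodule.span_le.mpr ?_
    rintro _ ⟨z, hz, hz', x, rfl⟩
    change ((res (tildeA B A Γ) z (tildeGamma B A Γ x) : complementSpace B Γ) : K) ∈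
      (upperSpan D (hatGamma B A Γ)).topologicalClosure
    have h3 : ((res (tildeA B A Γ) z (tildeGamma B A Γ x) : complementSpace B Γ) : K)
        = Γ (gramInverse B Γ x) - hatGamma B A Γ z x := by
      rw [hatGamma_apply, sub_sub_cancel]
    rw [h3]
    exact Submodule.sub_mem _ (hΓ ⟨_, rfl⟩)
      (Submodule.le_topologicalClosure _ (Submodule.subset_span ⟨z, hz, hz', x, rfl⟩))

/-- The continuous surjection `I - P` sends the total family of defect vectors to the vectors `-(Ã -
z)⁻¹ Γ̃ x`, which are therefore total. -/
theorem isMinimalOperator_tilde (h : IsPontryaginSpace B n) (hA : IsFormSelfAdjoint B A)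
    (hG : IsUnit (gammaPlus B Γ ∘L Γ)) (hmin : IsMinimalOperator A Γ) :
    IsMinimalOperator (tildeA B A Γ) (tildeGamma B A Γ) := by
  rw [isMinimalOperator_iff_cyclicSpan] at hmin ⊢
  rw [← closure_upperSpan_hatGamma h hA hG] at hmin
  have h1 : (upperSpan (hatDomain (resolventSet ℂ A) (resolventFun B A Γ))
      (hatGamma B A Γ)).topologicalClosure ≤
      (cyclicSpan (tildeA B A Γ) (tildeGamma B A Γ) (resolventSet ℂ (tildeA B A Γ))).comap
        (complementProj B Γ : K →ₗ[ℂ] complementSpace B Γ) := by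
    refine Submodule.topologicalClosure_minimal _ (Submodule.span_le.mpr ?_)
      ((isClosed_cyclicSpan _).preimage (complementProj B Γ).continuous)
    rintro _ ⟨z, hz, -, x, rfl⟩
    change complementProj B Γ (hatGamma B A Γ z x) ∈
      cyclicSpan (tildeA B A Γ) (tildeGamma B A Γ) (resolventSet ℂ (tildeA B A Γ))
    rw [complementProj_hatGamma hG]
    rw [hatDomain_eq h hA hG] at hz
    exact Submodule.neg_mem _ (res_mem_cyclicSpan_of_mem hz.2 x)
  rw [hmin] at h1
  rw [eq_top_iff]
  intro y _
  have h2 : complementProj B Γ (y : K) ∈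
      cyclicSpan (tildeA B A Γ) (tildeGamma B A Γ) (resolventSet ℂ (tildeA B A Γ)) :=
    h1 (Submodule.mem_top (x := (y : K)))
  rwa [complementProj_coe hG] at h2

theorem index_of_isMinimalOperator (h : IsPontryaginSpace B n) (hA : IsFormSelfAdjoint B A)
    (hmin : IsMinimalOperator A Γ)
    (hκ : HasNegativeIndex B (upperSpan (resolventSet ℂ A) fun z => res A z ∘L Γ) κ) : κ = n := by
  refine (hκ.of_closure_eq ?_).unique h.hasNegativeIndex
  rw [closure_upperSpan_res h hA, isMinimalOperator_iff_cyclicSpan.mp hmin]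
  exact (eq_top_iff.mpr (Submodule.le_topologicalClosure ⊤)).symm

end Inverse

/-! ### Linear relations and their `Γ`-fields -/

section Relation

variable {K : Type*} [NormedAddCommGroup K] [NormedSpace ℂ K] {B : K →L⋆[ℂ] K →L[ℂ] ℂ}
  {S : Submodule ℂ (K × K)} {z w : ℂ}

theorem isRelationResolvent_relationResolvent (hz : z ∈ relationResolventSet S) :
    IsRelationResolvent S z (relationResolvent S z) := by
  have h : ∃ R : K →L[ℂ] K, IsRelationResolvent S z R := hz
  rw [relationResolvent, dif_pos h]
  exact h.choose_spec

theorem relationResolvent_mem (hz : z ∈ relationResolventSet S) (k : K) :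
    (relationResolvent S z k, k + z • relationResolvent S z k) ∈ S :=
  (isRelationResolvent_relationResolvent hz _ _).mpr rfl

theorem eq_relationResolvent (hz : z ∈ relationResolventSet S) {k x : K}
    (h : (x, k + z • x) ∈ S) : x = relationResolvent S z k :=
  (isRelationResolvent_relationResolvent hz _ _).mp h

theorem IsRelationResolvent.eq {R : K →L[ℂ] K} (h : IsRelationResolvent S z R) :
    relationResolvent S z = R := by
  ext1 k
  exact (h _ _).mp (relationResolvent_mem ⟨R, h⟩ k)

theorem relationResolvent_sub (hz : z ∈ relationResolventSet S) (hw : w ∈ relationResolventSet S)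
    (k : K) : relationResolvent S z k - relationResolvent S w k
      = (z - w) • relationResolvent S w (relationResolvent S z k) := by
  have h1 := relationResolvent_mem hz k
  have h2 : k + z • relationResolvent S z k
      = (k + (z - w) • relationResolvent S z k) + w • relationResolvent S z k := by module
  rw [h2] at h1
  conv_lhs => rw [eq_relationResolvent hw h1]
  rw [map_add, map_smul, add_sub_cancel_left]

theorem eigenvector_eq_relationResolvent (hz : z ∈ relationResolventSet S) {β : ℂ} {x : K}
    (hx : (x, β • x) ∈ S) : x = (β - z) • relationResolvent S z x := by
  rw [← map_smul]
  refine eq_relationResolvent hz ?_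
  rwa [← add_smul, sub_add_cancel]

theorem form_relationResolvent (hS : IsSelfAdjointRelation B S) (hz : z ∈ relationResolventSet S)
    (hw : w ∈ relationResolventSet S) (k l : K) :
    (z - conj w) * B (relationResolvent S w l) (relationResolvent S z k)
      = B l (relationResolvent S z k) - B (relationResolvent S w l) k := by
  have h1 := (hS _).mp (relationResolvent_mem hz k) _ (relationResolvent_mem hw l)
  simp only [map_add, map_smul, map_smulₛₗ, add_apply, smul_apply, smul_eq_mul] at h1
  linear_combination h1

/-- The Neumann series construction: near `z` the resolvent at `w` is `(1 - (w - z) R(z))⁻¹ R(z)`.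
It gives openness of the resolvent set and continuity of the resolvent. -/
theorem eventually_isRelationResolvent [CompleteSpace K] (hz : z ∈ relationResolventSet S) :
    ∀ᶠ w in 𝓝 z, IsRelationResolvent S w
      (Ring.inverse (1 - (w - z) • relationResolvent S z) * relationResolvent S z) := by
  have h1 : ContinuousAt (fun w : ℂ => (1 : K →L[ℂ] K) - (w - z) • relationResolvent S z) z := by
    fun_prop
  have h2 : ∀ᶠ w in 𝓝 z, IsUnit ((1 : K →L[ℂ] K) - (w - z) • relationResolvent S z) :=
    h1.eventually_mem (Units.isOpen.mem_nhds (by simp))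
  filter_upwards [h2] with w hw k x
  have h3 : (x, k + w • x) = (x, (k + (w - z) • x) + z • x) := by
    congr 1; module
  rw [h3, isRelationResolvent_relationResolvent hz, map_add, map_smul, ← sub_eq_iff_eq_add]
  have h4 : x - (w - z) • relationResolvent S z x
      = ((1 : K →L[ℂ] K) - (w - z) • relationResolvent S z) x := by simp
  rw [h4]
  constructor
  · intro h5
    rw [mul_apply_eq_comp, ← h5, ← mul_apply_eq_comp, Ring.inverse_mul_cancel _ hw]
    rfl
  · intro h5
    rw [h5, ← mul_apply_eq_comp, ← mul_assoc, Ring.mul_inverse_cancel _ hw, one_mul]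

theorem relationResolventSet_mem_nhds [CompleteSpace K] (hz : z ∈ relationResolventSet S) :
    relationResolventSet S ∈ 𝓝 z :=
  (eventually_isRelationResolvent hz).mono fun _ h => ⟨_, h⟩

theorem continuousAt_relationResolvent [CompleteSpace K] (hz : z ∈ relationResolventSet S) :
    ContinuousAt (relationResolvent S) z := by
  have h1 : ContinuousAt (fun w : ℂ => (1 : K →L[ℂ] K) - (w - z) • relationResolvent S z) z := by
    fun_prop
  have h2 : ContinuousAt Ring.inverse ((1 : K →L[ℂ] K) - (z - z) • relationResolvent S z) := by
    rw [sub_self, zero_smul, sub_zero]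
    exact NormedRing.inverse_continuousAt (1 : (K →L[ℂ] K)ˣ)
  have h3 : ContinuousAt (fun w : ℂ => Ring.inverse ((1 : K →L[ℂ] K) -
      (w - z) • relationResolvent S z) * relationResolvent S z) z :=
    (h2.comp (f := fun w : ℂ => (1 : K →L[ℂ] K) - (w - z) • relationResolvent S z) h1).mul
      continuousAt_const
  refine h3.congr ?_
  filter_upwards [eventually_isRelationResolvent hz] with w hw using hw.eq.symm

variable {H : Type*} [NormedAddCommGroup H] [InnerProductSpace ℂ H]

/-- The `Γ`-field `(I + (z - z₀)(S - z)⁻¹) Γ` of a linear relation. -/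
def gammaField (S : Submodule ℂ (K × K)) (Γ : H →L[ℂ] K) (z₀ z : ℂ) : H →L[ℂ] K :=
  (1 + (z - z₀) • relationResolvent S z) ∘L Γ

variable {Γ : H →L[ℂ] K} {z₀ : ℂ}

theorem gammaField_apply (x : H) :
    gammaField S Γ z₀ z x = Γ x + (z - z₀) • relationResolvent S z (Γ x) := by
  simp [gammaField]

theorem gammaField_self (x : H) : gammaField S Γ z₀ z₀ x = Γ x := by
  rw [gammaField_apply, sub_self, zero_smul, add_zero]

theorem isMinimalRelation_iff : IsMinimalRelation S Γ z₀ ↔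
    (Submodule.span ℂ {k : K | ∃ z ∈ relationResolventSet S, ∃ h : H,
      k = gammaField S Γ z₀ z h}).topologicalClosure = ⊤ := Iff.rfl

/-- The resolvent acts on the `Γ`-field by difference quotients. In a minimal representation the
field therefore determines the resolvent, which is what makes intertwining possible. -/
theorem relationResolvent_gammaField (hz : z ∈ relationResolventSet S)
    (hw : w ∈ relationResolventSet S) (x : H) :
    (z - w) • relationResolvent S w (gammaField S Γ z₀ z x)
      = gammaField S Γ z₀ z x - gammaField S Γ z₀ w x := by
  have h1 := relationResolvent_sub hz hw (Γ x)
  rw [gammaField_apply, gammaField_apply, map_add, map_smul, smul_add, smul_comm (z - w), ← h1]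
  module

theorem continuousAt_gammaField [CompleteSpace K] (hz : z ∈ relationResolventSet S) (x : H) :
    ContinuousAt (fun z => gammaField S Γ z₀ z x) z := by
  have h1 := continuousAt_relationResolvent hz
  have h2 : ContinuousAt (fun z => relationResolvent S z (Γ x)) z :=
    ((ContinuousLinearMap.apply ℂ K (Γ x)).continuous.continuousAt).comp h1
  simp only [gammaField_apply]
  fun_prop

variable [CompleteSpace H] {D : Set ℂ} {Q : ℂ → H →L[ℂ] H}

/-- The Nevanlinna kernel is the Gram kernel of the `Γ`-field. -/
theorem IsRelationRepresentation.inner_nevanlinnaKernel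
    (h : IsRelationRepresentation D Q B S Γ z₀) (hz : z ∈ D ∩ relationResolventSet S)
    (hw : w ∈ D ∩ relationResolventSet S) (hzw : z - conj w ≠ 0) (x y : H) :
    ⟪y, nevanlinnaKernel Q z w x⟫_ℂ = B (gammaField S Γ z₀ w y) (gammaField S Γ z₀ z x) := by
  obtain ⟨κ, hB⟩ := h.pontryagin
  have hB := hB.isHermitianForm
  have hpair : ∀ k a, ⟪a, gammaPlus B Γ k⟫_ℂ = B (Γ a) k := fun k a => by
    rw [← inner_conj_symm, inner_gammaPlus, hB]
  have hform : ∀ v ∈ D ∩ relationResolventSet S, ∀ a b, ⟪a, Q v b⟫_ℂ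
      = ⟪a, ContinuousLinearMap.adjoint (Q z₀) b⟫_ℂ
        + (v - conj z₀) * B (Γ a) (gammaField S Γ z₀ v b) := fun v hv a b => by
    rw [h.formula v hv, add_apply, inner_add_right, smul_apply, inner_smul_right]
    exact congrArg (fun t => _ + _ * t) (hpair _ _)
  have h0 := hform z₀ ⟨h.reference_mem.1, h.reference_mem.2.1⟩ y x
  have h1 := hform z hz y x
  have h2 := congrArg conj (hform w hw x y)
  rw [inner_conj_symm, map_add, inner_conj_symm, map_mul, hB] at h2
  rw [ContinuousLinearMap.adjoint_inner_left] at h2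
  have h3 := form_relationResolvent h.selfAdjoint hz.2 hw.2 (Γ x) (Γ y)
  rw [nevanlinnaKernel, smul_apply, inner_smul_right, sub_apply, inner_sub_right,
    ContinuousLinearMap.adjoint_inner_right, inv_mul_eq_iff_eq_mul₀ hzw, h1, h2, h0]
  simp only [gammaField_apply, map_add, map_smul, map_smulₛₗ, add_apply, smul_apply, smul_eq_mul,
    sub_self, zero_mul, add_zero, map_sub, Complex.conj_conj]
  linear_combination -((z - z₀) * (conj w - conj z₀)) * h3

theorem eventually_ne_nhdsNE (z a : ℂ) : ∀ᶠ w in 𝓝[≠] z, w ≠ a := by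
  by_cases h : z = a
  · exact h ▸ self_mem_nhdsWithin
  · exact nhdsWithin_le_nhds (isOpen_ne.mem_nhds h)

/-- A function with constant Nevanlinna kernel has no generalized poles. -/
theorem not_isGeneralizedPole_of_nevanlinnaKernel_eq {T : H →L[ℂ] H}
    (hT : ∀ z w, z - conj w ≠ 0 → nevanlinnaKernel Q z w = T) (β : ℂ) :
    ¬ IsGeneralizedPole.{_, v} Set.univ Q β := by
  rintro ⟨K, _, _, B, S, Γ, z₀, hrep, hmin, x, hx0, hx⟩
  obtain ⟨κ, hK⟩ := hrep.pontryagin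
  have := hK.complete
  have hz₀ := hrep.reference_mem.2.1
  -- A constant kernel makes the difference of two field vectors orthogonal to the total family,
  -- hence zero. Nodes `v` conjugate to `z` or `z₀`, where the kernel is not available, are reached
  -- as limits.
  have hconst : ∀ z ∈ relationResolventSet S, ∀ a, gammaField S Γ z₀ z a = Γ a := by
    intro z hz a
    rw [← sub_eq_zero]
    refine hK.eq_zero_of_dense hmin ?_
    rintro _ ⟨w, hw, b, rfl⟩
    refine hK.isHermitianForm.eq_zero_symm ?_
    change B (gammaField S Γ z₀ w b) _ = 0
    have h1 : Tendsto (fun v => B (gammaField S Γ z₀ v b) (gammaField S Γ z₀ z a - Γ a)) (𝓝[≠] w)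
        (𝓝 (B (gammaField S Γ z₀ w b) (gammaField S Γ z₀ z a - Γ a))) := by
      have h2 : ContinuousAt (fun v => B (gammaField S Γ z₀ v b)
          (gammaField S Γ z₀ z a - Γ a)) w := by
        have h3 := continuousAt_gammaField (Γ := Γ) (z₀ := z₀) hw b
        fun_prop
      exact h2.tendsto.mono_left nhdsWithin_le_nhds
    refine tendsto_nhds_unique h1 (tendsto_const_nhds.congr' ?_)
    filter_upwards [eventually_ne_nhdsNE w (conj z), eventually_ne_nhdsNE w (conj z₀),
      nhdsWithin_le_nhds (relationResolventSet_mem_nhds hw)] with v hv1 hv2 hv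
    have h4 : ∀ {c : ℂ}, v ≠ conj c → c - conj v ≠ 0 := fun hc h0 => hc (by
      rw [sub_eq_zero.mp h0, Complex.conj_conj])
    rw [← gammaField_self (S := S) (Γ := Γ) (z₀ := z₀) a, map_sub,
      ← hrep.inner_nevanlinnaKernel ⟨trivial, hz⟩ ⟨trivial, hv⟩ (h4 hv1),
      ← hrep.inner_nevanlinnaKernel ⟨trivial, hz₀⟩ ⟨trivial, hv⟩ (h4 hv2), hT _ _ (h4 hv1),
      hT _ _ (h4 hv2), sub_self]
  obtain ⟨z, hz, hne⟩ : ∃ z ∈ relationResolventSet S, z ≠ z₀ := by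
    have h1 : ∀ᶠ z in 𝓝[≠] z₀, z ∈ relationResolventSet S :=
      nhdsWithin_le_nhds (relationResolventSet_mem_nhds hz₀)
    exact (h1.and (eventually_ne_nhdsNE z₀ z₀)).exists
  have hR : ∀ a, relationResolvent S z (Γ a) = 0 := fun a => by
    have h1 := hconst z hz a
    rw [gammaField_apply, add_eq_left] at h1
    exact (smul_eq_zero.mp h1).resolve_left (sub_ne_zero.mpr hne)
  -- A constant field means that the resolvent annihilates `ran Γ`, which is now dense by
  -- minimality; so the resolvent is zero, and an eigenvector is a multiple of its image.
  have hker : (⊤ : Submodule ℂ K) ≤ LinearMap.ker (relationResolvent S z : K →ₗ[ℂ] K) := by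
    rw [← isMinimalRelation_iff.mp hmin]
    refine Submodule.topologicalClosure_minimal _ (Submodule.span_le.mpr ?_)
      (relationResolvent S z).isClosed_ker
    rintro _ ⟨w, hw, a, rfl⟩
    rw [hconst w hw]
    exact hR a
  refine hx0 ?_
  rw [eigenvector_eq_relationResolvent hz hx,
    show relationResolvent S z x = 0 from hker trivial, smul_zero]

end Relation

/-! ### Bounded operators as linear relations -/

section Operator

variable {H : Type u} [NormedAddCommGroup H] [InnerProductSpace ℂ H] [CompleteSpace H]
variable {K : Type v} [NormedAddCommGroup K] [NormedSpace ℂ K] {B : K →L⋆[ℂ] K →L[ℂ] ℂ} {n : ℕ}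
  {A : K →L[ℂ] K} {Γ : H →L[ℂ] K} {z z₀ : ℂ} {D : Set ℂ} {Q : ℂ → H →L[ℂ] H}

theorem isSelfAdjointRelation_graph (h : IsPontryaginSpace B n) (hA : IsFormSelfAdjoint B A) :
    IsSelfAdjointRelation B (LinearMap.graph (A : K →ₗ[ℂ] K)) := by
  rintro ⟨x, y⟩
  rw [LinearMap.mem_graph_iff]
  constructor
  · rintro hy ⟨s, t⟩ ht
    rw [LinearMap.mem_graph_iff] at ht
    simp only [ContinuousLinearMap.coe_coe] at hy ht ⊢
    rw [hy, ht, hA]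
  · intro hxy
    change y = A x
    rw [← sub_eq_zero]
    refine h.eq_zero fun s => h.isHermitianForm.eq_zero_symm ?_
    have h1 := hxy (s, A s) rfl
    simp only [hA s x] at h1
    rw [map_sub, h1, sub_self]

theorem isRelationResolvent_graph (hz : z ∈ resolventSet ℂ A) :
    IsRelationResolvent (LinearMap.graph (A : K →ₗ[ℂ] K)) z (res A z) := by
  intro k x
  rw [LinearMap.mem_graph_iff]
  change k + z • x = A x ↔ x = res A z k
  constructor
  · intro h1
    exact eq_res_of_apply hz (by rw [← h1, add_sub_cancel_right])
  · rintro rfl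
    rw [apply_res hz]

theorem relationResolventSet_graph [CompleteSpace K] :
    relationResolventSet (LinearMap.graph (A : K →ₗ[ℂ] K)) = resolventSet ℂ A := by
  refine Set.Subset.antisymm ?_ fun z hz => ⟨_, isRelationResolvent_graph hz⟩
  rintro z ⟨R, hR⟩
  have h1 : ∀ k x, A x - z • x = k ↔ x = R k := fun k x => by
    rw [← hR k x, LinearMap.mem_graph_iff, ContinuousLinearMap.coe_coe, sub_eq_iff_eq_add]
    exact eq_comm
  refine mem_resolventSet_of_bijective ⟨fun x y hxy => ?_, fun k => ⟨R k, (h1 _ _).mpr rfl⟩⟩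
  rw [(h1 _ x).mp rfl, (h1 _ y).mp rfl]
  exact congrArg R hxy

/-- The choice `(A - z₀)⁻¹ Γ` for the operator of the relation representation turns its `Γ`-field
into `(A - z)⁻¹ Γ`, so both notions of minimality coincide. -/
theorem gammaField_graph (hz : z ∈ resolventSet ℂ A) (hz₀ : z₀ ∈ resolventSet ℂ A) (x : H) :
    gammaField (LinearMap.graph (A : K →ₗ[ℂ] K)) (res A z₀ ∘L Γ) z₀ z x = res A z (Γ x) := by
  rw [gammaField_apply, (isRelationResolvent_graph hz).eq, ContinuousLinearMap.comp_apply,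
    ← res_comm hz hz₀, ← res_sub_res hz hz₀, add_sub_cancel]

/-- The eigenvalues of the operator in a minimal representation `Γ⁺ (A - z)⁻¹ Γ` are generalized
poles. -/
theorem isGeneralizedPole_of_isMinimalOperator (h : IsPontryaginSpace B n)
    (hA : IsFormSelfAdjoint B A) (hmin : IsMinimalOperator A Γ)
    (hQ : ∀ z ∈ D ∩ resolventSet ℂ A, Q z = resolventFun B A Γ z)
    (hz₀ : z₀ ∈ D ∩ resolventSet ℂ A) (him : 0 < z₀.im) {α : ℂ} {x : K} (hx0 : x ≠ 0)
    (hx : A x = α • x) : IsGeneralizedPole.{u, v} D Q α := by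
  have := h.complete
  refine ⟨K, _, _, B, LinearMap.graph (A : K →ₗ[ℂ] K), res A z₀ ∘L Γ, z₀,
    ⟨⟨n, h⟩, isSelfAdjointRelation_graph h hA, ⟨hz₀.1, ?_, him⟩, fun z hz => ?_⟩, ?_, x, hx0, ?_⟩
  · rw [relationResolventSet_graph]; exact hz₀.2
  · rw [relationResolventSet_graph] at hz
    have hz' := hz.2
    have hz₀' := hz₀.2
    rw [hQ z hz, hQ z₀ hz₀]
    ext1 a
    refine ext_inner_left ℂ fun b => ?_
    rw [add_apply, inner_add_right, ContinuousLinearMap.adjoint_inner_right, inner_resolventFun,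
      smul_apply, inner_smul_right]
    change _ = _ + _ * ⟪b, gammaPlus B (res A z₀ ∘L Γ)
      (gammaField (LinearMap.graph (A : K →ₗ[ℂ] K)) (res A z₀ ∘L Γ) z₀ z a)⟫_ℂ
    rw [gammaField_graph hz' hz₀', ← inner_conj_symm b (gammaPlus _ _ _), inner_gammaPlus,
      h.isHermitianForm, inner_resolventFun_right h.isHermitianForm,
      ContinuousLinearMap.comp_apply, form_res h hA hz₀', form_res h hA hz₀', ← smul_eq_mul,
      ← map_smul, ← res_sub_res hz' (conj_mem_resolventSet h hA hz₀'), ← map_add, add_sub_cancel]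
  · rw [isMinimalRelation_iff, ← isMinimalOperator_iff_cyclicSpan.mp hmin, cyclicSpan,
      relationResolventSet_graph]
    congr 3
    ext k
    refine exists_congr fun z => and_congr_right fun hz => exists_congr fun a => ?_
    rw [gammaField_graph hz hz₀.2]
  · rw [LinearMap.mem_graph_iff]
    exact hx.symm

end Operator

/-! ### A scalar example with a generalized zero of `Q̂₁` -/

section Example

theorem isPontryaginSpace_innerSL : IsPontryaginSpace (innerSL ℂ : ℂ →L⋆[ℂ] ℂ →L[ℂ] ℂ) 0 := by
  refine ⟨inferInstance, fun x y => inner_conj_symm y x, ⊤, ⊥, isCompl_top_bot, ?_,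
    ⟨1, one_pos, ?_⟩, ?_, inferInstance, finrank_bot _ _⟩
  · rintro x - y hy
    rw [(Submodule.mem_bot ℂ).mp hy, map_zero]
  · rintro x -
    rw [one_mul, innerSL_apply_apply]
    exact (inner_self_eq_norm_sq (𝕜 := ℂ) x).ge
  · intro x hx hx0
    exact (hx0 ((Submodule.mem_bot ℂ).mp hx)).elim

theorem gammaPlus_innerSL_one :
    gammaPlus (innerSL ℂ : ℂ →L⋆[ℂ] ℂ →L[ℂ] ℂ) (1 : ℂ →L[ℂ] ℂ) = 1 := by
  ext1
  refine ext_inner_right ℂ fun y => ?_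
  rw [inner_gammaPlus]
  rfl

theorem gramInverse_innerSL_one :
    gramInverse (innerSL ℂ : ℂ →L⋆[ℂ] ℂ →L[ℂ] ℂ) (1 : ℂ →L[ℂ] ℂ) = 1 := by
  rw [gramInverse, gammaPlus_innerSL_one]
  exact Ring.inverse_one _

/-- The function `1 / (α - z)` has the generalized pole `α`, and the linear summand of its inverse
function has the generalized zero `α`. -/
theorem exists_isGeneralizedZero_hatFun₁ (α : ℝ) :
    ∃ (B' : ℂ →L⋆[ℂ] ℂ →L[ℂ] ℂ) (A' Γ' : ℂ →L[ℂ] ℂ) (κ' : ℕ),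
      IsPontryaginSpace B' κ' ∧ IsFormSelfAdjoint B' A' ∧
      IsGeneralizedNevanlinna (resolventSet ℂ A') (resolventFun B' A' Γ') κ' ∧
      IsUnit (gammaPlus B' Γ' ∘L Γ') ∧
      IsGeneralizedPole.{0, 0} (resolventSet ℂ A') (resolventFun B' A' Γ') α ∧
      IsGeneralizedZero.{0, 0} Set.univ (hatFun₁ B' A' Γ') α := by
  have hP := isPontryaginSpace_innerSL
  -- With `Γ = 1` this gives `Q(z) = 1 / (α - z)` and `Q̂₁(z) = z - α`, so `-Q̂₁⁻¹` is again `Q`,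
  -- and a single minimal representation yields both the pole and the zero.
  set A : ℂ →L[ℂ] ℂ := (α : ℂ) • 1 with hAdef
  have hA : IsFormSelfAdjoint (innerSL ℂ : ℂ →L⋆[ℂ] ℂ →L[ℂ] ℂ) A := fun x y => by
    simp [hAdef, mul_assoc, mul_left_comm]
  have hmin : IsMinimalOperator A (1 : ℂ →L[ℂ] ℂ) := by
    rw [isMinimalOperator_iff_cyclicSpan, eq_top_iff]
    exact fun x _ => (cyclicSpan_aux (Γ := (1 : ℂ →L[ℂ] ℂ)) hP hA subset_rfl (z := Complex.I)
      (by simp) (eventually_mem_resolventSet_nhdsNE hP hA (by simp)).frequently).1 x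
  have hfun : ∀ z, hatFun₁ (innerSL ℂ : ℂ →L⋆[ℂ] ℂ →L[ℂ] ℂ) A 1 z = -(A - z • 1) := fun z => by
    rw [hatFun₁, gramInverse_innerSL_one, gammaPlus_innerSL_one]
    rfl
  have hres : ∀ z, resolventFun (innerSL ℂ : ℂ →L⋆[ℂ] ℂ →L[ℂ] ℂ) A 1 z = res A z := fun z => by
    rw [resolventFun, gammaPlus_innerSL_one]
    rfl
  have hdom : ∀ z ∈ resolventSet ℂ A,
      z ∈ hatDomain Set.univ (hatFun₁ (innerSL ℂ : ℂ →L⋆[ℂ] ℂ →L[ℂ] ℂ) A 1) := fun z hz => by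
    refine ⟨trivial, ?_⟩
    rw [hfun, IsUnit.neg_iff]
    exact mem_resolventSet_iff_isUnit.mp hz
  obtain ⟨z₀, hz₀, him⟩ : ∃ z₀ ∈ resolventSet ℂ A, 0 < z₀.im := by
    have h1 : ∀ᶠ w : ℂ in 𝓝[≠] Complex.I, 0 < w.im :=
      nhdsWithin_le_nhds (Complex.continuous_im.continuousAt.eventually_const_lt (by simp))
    exact ((eventually_mem_resolventSet_nhdsNE hP hA (by simp)).and h1).exists
  have hx : A 1 = (α : ℂ) • (1 : ℂ) := rfl
  obtain ⟨κ, hκ⟩ := hP.exists_hasNegativeIndex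
    (upperSpan (resolventSet ℂ A) fun z => res A z ∘L (1 : ℂ →L[ℂ] ℂ))
  refine ⟨innerSL ℂ, A, 1, 0, hP, hA, ?_, ?_, ?_, ?_⟩
  · obtain rfl : κ = 0 := index_of_isMinimalOperator hP hA hmin hκ
    exact isGeneralizedNevanlinna_resolventFun hP hA hκ
  · rw [gammaPlus_innerSL_one]
    exact isUnit_one
  · exact isGeneralizedPole_of_isMinimalOperator hP hA hmin (fun _ _ => rfl) ⟨hz₀, hz₀⟩ him
      one_ne_zero hx
  · refine isGeneralizedPole_of_isMinimalOperator hP hA hmin (fun z hz => ?_)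
      ⟨hdom z₀ hz₀, hz₀⟩ him one_ne_zero hx
    have hu := mem_resolventSet_iff_isUnit.mp hz.2
    rw [hatFun, hfun, hres, res]
    obtain ⟨u, hu⟩ := hu
    rw [← hu, ← Units.val_neg, Ring.inverse_unit, Ring.inverse_unit]
    simp

end Example

/-! ### Reduction to a minimal representation -/

section Compression

variable {H : Type*} [NormedAddCommGroup H] [InnerProductSpace ℂ H]
variable {K : Type*} [NormedAddCommGroup K] [NormedSpace ℂ K] {B : K →L⋆[ℂ] K →L[ℂ] ℂ} {n : ℕ}
  {A : K →L[ℂ] K} {Γ : H →L[ℂ] K} {z w : ℂ}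

/-- The isotropic part of a subspace of a Pontryagin space is finite-dimensional. -/
theorem IsPontryaginSpace.finiteDimensional_of_neutral (h : IsPontryaginSpace B n)
    (M : Submodule ℂ K) (hM : ∀ x ∈ M, B x x = 0) : FiniteDimensional ℂ M := by
  obtain ⟨p, -, -, hfin, -, ⟨c, hc, hpos⟩, -⟩ := h.exists_symmetry
  refine FiniteDimensional.of_injective
    ((p : K →ₗ[ℂ] K).rangeRestrict ∘ₗ M.subtype) ((injective_iff_map_eq_zero _).mpr fun x hx => ?_)
  have h1 : p x = 0 := congrArg Subtype.val hx
  have h2 := hpos x h1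
  rw [hM x x.2, Complex.zero_re] at h2
  have h3 : ‖(x : K)‖ ^ 2 ≤ 0 := by
    by_contra h4
    push Not at h4
    nlinarith
  have h5 : ‖(x : K)‖ = 0 := by
    have := sq_nonneg ‖(x : K)‖
    exact pow_eq_zero_iff (two_ne_zero) |>.mp (le_antisymm h3 this)
  exact Subtype.ext (norm_eq_zero.mp h5)

/-- A closed subspace `M` of a Pontryagin space is the sum of its isotropic part and a Pontryagin
space `N`; `e` is the projection onto `N`. -/
theorem IsPontryaginSpace.exists_complement_isotropic (h : IsPontryaginSpace B n)
    (M : Submodule ℂ K) (hM : IsClosed (M : Set K)) :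
    ∃ (N : Submodule ℂ K) (e : K →L[ℂ] K) (m : ℕ), IsPontryaginSpace (restrictForm B N) m ∧ N ≤ M ∧
      (∀ x ∈ M, e x ∈ N) ∧ (∀ x ∈ N, e x = x) ∧ (∀ x ∈ M, x - e x ∈ M ∧ ∀ y ∈ M, B (x - e x) y = 0) ∧
      ∀ x ∈ M, (∀ y ∈ M, B x y = 0) → e x = 0 := by
  have hB := h.isHermitianForm
  let M₀ : Submodule ℂ K :=
    { carrier := {x | x ∈ M ∧ ∀ y ∈ M, B x y = 0}
      add_mem' := fun hx hy => ⟨M.add_mem hx.1 hy.1, fun y hy' => by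
        rw [map_add, add_apply, hx.2 y hy', hy.2 y hy', add_zero]⟩
      zero_mem' := ⟨M.zero_mem, fun y _ => by rw [map_zero]; rfl⟩
      smul_mem' := fun c x hx => ⟨M.smul_mem c hx.1, fun y hy => by
        rw [map_smulₛₗ, smul_apply, hx.2 y hy, smul_zero]⟩ }
  have hM₀ : ∀ x, x ∈ M₀ ↔ x ∈ M ∧ ∀ y ∈ M, B x y = 0 := fun x => Iff.rfl
  have hfin := h.finiteDimensional_of_neutral M₀ fun x hx => hx.2 x hx.1
  obtain ⟨f, hf⟩ := Submodule.ClosedComplemented.of_finiteDimensional M₀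
  let e : K →L[ℂ] K := 1 - M₀.subtypeL ∘L f
  have he : ∀ x, e x = x - f x := fun x => rfl
  -- `N` is a model of the quotient of `M` by its isotropic part `M₀`, obtained from a continuous
  -- projection onto the finite-dimensional space `M₀`.
  let N : Submodule ℂ K := M ⊓ LinearMap.ker (f : K →ₗ[ℂ] M₀)
  have hNM : N ≤ M := inf_le_left
  have hNf : ∀ x ∈ N, f x = 0 := fun x hx => hx.2
  have heN : ∀ x ∈ N, e x = x := fun x hx => by
    rw [he, hNf x hx]; simp
  have heM₀ : ∀ x ∈ M₀, e x = 0 := fun x hx => by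
    rw [he, hf ⟨x, hx⟩, sub_self]
  have hsub : ∀ x, x - e x ∈ M₀ := fun x => by
    rw [he, sub_sub_cancel]; exact (f x).2
  have hmem : ∀ x ∈ M, e x ∈ N := fun x hx => by
    refine ⟨?_, ?_⟩
    · rw [he]; exact M.sub_mem hx (f x).2.1
    · change f (e x) = 0
      rw [he, map_sub, hf, sub_self]
  -- A vector of `N` orthogonal to `N` is orthogonal to all of `M`, because `y - e y` is isotropic;
  -- so it lies in `M₀`, where `e` vanishes.
  obtain ⟨m, hm⟩ := h.restrict N (hM.inter f.isClosed_ker) fun x hx hx0 => by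
    have h1 : x ∈ M₀ := ⟨hNM hx, fun y hy => by
      have h2 := hB.eq_zero_symm ((hsub y).2 x (hNM hx))
      rwa [map_sub, hx0 _ (hmem y hy), sub_zero] at h2⟩
    rw [← heN x hx, heM₀ x h1]
  exact ⟨N, e, m, hm, hNM, hmem, heN, fun x _ => hsub x, fun x hx hx0 => heM₀ x ⟨hx, hx0⟩⟩

/-- Every function `Γ⁺ (A - z)⁻¹ Γ` has a minimal representation of the same form, in a subspace of
the given Pontryagin space. -/
theorem exists_minimal_compression [CompleteSpace H] (h : IsPontryaginSpace B n)
    (hA : IsFormSelfAdjoint B A) :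
    ∃ (N : Submodule ℂ K) (A₁ : N →L[ℂ] N) (Γ₁ : H →L[ℂ] N) (m : ℕ),
      IsPontryaginSpace (restrictForm B N) m ∧ IsFormSelfAdjoint (restrictForm B N) A₁ ∧
      IsMinimalOperator A₁ Γ₁ ∧
      gammaPlus (restrictForm B N) Γ₁ ∘L Γ₁ = gammaPlus B Γ ∘L Γ ∧
      (∀ x, gammaPlus (restrictForm B N) Γ₁ (A₁ (Γ₁ x)) = gammaPlus B Γ (A (Γ x))) ∧
      ∀ z ∈ resolventSet ℂ A ∩ resolventSet ℂ A₁,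
        resolventFun (restrictForm B N) A₁ Γ₁ z = resolventFun B A Γ z := by
  have hB := h.isHermitianForm
  set M := cyclicSpan A Γ (resolventSet ℂ A) with hMdef
  obtain ⟨hΓ, hAM, -⟩ := cyclicSpan_aux (Γ := Γ) h hA subset_rfl (z := Complex.I) (by simp)
    (eventually_mem_resolventSet_nhdsNE h hA (by simp)).frequently
  obtain ⟨N, e, m, hm, hNM, hmem, heN, hsub, hzero⟩ :=
    h.exists_complement_isotropic M (isClosed_cyclicSpan _)
  let A₁ : N →L[ℂ] N := (e ∘L A ∘L N.subtypeL).codRestrict N fun y => hmem _ (hAM y (hNM y.2))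
  let Γ₁ : H →L[ℂ] N := (e ∘L Γ).codRestrict N fun x => hmem _ (hΓ x)
  have hA₁ : ∀ y : N, (A₁ y : K) = e (A y) := fun y => rfl
  have hΓ₁ : ∀ x, (Γ₁ x : K) = e (Γ x) := fun x => rfl
  have heB : ∀ x ∈ M, ∀ y ∈ M, B (e x) y = B x y := fun x hx y hy => by
    have h1 := (hsub x hx).2 y hy
    rw [map_sub, sub_apply, sub_eq_zero] at h1
    exact h1.symm
  have heB' : ∀ x ∈ M, ∀ y ∈ M, B x (e y) = B x y := fun x hx y hy => by
    rw [← hB, heB y hy x hx, hB]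
  -- By self-adjointness `A` preserves the isotropic part of the invariant space `M`, so it descends
  -- to the quotient modelled by `N`.
  have heA : ∀ x ∈ M, e (A (e x)) = e (A x) := fun x hx => by
    rw [eq_comm, ← sub_eq_zero, ← map_sub, ← map_sub]
    refine hzero _ (hAM _ (hsub x hx).1) fun y hy => ?_
    rw [hA]
    exact (hsub x hx).2 _ (hAM y hy)
  have hsa : IsFormSelfAdjoint (restrictForm B N) A₁ := fun x y => by
    rw [restrictForm_apply, restrictForm_apply, hA₁, hA₁, heB _ (hAM _ (hNM x.2)) _ (hNM y.2),
      heB' _ (hNM x.2) _ (hAM _ (hNM y.2)), hA]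
  have hres : ∀ z ∈ resolventSet ℂ A ∩ resolventSet ℂ A₁, ∀ x,
      (res A₁ z (Γ₁ x) : K) = e (res A z (Γ x)) := fun z hz x => by
    have hu : res A z (Γ x) ∈ M := res_mem_cyclicSpan_of_mem hz.1 x
    have h1 : A₁ ⟨e (res A z (Γ x)), hmem _ hu⟩ - z • ⟨e (res A z (Γ x)), hmem _ hu⟩ = Γ₁ x := by
      refine Subtype.ext ?_
      change e (A (e (res A z (Γ x)))) - z • e (res A z (Γ x)) = e (Γ x)
      rw [heA _ hu, ← map_smul, ← map_sub, apply_res hz.1, add_sub_cancel_right]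
    rw [← eq_res_of_apply hz.2 h1]
  refine ⟨N, A₁, Γ₁, m, hm, hsa, ?_, ?_, fun x => ?_, fun z hz => ?_⟩
  · rw [isMinimalOperator_iff_cyclicSpan, eq_top_iff]
    rintro y -
    let e₁ : M →L[ℂ] N := (e ∘L M.subtypeL).codRestrict N fun x => hmem _ x.2
    have hfreq : ∃ᶠ w in 𝓝[≠] Complex.I, w ∈ resolventSet ℂ A ∩ resolventSet ℂ A₁ :=
      ((eventually_mem_resolventSet_nhdsNE h hA (by simp)).and
        (eventually_mem_resolventSet_nhdsNE hm hsa (by simp))).frequently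
    have h1 : M ≤ ((cyclicSpan A₁ Γ₁ (resolventSet ℂ A₁)).map N.subtype).topologicalClosure.comap
        (e : K →ₗ[ℂ] K) := by
      rw [hMdef, ← cyclicSpan_eq h hA (Set.inter_subset_left) (by simp) hfreq]
      refine cyclicSpan_le ((Submodule.isClosed_topologicalClosure _).preimage e.continuous)
        fun w hw x => ?_
      refine Submodule.le_topologicalClosure _ ?_
      exact ⟨_, res_mem_cyclicSpan_of_mem hw.2 x, hres w hw x⟩
    have h2 := h1 (hNM y.2)
    rw [Submodule.mem_comap, ContinuousLinearMap.coe_coe, heN _ y.2] at h2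
    have h3 : y ∈ closure (cyclicSpan A₁ Γ₁ (resolventSet ℂ A₁) : Set N) := by
      rw [Topology.IsInducing.subtypeVal.closure_eq_preimage_closure_image]
      exact h2
    rwa [(isClosed_cyclicSpan _).closure_eq] at h3
  · ext1 x
    refine ext_inner_right ℂ fun y => ?_
    rw [ContinuousLinearMap.comp_apply, ContinuousLinearMap.comp_apply, inner_gammaPlus,
      inner_gammaPlus, restrictForm_apply, hΓ₁, hΓ₁, heB _ (hΓ x) _ (hNM (hmem _ (hΓ y))),
      heB' _ (hΓ x) _ (hΓ y)]
  · refine ext_inner_right ℂ fun y => ?_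
    rw [inner_gammaPlus, inner_gammaPlus, restrictForm_apply, hA₁, hΓ₁, hΓ₁, heA _ (hΓ x),
      heB _ (hAM _ (hΓ x)) _ (hNM (hmem _ (hΓ y))), heB' _ (hAM _ (hΓ x)) _ (hΓ y)]
  · ext1 x
    refine ext_inner_right ℂ fun y => ?_
    have hu : res A z (Γ x) ∈ M := res_mem_cyclicSpan_of_mem hz.1 x
    rw [inner_resolventFun, inner_resolventFun, restrictForm_apply, hres z hz, hΓ₁,
      heB _ hu _ (hNM (hmem _ (hΓ y))), heB' _ hu _ (hΓ y)]

end Compression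

/-! ### Generalized zeros of `Q` and generalized poles of `Q̂₂` -/

section Zero

/-- Real points are limits of nonreal ones, in whose neighbourhoods `E` has points. This allows
extension by continuity to real points of resolvent sets. -/
theorem frequently_nhdsNE_of_eventually {E : Set ℂ}
    (hE : ∀ z : ℂ, z.im ≠ 0 → ∀ᶠ v in 𝓝[≠] z, v ∈ E) (z : ℂ) : ∃ᶠ v in 𝓝[≠] z, v ∈ E := by
  by_cases hz : z.im = 0
  · intro hcon
    rw [← eventually_eventually_nhdsWithin] at hcon
    obtain ⟨w, hw, hw', hwz⟩ := ((frequently_im_pos_of_real hz).and_eventually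
      (hcon.and self_mem_nhdsWithin)).exists
    rw [IsOpen.nhdsWithin_eq isOpen_compl_singleton hwz] at hw'
    obtain ⟨v, hv, hv'⟩ := ((hE w hw.ne').and (nhdsWithin_le_nhds hw')).exists
    exact hv' hv
  · exact (hE z hz).frequently

variable {H : Type u} [NormedAddCommGroup H] [InnerProductSpace ℂ H]
variable {K : Type v} [NormedAddCommGroup K] [NormedSpace ℂ K] {B : K →L⋆[ℂ] K →L[ℂ] ℂ} {n : ℕ}
  {A : K →L[ℂ] K} {Γ : H →L[ℂ] K} {z w : ℂ}

theorem span_gammaField_closure [CompleteSpace K] {S : Submodule ℂ (K × K)} {z₀ : ℂ}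
    (hmin : IsMinimalRelation S Γ z₀) {U : Set ℂ}
    (hU : ∀ z ∈ relationResolventSet S, ∃ᶠ v in 𝓝[≠] z, v ∈ U) :
    (Submodule.span ℂ {k | ∃ z ∈ U, ∃ x, k = gammaField S Γ z₀ z x}).topologicalClosure = ⊤ := by
  rw [eq_top_iff, ← isMinimalRelation_iff.mp hmin]
  refine Submodule.topologicalClosure_minimal _ (Submodule.span_le.mpr ?_)
    (Submodule.isClosed_topologicalClosure _)
  rintro _ ⟨z, hz, x, rfl⟩
  refine (Submodule.isClosed_topologicalClosure _).mem_of_frequently_of_tendsto (b := 𝓝[≠] z) ?_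
    ((continuousAt_gammaField hz x).tendsto.mono_left nhdsWithin_le_nhds)
  exact (hU z hz).mono fun v hv =>
    Submodule.le_topologicalClosure _ (Submodule.subset_span ⟨v, hv, x, rfl⟩)

variable [CompleteSpace H]

theorem continuousAt_hatGamma [CompleteSpace (complementSpace B Γ)]
    (hz : z ∈ resolventSet ℂ (tildeA B A Γ)) (x : H) :
    ContinuousAt (fun z => hatGamma B A Γ z x) z := by
  have h1 : ContinuousAt (fun z => res (tildeA B A Γ) z (tildeGamma B A Γ x)) z :=
    ((ContinuousLinearMap.apply ℂ _ (tildeGamma B A Γ x)).continuous.continuousAt).comp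
      (continuousAt_res hz)
  simp only [hatGamma_apply]
  exact continuousAt_const.sub (continuous_subtype_val.continuousAt.comp h1)

/-- The counterpart of `relationResolvent_gammaField`: for the defect field, `(Ã - w)⁻¹ (I - P)`
plays the part of the resolvent of the relation. -/
theorem hatGamma_sub_hatGamma (hG : IsUnit (gammaPlus B Γ ∘L Γ))
    (hz : z ∈ resolventSet ℂ (tildeA B A Γ)) (hw : w ∈ resolventSet ℂ (tildeA B A Γ)) (x : H) :
    hatGamma B A Γ z x - hatGamma B A Γ w x = (z - w) •
      (res (tildeA B A Γ) w (complementProj B Γ (hatGamma B A Γ z x)) : complementSpace B Γ) := by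
  rw [complementProj_hatGamma hG, map_neg, ← Submodule.coe_smul, smul_neg,
    ← res_sub_res hz hw, hatGamma_apply, hatGamma_apply, neg_sub, Submodule.coe_sub,
    sub_sub_sub_cancel_left]

/-- The Gram kernels of two representations of the same function agree, on the diagonal `z = w̄`
by continuity. -/
theorem form_gammaField_eq_form_hatGamma (h : IsPontryaginSpace B n) (hA : IsFormSelfAdjoint B A)
    (hG : IsUnit (gammaPlus B Γ ∘L Γ)) {D U : Set ℂ} {Q : ℂ → H →L[ℂ] H}
    {K' : Type*} [NormedAddCommGroup K'] [NormedSpace ℂ K'] {B' : K' →L⋆[ℂ] K' →L[ℂ] ℂ}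
    {S : Submodule ℂ (K' × K')} {Γ' : H →L[ℂ] K'} {z₀ : ℂ}
    (hrep : IsRelationRepresentation D Q B' S Γ' z₀) (hUo : IsOpen U)
    (hUS : U ⊆ D ∩ relationResolventSet S)
    (hUA : U ⊆ hatDomain (resolventSet ℂ A) (resolventFun B A Γ))
    (hQ : ∀ z ∈ U, Q z = hatFun (resolventFun B A Γ) z) (hz : z ∈ U) (hw : w ∈ U) (x y : H) :
    B' (gammaField S Γ' z₀ w y) (gammaField S Γ' z₀ z x)
      = B (hatGamma B A Γ w y) (hatGamma B A Γ z x) := by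
  obtain ⟨κ, hK'⟩ := hrep.pontryagin
  have := hK'.complete
  have := h.complete
  have : CompleteSpace (complementSpace B Γ) := (isClosed_complementSpace hG).completeSpace_coe
  have hz' := hUA hz
  rw [hatDomain_eq h hA hG] at hz'
  have h1 : Tendsto (fun v => B' (gammaField S Γ' z₀ w y) (gammaField S Γ' z₀ v x)) (𝓝[≠] z)
      (𝓝 (B' (gammaField S Γ' z₀ w y) (gammaField S Γ' z₀ z x))) :=
    (((B' _).continuous.tendsto _).comp (continuousAt_gammaField (hUS hz).2 x)).mono_left
      nhdsWithin_le_nhds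
  have h2 : Tendsto (fun v => B (hatGamma B A Γ w y) (hatGamma B A Γ v x)) (𝓝[≠] z)
      (𝓝 (B (hatGamma B A Γ w y) (hatGamma B A Γ z x))) :=
    (((B _).continuous.tendsto _).comp (continuousAt_hatGamma hz'.2 x)).mono_left
      nhdsWithin_le_nhds
  refine tendsto_nhds_unique h1 (h2.congr' ?_)
  filter_upwards [eventually_ne_nhdsNE z (conj w), nhdsWithin_le_nhds (hUo.mem_nhds hz)] with v hv hvU
  have hne := sub_ne_zero.mpr hv
  rw [← hrep.inner_nevanlinnaKernel (hUS hvU) (hUS hw) hne,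
    ← inner_nevanlinnaKernel_hatFun h hA hG (hUA hvU) (hUA hw) hne,
    nevanlinnaKernel_congr (hQ v hvU) (hQ w hw)]

theorem isOpen_hatDomain (h : IsPontryaginSpace B n) (hA : IsFormSelfAdjoint B A)
    (hG : IsUnit (gammaPlus B Γ ∘L Γ)) :
    IsOpen (hatDomain (resolventSet ℂ A) (resolventFun B A Γ)) := by
  have := h.complete
  have : CompleteSpace (complementSpace B Γ) := (isClosed_complementSpace hG).completeSpace_coe
  rw [hatDomain_eq h hA hG, isOpen_iff_mem_nhds]
  exact fun z hz => inter_mem (resolventSet_mem_nhds hz.1) (resolventSet_mem_nhds hz.2)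

theorem span_hatGamma_closure (h : IsPontryaginSpace B n) (hA : IsFormSelfAdjoint B A)
    (hG : IsUnit (gammaPlus B Γ ∘L Γ)) (hmin : IsMinimalOperator A Γ) {U : Set ℂ}
    (hUA : U ⊆ hatDomain (resolventSet ℂ A) (resolventFun B A Γ)) (hz : z.im ≠ 0)
    (hfreq : ∃ᶠ v in 𝓝[≠] z, v ∈ U) :
    (Submodule.span ℂ {k | ∃ z ∈ U, ∃ x, k = hatGamma B A Γ z x}).topologicalClosure = ⊤ := by
  rw [eq_top_iff, ← isMinimalOperator_iff_cyclicSpan.mp hmin,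
    ← cyclicSpan_eq h hA (fun v hv => (hUA hv).1) hz hfreq]
  refine cyclicSpan_le (Submodule.isClosed_topologicalClosure _) fun v hv x => ?_
  refine Submodule.le_topologicalClosure _ (Submodule.subset_span ⟨v, hv, resolventFun B A Γ v x, ?_⟩)
  exact (hatGamma_resolventFun h hA hG (hUA hv) x).symm

theorem range_uncurry {E : Type*} [NormedAddCommGroup E] [NormedSpace ℂ E] (U : Set ℂ)
    (g : ℂ → H →L[ℂ] E) :
    Set.range (fun i : U × H => g i.1 i.2) = {k | ∃ z ∈ U, ∃ x, k = g z x} := by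
  ext k
  constructor
  · rintro ⟨⟨z, x⟩, rfl⟩
    exact ⟨z, z.2, x, rfl⟩
  · rintro ⟨z, hz, x, rfl⟩
    exact ⟨⟨⟨z, hz⟩, x⟩, rfl⟩

/-- If an isometry maps the `Γ`-field of `S` onto the one of the inverse function, it maps
eigenvectors of `S` to eigenvectors of `Ã`. -/
theorem exists_eigenvector_of_intertwining (hG : IsUnit (gammaPlus B Γ ∘L Γ)) {U : Set ℂ}
    {K' : Type*} [NormedAddCommGroup K'] [NormedSpace ℂ K'] [CompleteSpace K']
    {S : Submodule ℂ (K' × K')} {Γ' : H →L[ℂ] K'} {z₀ : ℂ} (hmin' : IsMinimalRelation S Γ' z₀)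
    (hUS : U ⊆ relationResolventSet S) (hUA : U ⊆ resolventSet ℂ (tildeA B A Γ))
    (hU : ∀ z ∈ relationResolventSet S, ∃ᶠ v in 𝓝[≠] z, v ∈ U) (W : K' →L[ℂ] K)
    (hW : Function.Injective W)
    (hWγ : ∀ z ∈ U, ∀ x, W (gammaField S Γ' z₀ z x) = hatGamma B A Γ z x) (hw : w ∈ U)
    {α : ℂ} (hα : IsRelationEigenvalue S α) :
    ∃ y : complementSpace B Γ, y ≠ 0 ∧ tildeA B A Γ y = α • y := by
  set T : K' →L[ℂ] K := (complementSpace B Γ).subtypeL ∘L res (tildeA B A Γ) w ∘L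
    complementProj B Γ ∘L W with hT
  have hTapply : ∀ k, T k = (res (tildeA B A Γ) w (complementProj B Γ (W k)) : complementSpace B Γ) :=
    fun k => rfl
  -- The difference quotient identities show that `W (S - w)⁻¹` and `T` agree on the `Γ`-field at
  -- nodes other than `w`, which is total; hence they agree everywhere.
  have hker : (⊤ : Submodule ℂ K') ≤
      LinearMap.ker ((W ∘L relationResolvent S w - T : K' →L[ℂ] K) : K' →ₗ[ℂ] K) := by
    have hU' : ∀ z ∈ relationResolventSet S, ∃ᶠ v in 𝓝[≠] z, v ∈ U \ {w} := fun z hz =>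
      ((hU z hz).and_eventually (eventually_ne_nhdsNE z w)).mono fun v hv => ⟨hv.1, hv.2⟩
    rw [← span_gammaField_closure hmin' hU']
    refine Submodule.topologicalClosure_minimal _ (Submodule.span_le.mpr ?_)
      (ContinuousLinearMap.isClosed_ker _)
    rintro _ ⟨z, ⟨hz, hzw⟩, x, rfl⟩
    change W (relationResolvent S w (gammaField S Γ' z₀ z x)) - T (gammaField S Γ' z₀ z x) = 0
    have hne : z - w ≠ 0 := sub_ne_zero.mpr hzw
    rw [sub_eq_zero, hTapply, hWγ z hz]
    refine smul_right_injective K hne ?_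
    change (z - w) • _ = (z - w) • _
    rw [← map_smul, relationResolvent_gammaField (hUS hz) (hUS hw), map_sub, hWγ z hz, hWγ w hw,
      hatGamma_sub_hatGamma hG (hUA hz) (hUA hw)]
  obtain ⟨x, hx0, hx⟩ := hα
  have h1 : W x = (α - w) •
      ((res (tildeA B A Γ) w (complementProj B Γ (W x)) : complementSpace B Γ) : K) := by
    have h2 : W (relationResolvent S w x) - T x = 0 := hker (Submodule.mem_top (x := x))
    rw [hTapply, sub_eq_zero] at h2
    rw [← h2, ← map_smul, ← eigenvector_eq_relationResolvent (hUS hw) hx]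
  -- `W x` is a multiple of a vector in the range of `(Ã - w)⁻¹`, so it lies in `(I - P)K`, and the
  -- relation `h1` becomes an eigenvalue equation for `Ã`.
  have h3 : W x ∈ complementSpace B Γ := by
    rw [h1]
    exact Submodule.smul_mem _ _ (Submodule.coe_mem _)
  have h4 : complementProj B Γ (W x) = ⟨W x, h3⟩ := complementProj_coe hG ⟨W x, h3⟩
  refine ⟨⟨W x, h3⟩, fun h0 => hx0 (hW ?_), ?_⟩
  · rw [map_zero]
    exact congrArg Subtype.val h0
  · set y : complementSpace B Γ := ⟨W x, h3⟩ with hy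
    have h5 : y = (α - w) • res (tildeA B A Γ) w y := Subtype.ext (by
      rw [h4] at h1
      exact h1)
    have h6 : tildeA B A Γ y = (α - w) • tildeA B A Γ (res (tildeA B A Γ) w y) := by
      conv_lhs => rw [h5, map_smul]
    rw [h6, apply_res (hUA hw), smul_add, smul_comm, ← h5, ← add_smul, sub_add_cancel]

/-- If `Γ⁺ (A - z)⁻¹ Γ` is a minimal representation and its inverse function has the relation `S` in
a minimal representation, then the eigenvalues of `S` are eigenvalues of `Ã`. -/
theorem exists_eigenvector_tildeA (h : IsPontryaginSpace B n) (hA : IsFormSelfAdjoint B A)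
    (hG : IsUnit (gammaPlus B Γ ∘L Γ)) (hmin : IsMinimalOperator A Γ)
    {D : Set ℂ} {Q : ℂ → H →L[ℂ] H} (hD : ∀ z : ℂ, z.im ≠ 0 → ∀ᶠ v in 𝓝[≠] z, v ∈ D)
    (hDo : IsOpen D)
    (hQ : ∀ z ∈ D ∩ hatDomain (resolventSet ℂ A) (resolventFun B A Γ),
      Q z = hatFun (resolventFun B A Γ) z)
    {K' : Type*} [NormedAddCommGroup K'] [NormedSpace ℂ K'] {B' : K' →L⋆[ℂ] K' →L[ℂ] ℂ}
    {S : Submodule ℂ (K' × K')} {Γ' : H →L[ℂ] K'} {z₀ : ℂ}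
    (hrep : IsRelationRepresentation D Q B' S Γ' z₀) (hmin' : IsMinimalRelation S Γ' z₀)
    {α : ℂ} (hα : IsRelationEigenvalue S α) :
    ∃ y : complementSpace B Γ, y ≠ 0 ∧ tildeA B A Γ y = α • y := by
  obtain ⟨κ, hK'⟩ := hrep.pontryagin
  have := hK'.complete
  have := h.complete
  have : CompleteSpace (complementSpace B Γ) := (isClosed_complementSpace hG).completeSpace_coe
  have hD₁ := hatDomain_eq h hA hG
  set D₁ := hatDomain (resolventSet ℂ A) (resolventFun B A Γ)
  have hD₁o : IsOpen D₁ := isOpen_hatDomain h hA hG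
  -- On this open set both representations are available. It accumulates at every point of `ρ(S)`,
  -- so restricting the nodes to it keeps both fields total.
  set U : Set ℂ := (D ∩ D₁) ∩ relationResolventSet S with hU
  have hUo : IsOpen U := isOpen_iff_mem_nhds.mpr fun z hz =>
    inter_mem ((hDo.inter hD₁o).mem_nhds hz.1) (relationResolventSet_mem_nhds hz.2)
  have hUS : U ⊆ D ∩ relationResolventSet S := fun z hz => ⟨hz.1.1, hz.2⟩
  have hUD : U ⊆ D₁ := fun z hz => hz.1.2
  have hUA : U ⊆ resolventSet ℂ (tildeA B A Γ) := fun z hz => by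
    have := hUD hz
    rw [hD₁] at this
    exact this.2
  have hUfreq : ∀ z ∈ relationResolventSet S, ∃ᶠ v in 𝓝[≠] z, v ∈ U := fun z hz =>
    (frequently_nhdsNE_of_eventually (E := D ∩ D₁)
      (fun z hz => (hD z hz).and (eventually_mem_hatDomain h hA hG hz)) z).and_eventually
      (nhdsWithin_le_nhds (relationResolventSet_mem_nhds hz))
  have hz₀ := hrep.reference_mem.2
  obtain ⟨W, hWγ, hW⟩ := hK'.exists_isometry h
    (fun i : U × H => gammaField S Γ' z₀ i.1 i.2) (fun i : U × H => hatGamma B A Γ i.1 i.2)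
    (fun i j => form_gammaField_eq_form_hatGamma h hA hG hrep hUo hUS hUD
      (fun z hz => hQ z hz.1) j.1.2 i.1.2 _ _)
    (by rw [range_uncurry]; exact span_gammaField_closure hmin' hUfreq)
    (by
      rw [range_uncurry]
      exact span_hatGamma_closure h hA hG hmin hUD hz₀.2.ne' (hUfreq z₀ hz₀.1))
  obtain ⟨w, hw⟩ := (hUfreq z₀ hz₀.1).exists
  exact exists_eigenvector_of_intertwining hG hmin' (fun z hz => hz.2) hUA hUfreq W hW
    (fun z hz x => hWγ (⟨z, hz⟩, x)) hw hα

/-- `Q̂₁` depends only on the moments `Γ⁺Γ` and `Γ⁺AΓ`, which the minimal compression preserves. -/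
theorem hatFun₁_congr {K₁ : Type*} [NormedAddCommGroup K₁] [NormedSpace ℂ K₁]
    {B₁ : K₁ →L⋆[ℂ] K₁ →L[ℂ] ℂ} {A₁ : K₁ →L[ℂ] K₁} {Γ₁ : H →L[ℂ] K₁}
    (hG : IsUnit (gammaPlus B Γ ∘L Γ)) (hgram : gammaPlus B₁ Γ₁ ∘L Γ₁ = gammaPlus B Γ ∘L Γ)
    (hmom : ∀ x, gammaPlus B₁ Γ₁ (A₁ (Γ₁ x)) = gammaPlus B Γ (A (Γ x))) :
    hatFun₁ B₁ A₁ Γ₁ = hatFun₁ B A Γ := by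
  ext z x
  rw [hatFun₁_apply (hgram ▸ hG), hatFun₁_apply hG, hmom, gramInverse, hgram, gramInverse]

/-- Generalized zeros of `Γ⁺ (A - z)⁻¹ Γ` are generalized poles of the second summand of its inverse
function. -/
theorem isGeneralizedPole_hatFun₂ (h : IsPontryaginSpace B n) (hA : IsFormSelfAdjoint B A)
    (hG : IsUnit (gammaPlus B Γ ∘L Γ)) {α : ℂ}
    (hα : IsGeneralizedZero.{u, v} (resolventSet ℂ A) (resolventFun B A Γ) α) :
    IsGeneralizedPole.{u, v} (resolventSet ℂ (tildeA B A Γ)) (hatFun₂ B A Γ) α := by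
  obtain ⟨K', _, _, B', S, Γ', z₀, hrep, hmin', hS⟩ := hα
  -- The given representation need not be minimal, whereas both the isometry and the minimality of
  -- the representation of `Q̂₂` require it.
  obtain ⟨N, A₁, Γ₁, m₁, h₁, hA₁, hmin, hgram, hmom, hres⟩ :=
    exists_minimal_compression (Γ := Γ) h hA
  have := h.complete
  have := h₁.complete
  set B₁ := restrictForm B N
  have hG₁ : IsUnit (gammaPlus B₁ Γ₁ ∘L Γ₁) := hgram ▸ hG
  have hc : CompleteSpace (complementSpace B Γ) :=
    (isClosed_complementSpace hG).completeSpace_coe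
  have hc₁ : CompleteSpace (complementSpace B₁ Γ₁) :=
    (isClosed_complementSpace hG₁).completeSpace_coe
  obtain ⟨m, hm⟩ := exists_isPontryaginSpace_complementSpace h hG
  obtain ⟨m', hm'⟩ := exists_isPontryaginSpace_complementSpace h₁ hG₁
  have hAt := isFormSelfAdjoint_tildeA h.isHermitianForm hA hG
  have hAt₁ := isFormSelfAdjoint_tildeA h₁.isHermitianForm hA₁ hG₁
  have hhat : ∀ z ∈ hatDomain (resolventSet ℂ A) (resolventFun B A Γ) ∩
      hatDomain (resolventSet ℂ A₁) (resolventFun B₁ A₁ Γ₁),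
      hatFun (resolventFun B A Γ) z = hatFun (resolventFun B₁ A₁ Γ₁) z := fun z hz => by
    rw [hatFun, hatFun, hres z ⟨hz.1.1, hz.2.1⟩]
  obtain ⟨y, hy0, hy⟩ := exists_eigenvector_tildeA h₁ hA₁ hG₁ hmin
    (fun z hz => eventually_mem_hatDomain h hA hG hz)
    (isOpen_hatDomain h hA hG) hhat hrep hmin' hS
  have hfreq := frequently_nhdsNE_of_eventually
    (E := hatDomain (resolventSet ℂ A) (resolventFun B A Γ) ∩
      hatDomain (resolventSet ℂ A₁) (resolventFun B₁ A₁ Γ₁)) fun z hz =>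
    (eventually_mem_hatDomain h hA hG hz).and (eventually_mem_hatDomain h₁ hA₁ hG₁ hz)
  -- Where both inverse functions are defined they agree, and so do their linear summands; hence the
  -- second summands agree there, and elsewhere by continuity.
  have heq : ∀ z ∈ resolventSet ℂ (tildeA B A Γ) ∩ resolventSet ℂ (tildeA B₁ A₁ Γ₁),
      hatFun₂ B A Γ z = hatFun₂ B₁ A₁ Γ₁ z := fun z hz => by
    have h1 : Tendsto (fun v => hatFun₂ B A Γ v - hatFun₂ B₁ A₁ Γ₁ v) (𝓝[≠] z)
        (𝓝 (hatFun₂ B A Γ z - hatFun₂ B₁ A₁ Γ₁ z)) :=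
      ((analyticAt_resolventFun hz.1).continuousAt.sub
        (analyticAt_resolventFun hz.2).continuousAt).tendsto.mono_left nhdsWithin_le_nhds
    refine sub_eq_zero.mp (isClosed_singleton.mem_of_frequently_of_tendsto ((hfreq z).mono ?_) h1)
    intro v hv
    have h2 := hhat v hv
    rw [hatFun_eq h hA hG hv.1, hatFun_eq h₁ hA₁ hG₁ hv.2, hatFun₁_congr hG hgram hmom,
      add_right_inj] at h2
    exact sub_eq_zero.mpr h2
  obtain ⟨z₁, hz₁, him⟩ : ∃ z₁ ∈ resolventSet ℂ (tildeA B A Γ) ∩ resolventSet ℂ (tildeA B₁ A₁ Γ₁),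
      0 < z₁.im := by
    have h1 : ∀ᶠ w : ℂ in 𝓝[≠] Complex.I, 0 < w.im :=
      nhdsWithin_le_nhds (Complex.continuous_im.continuousAt.eventually_const_lt (by simp))
    exact (((eventually_mem_resolventSet_nhdsNE hm hAt (by simp)).and
      (eventually_mem_resolventSet_nhdsNE hm' hAt₁ (by simp))).and h1).exists
  exact isGeneralizedPole_of_isMinimalOperator hm' hAt₁ (isMinimalOperator_tilde h₁ hA₁ hG₁ hmin)
    heq hz₁ him hy0 hy

end Zero

/-! ### Assembly of the theorem -/

theorem theorem3 {H : Type u} [NormedAddCommGroup H] [InnerProductSpace ℂ H] [CompleteSpace H]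
    {K : Type v} [NormedAddCommGroup K] [NormedSpace ℂ K]
    (B : K →L⋆[ℂ] K →L[ℂ] ℂ) (κK : ℕ) (hK : IsPontryaginSpace B κK)
    (A : K →L[ℂ] K) (hA : IsFormSelfAdjoint B A) (Γ₀ : H →L[ℂ] K)
    (κ : ℕ) (hQ : IsGeneralizedNevanlinna (resolventSet ℂ A) (resolventFun B A Γ₀) κ)
    (hΓ : IsUnit (gammaPlus B Γ₀ ∘L Γ₀))
    (α : ℝ) (hα : IsGeneralizedPole.{u, v} (resolventSet ℂ A) (resolventFun B A Γ₀) α) :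
    ∃ κ₁ κ₂ : ℕ,
      -- the desirable decomposition of the inverse function
      IsGeneralizedNevanlinna (hatDomain (resolventSet ℂ A) (resolventFun B A Γ₀))
        (hatFun (resolventFun B A Γ₀)) κ ∧
      IsGeneralizedNevanlinna Set.univ (hatFun₁ B A Γ₀) κ₁ ∧
      IsGeneralizedNevanlinna (resolventSet ℂ (tildeA B A Γ₀)) (hatFun₂ B A Γ₀) κ₂ ∧
      κ₁ + κ₂ = κ ∧
      hatDomain (resolventSet ℂ A) (resolventFun B A Γ₀) ⊆ resolventSet ℂ (tildeA B A Γ₀) ∧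
      (∀ z ∈ hatDomain (resolventSet ℂ A) (resolventFun B A Γ₀),
        hatFun (resolventFun B A Γ₀) z = hatFun₁ B A Γ₀ z + hatFun₂ B A Γ₀ z) ∧
      -- (i) a linear polynomial without generalized poles, ...
      (∃ S T : H →L[ℂ] H, ∀ z : ℂ, hatFun₁ B A Γ₀ z = S + z • T) ∧
      (∀ β : ℂ, ¬ IsGeneralizedPole.{u, v} Set.univ (hatFun₁ B A Γ₀) β) ∧
      -- ... for which a generalized zero at `α` is possible under the same hypotheses
      (∃ (B' : ℂ →L⋆[ℂ] ℂ →L[ℂ] ℂ) (A' Γ' : ℂ →L[ℂ] ℂ) (κ' : ℕ),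
        IsPontryaginSpace B' κ' ∧ IsFormSelfAdjoint B' A' ∧
        IsGeneralizedNevanlinna (resolventSet ℂ A') (resolventFun B' A' Γ') κ' ∧
        IsUnit (gammaPlus B' Γ' ∘L Γ') ∧
        IsGeneralizedPole.{0, 0} (resolventSet ℂ A') (resolventFun B' A' Γ') α ∧
        IsGeneralizedZero.{0, 0} Set.univ (hatFun₁ B' A' Γ') α) ∧
      -- (ii) the index of the first summand
      Module.rank ℂ (negativeEigenspace (gramInverse B Γ₀)) = (κ₁ : Cardinal.{u}) ∧
      -- (iii) generalized zeros of `Q` are generalized poles of the second summand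
      (IsGeneralizedZero.{u, v} (resolventSet ℂ A) (resolventFun B A Γ₀) α →
        IsGeneralizedPole.{u, v} (resolventSet ℂ (tildeA B A Γ₀)) (hatFun₂ B A Γ₀) α) ∧
      -- (iv) the representation of the second summand in the Pontryagin space `(I - P) K`
      (∃ κ₃ : ℕ, κ₁ + κ₃ = κK ∧
        IsPontryaginSpace (restrictForm B (complementSpace B Γ₀)) κ₃) ∧
      IsFormSelfAdjoint (restrictForm B (complementSpace B Γ₀)) (tildeA B A Γ₀) ∧
      (IsMinimalOperator A Γ₀ →
        IsPontryaginSpace (restrictForm B (complementSpace B Γ₀)) κ₂ ∧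
        IsMinimalOperator (tildeA B A Γ₀) (tildeGamma B A Γ₀)) := by
  have hB := hK.isHermitianForm
  have hind := hQ.hasNegativeIndex hK hA
  obtain ⟨m, hm⟩ := exists_isPontryaginSpace_complementSpace hK hΓ
  have hAt := isFormSelfAdjoint_tildeA hB hA hΓ
  obtain ⟨κ₁, hκ₁⟩ := hK.exists_hasNegativeIndex (LinearMap.range (Γ₀ : H →ₗ[ℂ] K))
  obtain ⟨κ₂, hκ₂⟩ := hm.exists_hasNegativeIndex (upperSpan (resolventSet ℂ (tildeA B A Γ₀))
    fun z => res (tildeA B A Γ₀) z ∘L tildeGamma B A Γ₀)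
  have hindex := index_complementSpace hK hΓ hκ₁ hm
  refine ⟨κ₁, κ₂, isGeneralizedNevanlinna_hatFun hK hA hΓ (hasNegativeIndex_hatGamma hK hA hΓ hind),
    isGeneralizedNevanlinna_hatFun₁ hB hA hΓ hκ₁,
    isGeneralizedNevanlinna_resolventFun hm hAt hκ₂, index_add_index hK hA hΓ hind hκ₁ hκ₂,
    fun z hz => ?_, fun z hz => hatFun_eq hK hA hΓ hz, ⟨_, _, hatFun₁_eq hΓ⟩, fun β => ?_,
    exists_isGeneralizedZero_hatFun₁ α, rank_negativeEigenspace_gramInverse hB hΓ hκ₁,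
    isGeneralizedPole_hatFun₂ hK hA hΓ, ⟨m, hindex, hm⟩, hAt, fun hmin => ?_⟩
  · rw [hatDomain_eq hK hA hΓ] at hz
    exact hz.2
  · refine not_isGeneralizedPole_of_nevanlinnaKernel_eq (T := gramInverse B Γ₀)
      (fun z w hzw => ?_) β
    ext1 x
    refine ext_inner_left ℂ fun y => ?_
    exact inner_nevanlinnaKernel_hatFun₁ hB hA hΓ hzw x y
  · have hmin' := isMinimalOperator_tilde hK hA hΓ hmin
    -- Minimality makes the cyclic span dense in `(I - P)K`, so the number of negative squares of
    -- `Q̂₂` is the full index of the space.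
    obtain rfl : κ₂ = m := index_of_isMinimalOperator hm hAt hmin' hκ₂
    exact ⟨hm, hmin'⟩
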